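/- Let $0\le p\le d$ be integers, $N=\min(p+2,d-p)$, and consider two scalar $p$-dimensional conformal defects in $d$-dimensional Euclidean space. The corresponding symmetric pair is $G=SO(d+1,1)_0$, $H=SO(d-p)\times SO(p+1,1)_0$ (embedded block-diagonally), with the involution $\sigma$ of $G$ given by conjugation with $\operatorname{diag}(1_{d-p},-1_{p+2})$, the Cartan involution $\theta(X)=-X^T$ of $\mathfrak g=\mathfrak{so}(d+1,1)=\mathfrak k\oplus\mathfrak p$, and the trace form $B(X,Y)=\operatorname{tr}(XY)$. A scalar defect block is a zonal spherical function, i.e. a smooth $f:G\to\mathbb C$ with $f(hgh')=f(g)$ for all $g\in G$, $h,h'\in H$. Let $\Omega=\sum_i b_ib^i$ ($b_i,b^i$ bases of $\mathfrak g$ that are dual with respect to $B$) be the quadratic Casimir element; it acts on such $f$ by left-invariant differential operators ($(X\cdot f)(g)=\frac{d}{ds}f(g\exp(sX))|_{s=0}$) and by right-invariant ones ($(f\cdot X)(g)=\frac{d}{ds}f(\exp(sX)g)|_{s=0}$). Let $\mathfrak t$ be any maximal commutative subspace of $\mathfrak k^{-\sigma}$ and $\mathfrak c\supseteq\mathfrak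 t$ a maximal commutative subspace of $\mathfrak g^{-\sigma}$; put $\mathfrak a=\mathfrak c\cap\mathfrak p$ and $T=\exp(\mathfrak t)$. A standard Cartan subset is a set $C'=\exp(\mathfrak c')\tau\subseteq G$ with $\tau\in T$, where $\mathfrak c'\subseteq\mathfrak g^{-\sigma}\cap\operatorname{Ad}(\tau)(\mathfrak g^{-\sigma})$ is commutative with $\dim\mathfrak c'=\dim\mathfrak c$ and $\mathfrak c'=\mathfrak t'\oplus\mathfrak a'$ for some $\mathfrak t'\subseteq\mathfrak t$, $\mathfrak a\subseteq\mathfrak a'\subseteq\mathfrak p$. An element $g\in G$ is regular semisimple if $\sigma\operatorname{Ad}(g)\sigma\operatorname{Ad}(g)^{-1}$ is a semisimple automorphism of $\mathfrak g$ and $\mathfrak g^{-\sigma}\cap\operatorname{Ad}(g)(\mathfrak g^{-\sigma})$ is commutative. Let $\Sigma$ be the set of non-zero $\gamma\in(\mathfrak c'_{\mathbb C})^*$ whose root space $\mathfrak g_\gamma=\{X\in\mathfrak g_{\mathbb C}:[Z,X]=\gamma(Z)X\ \forall Z\in\mathfrak c'\}$ is non-zero, and set $R=2\Sigma$, $k_{2\gamma}=\tfrac12\dim_{\mathbb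 C}\mathfrak g_\gamma$. **Theorem.** For every standard Cartan subset $C'=\exp(\mathfrak c')\tau$ the following hold. (i) $\dim\mathfrak c'=N$, and $B$ is non-degenerate on $\mathfrak g$ and on $\mathfrak c'$. (ii) There is a $\mathbb C$-basis $\varepsilon_1,\dots,\varepsilon_N$ of $(\mathfrak c'_{\mathbb C})^*$, orthogonal with $B^*(\varepsilon_i,\varepsilon_i)=r>0$ independent of $i$, such that $R$ is the root system $\{\pm\varepsilon_i\}\cup\{\pm\varepsilon_i\pm\varepsilon_j: i\ne j\}$ of type $B_N$ if $d\neq 2p+2$, and the root system $\{\pm\varepsilon_i\pm\varepsilon_j:i\ne j\}$ of type $D_N$ if $d=2p+2$. The multiplicities are $k_{\mathrm{short}}=k_{\pm\varepsilon_i}=\frac{|d-2-2p|}{2}$ (which is $0$ in the $D_N$ case) and $k_{\mathrm{long}}=k_{\pm\varepsilon_i\pm\varepsilon_j}=\frac12$. (iii) There is $t_0\in T$ with $t_0^2=1$ and $C'=\exp(\mathfrak c')t_0$ such that, for every $X\in\mathfrak c'$ for which $x=\exp(X)t_0$ is regular semisimple, one has $e^{\alpha(X)}\ne1$ for all $\alpha\in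 R$, and for every scalar defect block $f$ $$(\Omega\cdot f)(x)=(f\cdot\Omega)(x)=(L(k)u)(X),\qquad u(Y)=f(\exp(Y)t_0)\quad(Y\in\mathfrak c'),$$ where $$L(k)=\sum_{i=1}^N\partial_{\xi_i}^2+\sum_{\alpha\in R^+}k_\alpha\frac{1+e^{-\alpha}}{1-e^{-\alpha}}\,\partial_\alpha$$ is the Heckman–Opdam Laplacian. Here $R^+\subset R$ is any system of positive roots, $\xi_1,\dots,\xi_N$ is any orthonormal basis of the Euclidean space $(\operatorname{span}_{\mathbb R}R,B^*)$, and $\partial_\lambda$ is the (complex-linearly extended) directional derivative along the vector of $\mathfrak c'_{\mathbb C}$ that corresponds to $\lambda$ under $B$. -/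

import Mathlib

open Matrix
open scoped ContDiff

noncomputable section

namespace Defect

/-! ### The groups and Lie algebras -/

/-- The signature `(1, …, 1, -1)` on `m + 1` coordinates. -/
def lorentz (m : ℕ) : Fin (m + 1) → ℝ := fun i => if i = Fin.last m then -1 else 1

/-- The special orthogonal group of the diagonal form `∑ i, η i * x i ^ 2`. -/
def SO {n : Type} [Fintype n] [DecidableEq n] (η : n → ℝ) : Set (Matrix n n ℝ) :=
  {g | gᵀ * diagonal η * g = diagonal η ∧ g.det = 1}

/-- The identity component of the special orthogonal group of the diagonal form `η`. -/
def SO₀ {n : Type} [Fintype n] [DecidableEq n] (η : n → ℝ) : Set (Matrix n n ℝ) :=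
  connectedComponentIn (SO η) 1

/-- Index set of the `d + 2` coordinates (for `p ≤ d`): the first `d - p` ones, and the
last `p + 2` ones. -/
abbrev Idx (d p : ℕ) : Type := Fin (d - p) ⊕ Fin (p + 2)

/-- Real square matrices of size `d + 2`. -/
abbrev Mat (d p : ℕ) : Type := Matrix (Idx d p) (Idx d p) ℝ

/-- Complex square matrices of size `d + 2`. -/
abbrev MatC (d p : ℕ) : Type := Matrix (Idx d p) (Idx d p) ℂ

/-- The signature `(1, …, 1, -1)` on the `d + 2` coordinates. -/
def sig (d p : ℕ) : Idx d p → ℝ := Sum.elim (fun _ => 1) (lorentz (p + 1))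

/-- `G = SO(d+1,1)₀`. -/
def G (d p : ℕ) : Set (Mat d p) := SO₀ (sig d p)

/-- `H = SO(d-p) × SO(p+1,1)₀`, embedded block-diagonally in `G`. -/
def H (d p : ℕ) : Set (Mat d p) :=
  {h | ∃ A ∈ specialOrthogonalGroup (Fin (d - p)) ℝ, ∃ D ∈ SO₀ (lorentz (p + 1)),
    h = fromBlocks A 0 0 D}

/-- The Lie algebra `𝔤 = 𝔰𝔬(d+1,1)` of `G`. -/
def lieG (d p : ℕ) : Submodule ℝ (Mat d p) := skewAdjointMatricesSubmodule (diagonal (sig d p))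

/-- The complexified Lie algebra `𝔤_ℂ`. -/
def lieGC (d p : ℕ) : Submodule ℂ (MatC d p) :=
  skewAdjointMatricesSubmodule (diagonal fun i => (sig d p i : ℂ))

/-- The diagonal matrix with blocks `1_{d-p}` and `-1_{p+2}`. -/
def sigmaMat (d p : ℕ) : Mat d p := fromBlocks 1 0 0 (-1)

/-- The involution `σ`: conjugation with `diag(1_{d-p}, -1_{p+2})`. -/
def sigma (d p : ℕ) : Mat d p →ₗ[ℝ] Mat d p where
  toFun X := sigmaMat d p * X * sigmaMat d p
  map_add' X Y := by rw [Matrix.mul_add, Matrix.add_mul]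
  map_smul' c X := by simp

/-- The subspace `𝔤^{-σ}` of `σ`-antiinvariant elements of `𝔤`. -/
def lieGMinus (d p : ℕ) : Submodule ℝ (Mat d p) :=
  lieG d p ⊓ LinearMap.ker (sigma d p + LinearMap.id)

/-- The `+1`-eigenspace `𝔨` of the Cartan involution `θ X = -Xᵀ` of `𝔤`. -/
def lieK (d p : ℕ) : Submodule ℝ (Mat d p) :=
  lieG d p ⊓ LinearMap.ker ((transposeLinearEquiv (Idx d p) (Idx d p) ℝ ℝ).toLinearMap + LinearMap.id)

/-- The `-1`-eigenspace `𝔭` of the Cartan involution `θ X = -Xᵀ` of `𝔤`. -/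
def lieP (d p : ℕ) : Submodule ℝ (Mat d p) :=
  lieG d p ⊓ LinearMap.ker ((transposeLinearEquiv (Idx d p) (Idx d p) ℝ ℝ).toLinearMap - LinearMap.id)

/-! ### Cartan subsets -/

/-- A linear subspace of matrices is commutative. -/
def IsComm {n : Type} [Fintype n] (V : Submodule ℝ (Matrix n n ℝ)) : Prop :=
  ∀ X ∈ V, ∀ Y ∈ V, X * Y = Y * X

/-- `V` is a maximal commutative subspace of `U`. -/
def IsMaxComm {n : Type} [Fintype n] (U V : Submodule ℝ (Matrix n n ℝ)) : Prop :=
  Maximal (fun W : Submodule ℝ (Matrix n n ℝ) => W ≤ U ∧ IsComm W) V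

/-- The set `exp(V) t`. -/
def expCoset {n : Type} [Fintype n] [DecidableEq n] (V : Submodule ℝ (Matrix n n ℝ))
    (t : Matrix n n ℝ) : Set (Matrix n n ℝ) :=
  {x | ∃ X ∈ V, x = NormedSpace.exp X * t}

/-- `𝔱` is maximal commutative in `𝔨^{-σ}`, and `𝔠` is a maximal commutative subspace of `𝔤^{-σ}`
containing it (then `𝔠 = 𝔱 ⊕ 𝔞` with `𝔞 = 𝔠 ∩ 𝔭`). The fundamental Cartan subset
is `C = exp(𝔠)`, and `T = exp(𝔱)`. -/
structure IsFundamentalCartan (d p : ℕ) (t c : Submodule ℝ (Mat d p)) : Prop where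
  maximal_t : IsMaxComm (lieK d p ⊓ lieGMinus d p) t
  maximal_c : IsMaxComm (lieGMinus d p) c
  le : t ≤ c

/-- `C' = exp(𝔠') τ` is a standard Cartan subset with respect to the fundamental Cartan subset
given by `𝔱` and `𝔠`. -/
structure IsStandardCartan (d p : ℕ) (t c c' : Submodule ℝ (Mat d p)) (τ : Mat d p) : Prop where
  mem_T : τ ∈ expCoset t 1
  le_minus : c' ≤ lieGMinus d p
  le_Ad : ∀ X ∈ c', τ⁻¹ * X * τ ∈ lieGMinus d p
  comm : IsComm c'
  decomp : ∃ t' a' : Submodule ℝ (Mat d p),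
    c' = t' ⊔ a' ∧ t' ≤ t ∧ c ⊓ lieP d p ≤ a' ∧ a' ≤ lieP d p
  finrank_eq : Module.finrank ℝ c' = Module.finrank ℝ c

/-- `g` is a semisimple element of `G`: the automorphism `σ ∘ Ad(g) ∘ σ ∘ Ad(g)⁻¹` of `𝔤`
is semisimple. -/
def IsSemisimpleElt (d p : ℕ) (g : Mat d p) : Prop :=
  g ∈ G d p ∧ ∃ S : Module.End ℝ (lieG d p), S.IsSemisimple ∧
    ∀ Y : lieG d p, (S Y : Mat d p) = sigma d p (g * sigma d p (g⁻¹ * (Y : Mat d p) * g) * g⁻¹)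

/-- `g` is a regular semisimple element of `G`: it is semisimple and
`𝔤^{-σ} ∩ Ad(g)(𝔤^{-σ})` is commutative. -/
def IsRegularSemisimple (d p : ℕ) (g : Mat d p) : Prop :=
  IsSemisimpleElt d p g ∧
    ∀ X ∈ lieGMinus d p, ∀ Y ∈ lieGMinus d p, g⁻¹ * X * g ∈ lieGMinus d p →
      g⁻¹ * Y * g ∈ lieGMinus d p → X * Y = Y * X

/-! ### Zonal spherical functions and the quadratic Casimir element -/

section Smooth

attribute [local instance] Matrix.linftyOpNormedAddCommGroup Matrix.linftyOpNormedSpace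

/-- `f` is smooth on the (embedded) submanifold `S` of the space of matrices. -/
def IsSmoothOn {n : Type} [Fintype n] (f : Matrix n n ℝ → ℂ) (S : Set (Matrix n n ℝ)) : Prop :=
  ContDiffOn ℝ ∞ f S

end Smooth

/-- A scalar block for two `p`-dimensional defects: a zonal spherical function for `(G, H)`, i.e.
a smooth function on `G` that is invariant under `H` from both sides. (Functions on `G` are
represented by functions on matrices whose values outside `G` play no role.) -/
structure IsDefectBlock (d p : ℕ) (f : Mat d p → ℂ) : Prop where
  smooth : IsSmoothOn f (G d p)
  invariant : ∀ g ∈ G d p, ∀ h ∈ H d p, ∀ h' ∈ H d p, f (h * g * h') = f g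

/-- Two bases of `V` that are dual to each other for the trace form `B(X, Y) = tr(XY)`. -/
structure TraceDualBases {n : Type} [Fintype n] (V : Submodule ℝ (Matrix n n ℝ)) (m : ℕ) where
  b : Module.Basis (Fin m) ℝ V
  b' : Module.Basis (Fin m) ℝ V
  dual : ∀ i j, trace ((b i : Matrix n n ℝ) * (b' j : Matrix n n ℝ)) = if i = j then 1 else 0

/-- The action `X · f` by the left-invariant vector field of `X`. -/
def leftInv {n : Type} [Fintype n] [DecidableEq n] (X : Matrix n n ℝ) (f : Matrix n n ℝ → ℂ)
    (g : Matrix n n ℝ) : ℂ :=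
  deriv (fun s : ℝ => f (g * NormedSpace.exp (s • X))) 0

/-- The action `f · X` by the right-invariant vector field of `X`. -/
def rightInv {n : Type} [Fintype n] [DecidableEq n] (X : Matrix n n ℝ) (f : Matrix n n ℝ → ℂ)
    (g : Matrix n n ℝ) : ℂ :=
  deriv (fun s : ℝ => f (NormedSpace.exp (s • X) * g)) 0

/-- The function `Ω · f`, where `Ω = ∑ i, b i * b' i` is the quadratic Casimir element. -/
def casimirLeft {n : Type} [Fintype n] [DecidableEq n] {V : Submodule ℝ (Matrix n n ℝ)} {m : ℕ}
    (D : TraceDualBases V m) (f : Matrix n n ℝ → ℂ) (g : Matrix n n ℝ) : ℂ :=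
  ∑ i, leftInv (D.b i : Matrix n n ℝ) (leftInv (D.b' i : Matrix n n ℝ) f) g

/-- The function `f · Ω`, where `Ω = ∑ i, b i * b' i` is the quadratic Casimir element. -/
def casimirRight {n : Type} [Fintype n] [DecidableEq n] {V : Submodule ℝ (Matrix n n ℝ)} {m : ℕ}
    (D : TraceDualBases V m) (f : Matrix n n ℝ → ℂ) (g : Matrix n n ℝ) : ℂ :=
  ∑ i, rightInv (D.b' i : Matrix n n ℝ) (rightInv (D.b i : Matrix n n ℝ) f) g

/-! ### Roots with respect to `𝔠'`

Linear forms on `𝔠'_ℂ` are given by their restrictions to `𝔠'`, i.e. by `ℝ`-linear maps `𝔠' → ℂ`. -/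

/-- The complex dual space of `𝔠'_ℂ`. -/
abbrev Form {d p : ℕ} (c' : Submodule ℝ (Mat d p)) : Type := c' →ₗ[ℝ] ℂ

/-- The space `𝔤_γ = {X ∈ 𝔤_ℂ | [Z, X] = γ(Z) X for all Z ∈ 𝔠'}`. -/
def rootSpace {d p : ℕ} (c' : Submodule ℝ (Mat d p)) (γ : Form c') : Submodule ℂ (MatC d p) where
  carrier := {X | X ∈ lieGC d p ∧ ∀ Z : c',
    (Z : Mat d p).map Complex.ofReal * X - X * (Z : Mat d p).map Complex.ofReal = γ Z • X}
  add_mem' := by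
    rintro X Y ⟨hX, hX'⟩ ⟨hY, hY'⟩
    refine ⟨add_mem hX hY, fun Z => ?_⟩
    rw [smul_add, ← hX' Z, ← hY' Z, Matrix.mul_add, Matrix.add_mul]
    abel
  zero_mem' := ⟨zero_mem _, fun Z => by simp⟩
  smul_mem' := by
    rintro a X ⟨hX, hX'⟩
    refine ⟨Submodule.smul_mem _ a hX, fun Z => ?_⟩
    rw [smul_comm, ← hX' Z, Matrix.mul_smul, Matrix.smul_mul, smul_sub]

/-- The set of roots `Σ(𝔤 : 𝔠')`. -/
def roots {d p : ℕ} (c' : Submodule ℝ (Mat d p)) : Set (Form c') :=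
  {γ | γ ≠ 0 ∧ rootSpace c' γ ≠ ⊥}

/-- The rescaled root set `R = 2 Σ(𝔤 : 𝔠')`. -/
def doubledRoots {d p : ℕ} (c' : Submodule ℝ (Mat d p)) : Set (Form c') :=
  {α | ∃ γ ∈ roots c', α = (2 : ℂ) • γ}

/-- The multiplicity parameter `k_{2γ} = dim(𝔤_γ) / 2`. -/
def mult {d p : ℕ} (c' : Submodule ℝ (Mat d p)) (α : Form c') : ℝ :=
  (Module.finrank ℂ (rootSpace c' ((1 / 2 : ℂ) • α)) : ℝ) / 2

/-- The `ℂ`-bilinear form `B*` on the dual space that is induced by the trace form. -/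
def dualForm {d p m : ℕ} {c' : Submodule ℝ (Mat d p)} (D : TraceDualBases c' m)
    (lam μ : Form c') : ℂ :=
  ∑ i, lam (D.b i) * μ (D.b' i)

/-- The derivative `∂_λ` in the direction of the vector of `𝔠'_ℂ` that corresponds to
the form `λ` under the trace form, extended complex-linearly from real directions. -/
def dirDeriv {d p m : ℕ} {c' : Submodule ℝ (Mat d p)} (D : TraceDualBases c' m)
    (lam : Form c') (u : c' → ℂ) (X : c') : ℂ :=
  ∑ i, lam (D.b i) * lineDeriv ℝ u X (D.b' i)

/-- `ξ` is an orthonormal basis of the Euclidean space given by the real span of `R`, of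
dimension `N`, with the inner product `B*`. -/
def IsOrthonormalFrame {d p m N : ℕ} {c' : Submodule ℝ (Mat d p)} (D : TraceDualBases c' m)
    (R : Set (Form c')) (ξ : Fin N → Form c') : Prop :=
  (∀ i j, dualForm D (ξ i) (ξ j) = if i = j then 1 else 0) ∧
    Submodule.span ℝ (Set.range ξ) = Submodule.span ℝ R

/-- `P` is a system of positive roots in `R`. -/
def IsPositiveSystem {d p : ℕ} {c' : Submodule ℝ (Mat d p)} (R : Set (Form c'))
    (P : Finset (Form c')) : Prop :=
  ∃ ℓ : Form c' →ₗ[ℝ] ℝ, (∀ α ∈ R, ℓ α ≠ 0) ∧ (P : Set (Form c')) = {α ∈ R | 0 < ℓ α}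

/-- The Heckman–Opdam Laplacian
`L(k) = ∑ i, ∂_{ξ i}² + ∑_{α > 0} k_α (1 + e^{-α}) / (1 - e^{-α}) ∂_α`
with `e^α(X) = exp(α(X))`, where `ξ` is an orthonormal basis and `P` is the set of positive roots,
acting on functions of `X ∈ 𝔠'`. -/
def heckmanOpdam {d p m N : ℕ} {c' : Submodule ℝ (Mat d p)} (D : TraceDualBases c' m)
    (ξ : Fin N → Form c') (P : Finset (Form c')) (k : Form c' → ℝ) (u : c' → ℂ) (X : c') : ℂ :=
  ∑ i, dirDeriv D (ξ i) (dirDeriv D (ξ i) u) X +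
    ∑ α ∈ P, (k α : ℂ) * ((1 + Complex.exp (-α X)) / (1 - Complex.exp (-α X))) * dirDeriv D α u X

/-! ### The root systems of type `B` and `D` -/

/-- The short roots `± e_i` of `B_N`. -/
def shortRoots (N : ℕ) : Set (Fin N → ℤ) :=
  {v | ∃ i, ∃ s : ℤ, (s = 1 ∨ s = -1) ∧ v = Pi.single i s}

/-- The long roots `± e_i ± e_j` (`i ≠ j`) of `B_N`, which are the roots of `D_N`. -/
def longRoots (N : ℕ) : Set (Fin N → ℤ) :=
  {v | ∃ i j, i ≠ j ∧ ∃ s r : ℤ, (s = 1 ∨ s = -1) ∧ (r = 1 ∨ r = -1) ∧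
    v = Pi.single i s + Pi.single j r}

/-- The linear combination of the `ε i` with integer coefficients `v i`. -/
def comb {d p N : ℕ} {c' : Submodule ℝ (Mat d p)} (ε : Fin N → Form c') (v : Fin N → ℤ) :
    Form c' :=
  ∑ i, (v i : ℂ) • ε i

/-- With respect to orthogonal vectors `ε i` of equal length that form a basis of the dual space,
`R = 2 Σ(𝔤 : 𝔠')` is the root system of type `B_N` (or `D_N`, without the short roots, if
`d = 2 p + 2`), with multiplicity parameters `k_short = |d-2-2p|/2` and `k_long = 1/2`. -/
def IsTypeBD (d p N : ℕ) (c' : Submodule ℝ (Mat d p)) : Prop :=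
  ∃ ε : Module.Basis (Fin N) ℂ (Form c'),
    (∃ r : ℝ, 0 < r ∧ ∀ (m : ℕ) (D : TraceDualBases c' m), ∀ i j,
      dualForm D (ε i) (ε j) = if i = j then (r : ℂ) else 0) ∧
    doubledRoots c' =
      comb ε '' (if d = 2 * p + 2 then longRoots N else longRoots N ∪ shortRoots N) ∧
    (∀ v ∈ shortRoots N, mult c' (comb ε v) = |(d : ℝ) - 2 - 2 * p| / 2) ∧
    (∀ v ∈ longRoots N, mult c' (comb ε v) = 1 / 2)

end Defect

end

noncomputable section

namespace Defect

attribute [local instance] Matrix.linftyOpNormedAddCommGroup Matrix.linftyOpNormedSpace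
  Matrix.linftyOpNormedRing Matrix.linftyOpNormedAlgebra

/-! ### Exponentials and the groups -/

section Groups

variable {n : Type} [Fintype n] [DecidableEq n]

/-! Everything is reduced to linear algebra in the defining representation on `ℂ^(d+2)`.

Normal form. An element of `𝔤^{-σ}` is given by a single `(d-p) × (p+2)` block `M`. For a
commutative subspace of `𝔨^{-σ}` the matrices `(0, M; Mᵀ, 0)` are symmetric and commute, so they
have common singular vectors (`exists_isSingularSystem`). Hence `𝔱` is spanned by rotations in
planes `(u j, w j)` with `w j` orthogonal to the timelike vector `e`. If `p + 1 < d - p`, then `𝔠`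
has one additional boost `(v, e)` and every `𝔠'` equals `𝔠`. Otherwise `𝔠 = 𝔱`, and `𝔠'` is `𝔱` or
arises from it when one rotation `(u j₀, w j₀)` is replaced by the boost `(u j₀, e)`
(`exists_span_of_standard`). In all cases `WeightFrame.nonempty_of_span` yields a basis of `ℂ^(d+2)`
with weights `±δ i` and `n₀ = d + 2 - 2N` zero weights, in which the invariant form pairs opposite
weights and the involution exchanges them.

Roots. In such a basis `𝔤_ℂ` is spanned by the matrices `E_ab - E_{-b,-a}`, of weight `w a - w b`.
Counting index pairs with a given weight difference gives the root system and the multiplicities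
(`WeightFrame.isTypeBD`).

The representative `t₀`. The condition on `Ad(τ)` says that `τ²` centralizes `𝔠'`. Up to a factor in
`exp(𝔠')`, `τ` is trivial or a rotation in the plane `(u j₀, w j₀)`. In the latter case its square
commutes with the boost `(u j₀, e)`, which forces the square to be `1` (`exp_mul_exp_eq_one`).

Radial part. At `exp(A) t₀` let `r(X, Y)` be the mixed second derivative of `f(exp(A) exp(sX)
exp(tY) t₀)` and `ℓ` the corresponding first derivative. By invariance of the Casimir element under
`Ad`, both of its actions are the sum of `r` over dual bases. Invariance of `f` under `H` makes `r`
vanish on `Ad(exp(-A)) 𝔥` in the first argument and on `𝔥` in the second, while `r(X, Y) - r(Y, X) =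
ℓ([X, Y])`; this is `IsRadial`. For opposite root vectors `E`, `S` the vanishing gives `r(E, S) =
e^{2γ(A)} r(S, E)`, so `r(E, S) + r(S, E)` is a hyperbolic cotangent times a first derivative
(`WeightFrame.bilC_rootVec_add`). The Cartan directions contribute the flat Laplacian, and the
remaining zero-weight directions lie in `𝔥` and contribute nothing (`WeightFrame.casimir_radial`).
Regularity keeps the denominators away from zero (`exp_doubledRoot_ne_one`). -/

theorem exp_mul_eq_mul_exp {𝕜 : Type*} [RCLike 𝕜] {A B V : Matrix n n 𝕜} (h : A * V = V * B) :
    NormedSpace.exp A * V = V * NormedSpace.exp B := by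
  let _ : NormedAlgebra ℚ (Matrix n n 𝕜) := NormedAlgebra.restrictScalars ℚ 𝕜 _
  exact (SemiconjBy.exp_right (x := V) (a := B) (b := A) h.symm).eq.symm

theorem exp_map_ofReal (A : Matrix n n ℝ) :
    NormedSpace.exp (A.map Complex.ofReal) = (NormedSpace.exp A).map Complex.ofReal := by
  let _ : NormedAlgebra ℚ (Matrix n n ℝ) := NormedAlgebra.restrictScalars ℚ ℝ _
  have h : Continuous (Complex.ofRealHom.mapMatrix : Matrix n n ℝ →+* Matrix n n ℂ) :=
    continuous_id.matrix_map Complex.continuous_ofReal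
  exact (NormedSpace.map_exp (Complex.ofRealHom.mapMatrix : Matrix n n ℝ →+* Matrix n n ℂ) h A).symm

theorem exp_neg_mul_exp {𝕜 : Type*} [RCLike 𝕜] (A : Matrix n n 𝕜) :
    NormedSpace.exp (-A) * NormedSpace.exp A = 1 := by
  rw [← Matrix.exp_add_of_commute _ _ (Commute.neg_left (Commute.refl A)), neg_add_cancel,
    NormedSpace.exp_zero]

theorem exp_mul_exp_neg {𝕜 : Type*} [RCLike 𝕜] (A : Matrix n n 𝕜) :
    NormedSpace.exp A * NormedSpace.exp (-A) = 1 := by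
  simpa using exp_neg_mul_exp (-A)

theorem mul_mem_SO {η : n → ℝ} {g h : Matrix n n ℝ} (hg : g ∈ SO η) (hh : h ∈ SO η) :
    g * h ∈ SO η := by
  refine ⟨?_, by rw [det_mul, hg.2, hh.2, one_mul]⟩
  calc (g * h)ᵀ * diagonal η * (g * h) = hᵀ * (gᵀ * diagonal η * g) * h := by
        rw [transpose_mul]; simp only [Matrix.mul_assoc]
    _ = diagonal η := by rw [hg.1, hh.1]

theorem one_mem_SO (η : n → ℝ) : (1 : Matrix n n ℝ) ∈ SO η := by
  constructor <;> simp

theorem one_mem_SO₀ (η : n → ℝ) : (1 : Matrix n n ℝ) ∈ SO₀ η :=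
  mem_connectedComponentIn (one_mem_SO η)

theorem SO₀_subset_SO (η : n → ℝ) : SO₀ η ⊆ SO η := connectedComponentIn_subset _ _

/-- A continuous image of a connected set stays in one component, so a single point that lands in
the identity component is enough. Applied to left translations, this gives closure of `SO₀` under
products. -/
theorem image_subset_SO₀ {m : Type} [Fintype m] [DecidableEq m] {η : n → ℝ} {ζ : m → ℝ}
    {φ : Matrix n n ℝ → Matrix m m ℝ} (hφ : Continuous φ) (hmaps : ∀ g ∈ SO η, φ g ∈ SO ζ)
    (h1 : ∃ g ∈ SO₀ η, φ g ∈ SO₀ ζ) : ∀ g ∈ SO₀ η, φ g ∈ SO₀ ζ := by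
  obtain ⟨g₀, hg₀, hφg₀⟩ := h1
  have hpre : IsPreconnected (φ '' SO₀ η) :=
    isPreconnected_connectedComponentIn.image _ hφ.continuousOn
  have hsub : φ '' SO₀ η ⊆ SO ζ := by
    rintro _ ⟨g, hg, rfl⟩
    exact hmaps g (SO₀_subset_SO η hg)
  have := hpre.subset_connectedComponentIn ⟨g₀, hg₀, rfl⟩ hsub
  rw [← connectedComponentIn_eq hφg₀] at this
  intro g hg
  exact this ⟨g, hg, rfl⟩

theorem mul_mem_SO₀ {η : n → ℝ} {g h : Matrix n n ℝ} (hg : g ∈ SO₀ η) (hh : h ∈ SO₀ η) :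
    g * h ∈ SO₀ η :=
  image_subset_SO₀ (η := η) (φ := fun h => g * h) (continuous_const.mul continuous_id)
    (fun _ hx => mul_mem_SO (SO₀_subset_SO η hg) hx)
    ⟨1, one_mem_SO₀ η, by simpa using hg⟩ h hh

theorem continuous_exp_smul (X : Matrix n n ℝ) :
    Continuous fun s : ℝ => NormedSpace.exp (s • X) := by
  let _ : NormedAlgebra ℚ (Matrix n n ℝ) := NormedAlgebra.restrictScalars ℚ ℝ _
  exact NormedSpace.exp_continuous.comp (continuous_id.smul continuous_const)

theorem exp_mem_SO {η : n → ℝ} (hη : ∀ i, η i * η i = 1) {X : Matrix n n ℝ}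
    (hX : Xᵀ * diagonal η = -(diagonal η * X)) : NormedSpace.exp X ∈ SO η := by
  have hηη : diagonal η * diagonal η = 1 := by
    rw [diagonal_mul_diagonal, ← diagonal_one]; congr 1; ext i; exact hη i
  have key : ∀ Y : Matrix n n ℝ, Yᵀ * diagonal η = -(diagonal η * Y) →
      (NormedSpace.exp Y)ᵀ * diagonal η * NormedSpace.exp Y = diagonal η := by
    intro Y hY
    rw [← Matrix.exp_transpose, exp_mul_eq_mul_exp (A := Yᵀ) (B := -Y) (by rw [hY, Matrix.mul_neg]),
      Matrix.mul_assoc, exp_neg_mul_exp, Matrix.mul_one]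
  refine ⟨key X hX, ?_⟩
  -- Preservation of the form at `X` only gives `det² = 1`. Since `exp X` is the square of
  -- `exp(X/2)`, its determinant is such a square.
  have h2 := key ((1 / 2 : ℝ) • X) (by rw [transpose_smul, Matrix.smul_mul, hX, Matrix.mul_smul, smul_neg])
  have hsq : NormedSpace.exp X = NormedSpace.exp ((1 / 2 : ℝ) • X) * NormedSpace.exp ((1 / 2 : ℝ) • X) := by
    rw [← Matrix.exp_add_of_commute _ _ (Commute.refl _), ← add_smul]; norm_num
  have hdet : (diagonal η).det * (diagonal η).det = 1 := by rw [← det_mul, hηη, det_one]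
  have h3 := congrArg det h2
  rw [det_mul, det_mul, det_transpose] at h3
  rw [hsq, det_mul]
  have h4 : (diagonal η).det ≠ 0 := by intro h0; simp [h0] at hdet
  apply mul_right_cancel₀ h4
  rw [one_mul]; linarith [h3]

theorem exp_mem_SO₀ {η : n → ℝ} (hη : ∀ i, η i * η i = 1) {X : Matrix n n ℝ}
    (hX : Xᵀ * diagonal η = -(diagonal η * X)) : NormedSpace.exp X ∈ SO₀ η := by
  have hpre : IsPreconnected (Set.range fun s : ℝ => NormedSpace.exp (s • X)) :=
    isPreconnected_range (continuous_exp_smul X)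
  have hsub : (Set.range fun s : ℝ => NormedSpace.exp (s • X)) ⊆ SO η := by
    rintro _ ⟨s, rfl⟩
    exact exp_mem_SO hη (by rw [transpose_smul, Matrix.smul_mul, hX, Matrix.mul_smul, smul_neg])
  exact hpre.subset_connectedComponentIn ⟨0, by simp⟩ hsub ⟨1, by simp⟩

end Groups

/-! ### The Lie algebra, the involution, and exponentials in `G` and `H`. -/

section Involution

variable {d p : ℕ}

theorem lorentz_mul_self (m : ℕ) (i : Fin (m + 1)) : lorentz m i * lorentz m i = 1 := by
  unfold lorentz; split_ifs <;> norm_num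

theorem sig_mul_self (i : Idx d p) : sig d p i * sig d p i = 1 := by
  rcases i with i | i <;> simp [sig, lorentz_mul_self]

/-- The diagonal matrix of the form that defines `G`. -/
def eta (d p : ℕ) : Mat d p := diagonal (sig d p)

theorem eta_mul_eta : eta d p * eta d p = 1 := by
  rw [eta, diagonal_mul_diagonal, ← diagonal_one]; congr 1; ext i; exact sig_mul_self i

theorem eta_transpose : (eta d p)ᵀ = eta d p := diagonal_transpose _

theorem eta_eq_fromBlocks :
    eta d p = fromBlocks 1 0 0 (diagonal (lorentz (p + 1))) := by
  rw [eta, sig, ← diagonal_one, fromBlocks_diagonal]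

theorem mem_lieG {X : Mat d p} : X ∈ lieG d p ↔ Xᵀ * eta d p = -(eta d p * X) := by
  rw [lieG, mem_skewAdjointMatricesSubmodule, Matrix.IsSkewAdjoint, Matrix.IsAdjointPair,
    Matrix.mul_neg]; rfl

theorem sigmaMat_mul_self : sigmaMat d p * sigmaMat d p = 1 := by
  simp [sigmaMat, fromBlocks_multiply]

theorem sigmaMat_transpose : (sigmaMat d p)ᵀ = sigmaMat d p := by
  simp [sigmaMat, fromBlocks_transpose]

theorem sigmaMat_mul_eta : sigmaMat d p * eta d p = eta d p * sigmaMat d p := by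
  simp [sigmaMat, eta_eq_fromBlocks, fromBlocks_multiply]

theorem sigma_apply (X : Mat d p) : sigma d p X = sigmaMat d p * X * sigmaMat d p := rfl

theorem mem_lieGMinus {X : Mat d p} :
    X ∈ lieGMinus d p ↔ X ∈ lieG d p ∧ sigmaMat d p * X * sigmaMat d p = -X := by
  rw [lieGMinus, Submodule.mem_inf, LinearMap.mem_ker, LinearMap.add_apply, LinearMap.id_apply,
    sigma_apply, add_eq_zero_iff_eq_neg]

theorem exp_mem_G {X : Mat d p} (hX : X ∈ lieG d p) : NormedSpace.exp X ∈ G d p :=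
  exp_mem_SO₀ sig_mul_self (mem_lieG.1 hX)

theorem mul_mem_G {g h : Mat d p} (hg : g ∈ G d p) (hh : h ∈ G d p) : g * h ∈ G d p :=
  mul_mem_SO₀ hg hh

theorem exp_fromBlocks {k m : Type} [Fintype k] [DecidableEq k] [Fintype m] [DecidableEq m]
    (A : Matrix k k ℝ) (D : Matrix m m ℝ) :
    NormedSpace.exp (fromBlocks A 0 0 D) =
      fromBlocks (NormedSpace.exp A) 0 0 (NormedSpace.exp D) := by
  let _ : NormedAlgebra ℚ (Matrix k k ℝ) := NormedAlgebra.restrictScalars ℚ ℝ _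
  let _ : NormedAlgebra ℚ (Matrix m m ℝ) := NormedAlgebra.restrictScalars ℚ ℝ _
  let φ : Matrix k k ℝ × Matrix m m ℝ →+* Matrix (k ⊕ m) (k ⊕ m) ℝ :=
    { toFun := fun x => fromBlocks x.1 0 0 x.2
      map_one' := by simp
      map_mul' := fun x y => by simp [fromBlocks_multiply]
      map_zero' := by simp
      map_add' := fun x y => by simp [fromBlocks_add] }
  have hφ : Continuous φ :=
    Continuous.matrix_fromBlocks continuous_fst continuous_const continuous_const continuous_snd
  have := NormedSpace.map_exp φ hφ (A, D)
  refine this.symm.trans ?_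
  exact congrArg₂ (fun a b => fromBlocks a 0 0 b) (Prod.fst_exp (A, D)) (Prod.snd_exp (A, D))

theorem eq_fromBlocks_of_sigma_fixed {Y : Mat d p}
    (hY : sigmaMat d p * Y * sigmaMat d p = Y) :
    Y = fromBlocks Y.toBlocks₁₁ 0 0 Y.toBlocks₂₂ := by
  have h : sigmaMat d p * fromBlocks Y.toBlocks₁₁ Y.toBlocks₁₂ Y.toBlocks₂₁ Y.toBlocks₂₂ *
      sigmaMat d p = Y := by rw [fromBlocks_toBlocks, hY]
  rw [sigmaMat, fromBlocks_multiply, fromBlocks_multiply] at h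
  have h12 := congrArg toBlocks₁₂ h
  have h21 := congrArg toBlocks₂₁ h
  simp only [toBlocks_fromBlocks₁₂, toBlocks_fromBlocks₂₁] at h12 h21
  have e12 : Y.toBlocks₁₂ = 0 := by
    ext i j
    have := congrFun (congrFun h12 i) j
    simp at this
    rw [Matrix.zero_apply]
    linarith
  have e21 : Y.toBlocks₂₁ = 0 := by
    ext i j
    have := congrFun (congrFun h21 i) j
    simp at this
    rw [Matrix.zero_apply]
    linarith
  conv_lhs => rw [← fromBlocks_toBlocks Y, e12, e21]

/-- Fixed points of the involution are block diagonal, so the exponential splits into an orthogonal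
and a Lorentzian block. This is how invariance under the group `H` becomes usable for elements of
`𝔤^σ`. -/
theorem exp_mem_H {Y : Mat d p} (hY : Y ∈ lieG d p)
    (hσ : sigmaMat d p * Y * sigmaMat d p = Y) : NormedSpace.exp Y ∈ H d p := by
  have hb := eq_fromBlocks_of_sigma_fixed hσ
  rw [mem_lieG] at hY
  set A := Y.toBlocks₁₁
  set D := Y.toBlocks₂₂
  rw [hb, eta_eq_fromBlocks, fromBlocks_transpose, fromBlocks_multiply, fromBlocks_multiply,
    fromBlocks_neg] at hY
  simp only [Matrix.mul_one, Matrix.one_mul, Matrix.mul_zero, Matrix.zero_mul, transpose_zero,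
    add_zero, zero_add, neg_zero] at hY
  obtain ⟨hA, -, -, hD⟩ := fromBlocks_inj.1 hY
  refine ⟨NormedSpace.exp A, ?_, NormedSpace.exp D, exp_mem_SO₀ (lorentz_mul_self _) hD, ?_⟩
  · have := exp_mem_SO (η := fun _ : Fin (d - p) => (1 : ℝ)) (X := A) (by simp)
      (by rw [diagonal_one]; simpa using hA)
    rw [mem_specialOrthogonalGroup_iff, mem_orthogonalGroup_iff']
    refine ⟨?_, this.2⟩
    have h1 := this.1
    rw [diagonal_one, Matrix.mul_one] at h1
    exact h1
  · rw [← exp_fromBlocks, ← hb]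

theorem one_mem_H : (1 : Mat d p) ∈ H d p :=
  ⟨1, one_mem _, 1, one_mem_SO₀ _, by simp⟩

theorem conj_mem_lieG {g X : Mat d p} {g' : Mat d p} (hg : gᵀ * eta d p * g = eta d p)
    (hgg' : g * g' = 1) (hX : X ∈ lieG d p) : g * X * g' ∈ lieG d p := by
  have hg'g : g' * g = 1 := mul_eq_one_comm.1 hgg'
  rw [mem_lieG] at hX ⊢
  have h1 : eta d p * g = g'ᵀ * eta d p := by
    have : g'ᵀ * gᵀ = 1 := by rw [← transpose_mul, hgg', transpose_one]
    calc eta d p * g = (g'ᵀ * gᵀ) * (eta d p * g) := by rw [this, Matrix.one_mul]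
      _ = g'ᵀ * (gᵀ * eta d p * g) := by simp only [Matrix.mul_assoc]
      _ = g'ᵀ * eta d p := by rw [hg]
  have h2 : gᵀ * eta d p = eta d p * g' := by
    have := congrArg transpose h1
    rwa [transpose_mul, transpose_mul, transpose_transpose, eta_transpose] at this
  calc (g * X * g')ᵀ * eta d p = g'ᵀ * Xᵀ * (gᵀ * eta d p) := by
        simp only [transpose_mul, Matrix.mul_assoc]
    _ = g'ᵀ * (Xᵀ * eta d p) * g' := by rw [h2]; simp only [Matrix.mul_assoc]
    _ = -(g'ᵀ * eta d p * X * g') := by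
        rw [hX]; simp only [Matrix.mul_neg, Matrix.neg_mul, Matrix.mul_assoc]
    _ = -(eta d p * (g * X * g')) := by rw [← h1]; simp only [Matrix.mul_assoc]

theorem exp_transpose_eta {X : Mat d p} (hX : X ∈ lieG d p) :
    (NormedSpace.exp X)ᵀ * eta d p * NormedSpace.exp X = eta d p :=
  (exp_mem_SO sig_mul_self (mem_lieG.1 hX)).1

theorem exp_conj_mem_lieG {A X : Mat d p} (hA : A ∈ lieG d p) (hX : X ∈ lieG d p) :
    NormedSpace.exp A * X * NormedSpace.exp (-A) ∈ lieG d p :=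
  conj_mem_lieG (exp_transpose_eta hA) (exp_mul_exp_neg A) hX

/-- The projection of the space of matrices onto `𝔤`. -/
def projG (d p : ℕ) : Mat d p →ₗ[ℝ] Mat d p where
  toFun X := (1 / 2 : ℝ) • (X - eta d p * Xᵀ * eta d p)
  map_add' X Y := by
    rw [transpose_add, Matrix.mul_add, Matrix.add_mul, ← smul_add]; congr 1; abel
  map_smul' c X := by
    simp only [transpose_smul, Matrix.mul_smul, Matrix.smul_mul, RingHom.id_apply, ← smul_sub]
    rw [smul_comm]

theorem projG_apply (X : Mat d p) :
    projG d p X = (1 / 2 : ℝ) • (X - eta d p * Xᵀ * eta d p) := rfl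

theorem projG_mem (X : Mat d p) : projG d p X ∈ lieG d p := by
  rw [mem_lieG, projG_apply, transpose_smul, Matrix.smul_mul, Matrix.mul_smul, ← smul_neg]
  congr 1
  rw [transpose_sub, transpose_mul, transpose_mul, eta_transpose, transpose_transpose,
    Matrix.sub_mul, Matrix.mul_sub]
  have e1 : eta d p * (X * eta d p) * eta d p = eta d p * X := by
    simp only [Matrix.mul_assoc, eta_mul_eta, Matrix.mul_one]
  have e2 : eta d p * (eta d p * Xᵀ * eta d p) = Xᵀ * eta d p := by
    simp only [← Matrix.mul_assoc, eta_mul_eta, Matrix.one_mul]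
  rw [e1, e2]; abel

theorem projG_eq_self {X : Mat d p} (hX : X ∈ lieG d p) : projG d p X = X := by
  rw [mem_lieG] at hX
  have : eta d p * Xᵀ * eta d p = -X := by
    rw [Matrix.mul_assoc, hX, Matrix.mul_neg, ← Matrix.mul_assoc, eta_mul_eta, Matrix.one_mul]
  rw [projG_apply, this, sub_neg_eq_add, ← two_smul ℝ X, smul_smul]
  norm_num

end Involution

end Defect

end

noncomputable section

namespace Defect

attribute [local instance] Matrix.linftyOpNormedAddCommGroup Matrix.linftyOpNormedSpace
  Matrix.linftyOpNormedRing Matrix.linftyOpNormedAlgebra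

/-! ### Second derivatives along two one-parameter subgroups -/

section Calculus

theorem deriv_line {E : Type*} [NormedAddCommGroup E] [NormedSpace ℝ E] {φ : E → ℂ}
    (hφ : ContDiff ℝ ∞ φ) (x₀ y : E) :
    deriv (fun t : ℝ => φ (x₀ + t • y)) 0 = fderiv ℝ φ x₀ y := by
  have h := (hφ.differentiable (by simp)).differentiableAt (x := x₀)
  have := h.lineDeriv_eq_fderiv (v := y)
  rw [← this]; rfl

theorem contDiff_fderiv {E : Type*} [NormedAddCommGroup E] [NormedSpace ℝ E] {φ : E → ℂ}
    (hφ : ContDiff ℝ ∞ φ) : ContDiff ℝ ∞ (fderiv ℝ φ) :=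
  hφ.fderiv_right (by simp)

theorem deriv_deriv_line {E : Type*} [NormedAddCommGroup E] [NormedSpace ℝ E] {φ : E → ℂ}
    (hφ : ContDiff ℝ ∞ φ) (x₀ x y : E) :
    deriv (fun s : ℝ => deriv (fun t : ℝ => φ (x₀ + s • x + t • y)) 0) 0 =
      fderiv ℝ (fderiv ℝ φ) x₀ x y := by
  simp_rw [deriv_line hφ]
  have h := ((contDiff_fderiv hφ).differentiable (by simp)).differentiableAt (x := x₀)
  have h2 : DifferentiableAt ℝ (fun z => fderiv ℝ φ z y) x₀ := h.clm_apply (by fun_prop)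
  have := h2.lineDeriv_eq_fderiv (v := x)
  rw [lineDeriv] at this
  rw [this, fderiv_clm_apply h (by fun_prop)]
  simp

theorem fderiv_fderiv_symm {E : Type*} [NormedAddCommGroup E] [NormedSpace ℝ E] {φ : E → ℂ}
    (hφ : ContDiff ℝ ∞ φ) (x₀ x y : E) :
    fderiv ℝ (fderiv ℝ φ) x₀ x y = fderiv ℝ (fderiv ℝ φ) x₀ y x :=
  (hφ.contDiffAt.isSymmSndFDerivAt (by simpa using ENat.LEInfty.out)) x y

theorem contDiff_matrix_exp {n : Type} [Fintype n] [DecidableEq n] :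
    ContDiff ℝ ∞ (NormedSpace.exp : Matrix n n ℝ → Matrix n n ℝ) :=
  contDiff_iff_contDiffAt.2 fun x => (NormedSpace.exp_analytic (𝕂 := ℝ) x).contDiffAt

theorem hasDerivAt_exp_conj {𝔸 : Type*} [NormedRing 𝔸] [NormedAlgebra ℝ 𝔸] [CompleteSpace 𝔸]
    (X Y : 𝔸) :
    HasDerivAt (fun s : ℝ => NormedSpace.exp (s • X) * Y * NormedSpace.exp (-(s • X)))
      (X * Y - Y * X) 0 := by
  have h1 : HasDerivAt (fun s : ℝ => NormedSpace.exp (s • X)) X 0 := by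
    simpa using hasDerivAt_exp_smul_const X (0 : ℝ)
  have h2 : HasDerivAt (fun s : ℝ => NormedSpace.exp (-(s • X))) (-X) 0 := by
    simpa using hasDerivAt_exp_smul_const (-X) (0 : ℝ)
  have := (h1.mul_const Y).mul h2
  simpa [sub_eq_add_neg] using! this

theorem hasDerivAt_comp_smul {E F : Type*} [NormedAddCommGroup E] [NormedSpace ℝ E]
    [NormedAddCommGroup F] [NormedSpace ℝ F] {Ψ : E → F} (h : DifferentiableAt ℝ Ψ 0) (v : E) :
    HasDerivAt (fun s : ℝ => Ψ (s • v)) (fderiv ℝ Ψ 0 v) 0 := by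
  have e : HasDerivAt (fun s : ℝ => s • v) v 0 := by
    simpa using (hasDerivAt_id (0 : ℝ)).smul_const v
  have h' : HasFDerivAt Ψ (fderiv ℝ Ψ 0) ((0 : ℝ) • v) := by
    rw [zero_smul]; exact h.hasFDerivAt
  exact h'.comp_hasDerivAt (0 : ℝ) e

/-- The hypothesis encodes `exp(sX) exp(tY) = exp(t Ad(exp(sX)) Y) exp(sX)`. Differentiating in `t`
and then in `s` by the product rule leaves the mixed derivative with `X` and `Y` exchanged, plus the
first derivative along `d/ds Ad(exp(sX)) Y = [X, Y]`. -/
theorem fderiv_fderiv_sub_swap {𝔸 : Type*} [NormedRing 𝔸] [NormedAlgebra ℝ 𝔸] [CompleteSpace 𝔸]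
    {φ : 𝔸 × 𝔸 → ℂ} (hφ : ContDiff ℝ ∞ φ) {X Y : 𝔸}
    (h : ∀ s t : ℝ, φ (s • X, t • Y) =
      φ (t • (NormedSpace.exp (s • X) * Y * NormedSpace.exp (-(s • X))), s • X)) :
    fderiv ℝ (fderiv ℝ φ) 0 (X, 0) (0, Y) - fderiv ℝ (fderiv ℝ φ) 0 (Y, 0) (0, X) =
      fderiv ℝ φ 0 (X * Y - Y * X, 0) := by
  have h1 : fderiv ℝ (fderiv ℝ φ) 0 (X, 0) (0, Y) = deriv (fun s : ℝ => fderiv ℝ φ (s • (0, X))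
      (NormedSpace.exp (s • X) * Y * NormedSpace.exp (-(s • X)), 0)) 0 := by
    rw [← deriv_deriv_line hφ]
    congr 1; ext s
    rw [← deriv_line hφ]
    congr 1; ext t
    have := h s t
    simpa using this
  have hd := ((contDiff_fderiv hφ).differentiable (by simp)).differentiableAt (x := 0)
  have h2 : HasDerivAt (fun s : ℝ => fderiv ℝ φ (s • ((0, X) : 𝔸 × 𝔸)))
      (fderiv ℝ (fderiv ℝ φ) 0 (0, X)) 0 :=
    hasDerivAt_comp_smul hd (0, X)
  have h3 : HasDerivAt (fun s : ℝ => ((NormedSpace.exp (s • X) * Y * NormedSpace.exp (-(s • X)), 0) :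
      𝔸 × 𝔸)) (X * Y - Y * X, 0) 0 :=
    (hasDerivAt_exp_conj X Y).prodMk (hasDerivAt_const _ _)
  have h4 := (h2.clm_apply h3).deriv
  rw [h1, h4, fderiv_fderiv_symm hφ 0 (Y, 0)]
  simp

variable {d p : ℕ}

/-- The function `(Z, W) ↦ f (a exp(Z) exp(W) b)` on `𝔤 × 𝔤`, extended to all matrices. -/
def twoParam (f : Mat d p → ℂ) (a b : Mat d p) (x : Mat d p × Mat d p) : ℂ :=
  f (a * NormedSpace.exp (projG d p x.1) * NormedSpace.exp (projG d p x.2) * b)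

theorem contDiff_projG : ContDiff ℝ ∞ (projG d p) :=
  (LinearMap.toContinuousLinearMap (projG d p)).contDiff

/-- The block `f` is smooth only on `G`. Because of `projG` the argument of `f` never leaves `G`, so
the result is smooth on a whole vector space and ordinary Fréchet calculus applies. -/
theorem contDiff_twoParam {f : Mat d p → ℂ} (hf : IsDefectBlock d p f) {a b : Mat d p}
    (ha : a ∈ G d p) (hb : b ∈ G d p) : ContDiff ℝ ∞ (twoParam f a b) := by
  have hs : ContDiffOn ℝ ∞ f (G d p) := hf.smooth
  refine hs.comp_contDiff (f := fun x : Mat d p × Mat d p =>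
    a * NormedSpace.exp (projG d p x.1) * NormedSpace.exp (projG d p x.2) * b) ?_ ?_
  · have e1 : ContDiff ℝ ∞ fun x : Mat d p × Mat d p => NormedSpace.exp (projG d p x.1) :=
      contDiff_matrix_exp.comp (contDiff_projG.comp contDiff_fst)
    have e2 : ContDiff ℝ ∞ fun x : Mat d p × Mat d p => NormedSpace.exp (projG d p x.2) :=
      contDiff_matrix_exp.comp (contDiff_projG.comp contDiff_snd)
    exact ((contDiff_const.mul e1).mul e2).mul contDiff_const
  · intro x
    exact mul_mem_G (mul_mem_G (mul_mem_G ha (exp_mem_G (projG_mem _))) (exp_mem_G (projG_mem _))) hb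

/-- The mixed second derivative of `f (a exp(sX) exp(tY) b)` at `s = t = 0`. -/
def mixedForm (f : Mat d p → ℂ) (a b : Mat d p) : Mat d p →ₗ[ℝ] Mat d p →ₗ[ℝ] ℂ :=
  LinearMap.mk₂ ℝ (fun X Y => fderiv ℝ (fderiv ℝ (twoParam f a b)) 0 (X, 0) (0, Y))
    (fun X X' Y => by
      rw [show ((X + X', 0) : Mat d p × Mat d p) = (X, 0) + (X', 0) by simp, map_add]; rfl)
    (fun c X Y => by
      rw [show ((c • X, 0) : Mat d p × Mat d p) = c • (X, 0) by simp, map_smul]; rfl)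
    (fun X Y Y' => by
      rw [show ((0, Y + Y') : Mat d p × Mat d p) = (0, Y) + (0, Y') by simp, map_add])
    (fun c X Y => by
      rw [show ((0, c • Y) : Mat d p × Mat d p) = c • (0, Y) by simp, map_smul])

/-- The derivative of `f (a exp(sX) b)` at `s = 0`. -/
def firstForm (f : Mat d p → ℂ) (a b : Mat d p) : Mat d p →ₗ[ℝ] ℂ where
  toFun X := fderiv ℝ (twoParam f a b) 0 (X, 0)
  map_add' X Y := by
    rw [show ((X + Y, 0) : Mat d p × Mat d p) = (X, 0) + (Y, 0) by simp, map_add]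
  map_smul' c X := by
    rw [show ((c • X, 0) : Mat d p × Mat d p) = c • (X, 0) by simp, map_smul]; rfl

theorem twoParam_smul_smul (f : Mat d p → ℂ) (a b X Y : Mat d p) (s t : ℝ) :
    twoParam f a b (0 + s • (X, 0) + t • (0, Y)) =
      f (a * NormedSpace.exp (s • projG d p X) * NormedSpace.exp (t • projG d p Y) * b) := by
  simp [twoParam]

variable {f : Mat d p → ℂ} {a b : Mat d p}

theorem mixedForm_eq_deriv (hf : IsDefectBlock d p f) (ha : a ∈ G d p) (hb : b ∈ G d p)
    (X Y : Mat d p) :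
    mixedForm f a b X Y = deriv (fun s : ℝ => deriv (fun t : ℝ =>
      f (a * NormedSpace.exp (s • projG d p X) * NormedSpace.exp (t • projG d p Y) * b)) 0) 0 := by
  refine (deriv_deriv_line (contDiff_twoParam hf ha hb) 0 (X, 0) (0, Y)).symm.trans ?_
  simp_rw [twoParam_smul_smul]

/-- Symmetry of the second derivative. This order of differentiation is the one that occurs for
right-invariant vector fields, which compose in reverse. -/
theorem mixedForm_eq_deriv_swap (hf : IsDefectBlock d p f) (ha : a ∈ G d p) (hb : b ∈ G d p)
    (X Y : Mat d p) :
    mixedForm f a b X Y = deriv (fun t : ℝ => deriv (fun s : ℝ =>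
      f (a * NormedSpace.exp (s • projG d p X) * NormedSpace.exp (t • projG d p Y) * b)) 0) 0 := by
  refine (fderiv_fderiv_symm (contDiff_twoParam hf ha hb) 0 (X, 0) (0, Y)).trans ?_
  refine (deriv_deriv_line (contDiff_twoParam hf ha hb) 0 (0, Y) (X, 0)).symm.trans ?_
  simp_rw [add_right_comm, twoParam_smul_smul]

theorem firstForm_eq_deriv (hf : IsDefectBlock d p f) (ha : a ∈ G d p) (hb : b ∈ G d p)
    (X : Mat d p) :
    firstForm f a b X = deriv (fun s : ℝ => f (a * NormedSpace.exp (s • projG d p X) * b)) 0 := by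
  refine (deriv_line (contDiff_twoParam hf ha hb) 0 (X, 0)).symm.trans ?_
  congr 1; ext s
  simp [twoParam]

theorem smul_conj {n : Type} [Fintype n] (g g' X : Matrix n n ℝ) (s : ℝ) :
    s • (g * X * g') = g * (s • X) * g' := by
  rw [Matrix.mul_smul, Matrix.smul_mul]

theorem mul_exp_conj {n : Type} [Fintype n] [DecidableEq n] {g g' : Matrix n n ℝ}
    (hg : g' * g = 1) (X : Matrix n n ℝ) :
    NormedSpace.exp (g * X * g') * g = g * NormedSpace.exp X :=
  exp_mul_eq_mul_exp (by rw [Matrix.mul_assoc, hg, Matrix.mul_one])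

/-- Moving `exp(s Ad(exp(-A)) Y)` to the left past `exp A` turns it into `exp(sY)`, an element of
`H` that the left invariance of `f` absorbs. The function is then constant in `s`. -/
theorem mixedForm_left (hf : IsDefectBlock d p f) {A : Mat d p} (hA : A ∈ lieG d p)
    (hb : b ∈ G d p) {Y : Mat d p} (hY : Y ∈ lieG d p)
    (hσ : sigmaMat d p * Y * sigmaMat d p = Y) (X : Mat d p) :
    mixedForm f (NormedSpace.exp A) b (NormedSpace.exp (-A) * Y * NormedSpace.exp A) X = 0 := by
  have hA' : -A ∈ lieG d p := neg_mem hA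
  have hmem : NormedSpace.exp (-A) * Y * NormedSpace.exp A ∈ lieG d p := by
    simpa using exp_conj_mem_lieG hA' hY
  rw [mixedForm_eq_deriv hf (exp_mem_G hA) hb, projG_eq_self hmem]
  have key : ∀ s t : ℝ, f (NormedSpace.exp A *
      NormedSpace.exp (s • (NormedSpace.exp (-A) * Y * NormedSpace.exp A)) *
      NormedSpace.exp (t • projG d p X) * b) =
      f (NormedSpace.exp A * NormedSpace.exp (t • projG d p X) * b) := by
    intro s t
    have h1 : NormedSpace.exp A *
        NormedSpace.exp (s • (NormedSpace.exp (-A) * Y * NormedSpace.exp A)) =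
        NormedSpace.exp (s • Y) * NormedSpace.exp A := by
      refine (exp_mul_eq_mul_exp ?_).symm
      rw [smul_conj, ← Matrix.mul_assoc, ← Matrix.mul_assoc, exp_mul_exp_neg, Matrix.one_mul]
    have h2 : NormedSpace.exp (s • Y) ∈ H d p := by
      refine exp_mem_H (Submodule.smul_mem _ s hY) ?_
      rw [← smul_conj, hσ]
    have h3 := hf.invariant (NormedSpace.exp A * NormedSpace.exp (t • projG d p X) * b)
      (mul_mem_G (mul_mem_G (exp_mem_G hA)
        (exp_mem_G (Submodule.smul_mem _ t (projG_mem X)))) hb) _ h2 1 one_mem_H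
    rw [← h3, h1]
    simp only [Matrix.mul_assoc, Matrix.mul_one]
  simp_rw [key]
  simp

/-- Mirror image of `mixedForm_left`: the factor `exp(tY)` is moved to the right past `exp B` and
absorbed there. -/
theorem mixedForm_right (hf : IsDefectBlock d p f) (ha : a ∈ G d p) {B : Mat d p}
    (hB : B ∈ lieG d p) {Y : Mat d p} (hY : Y ∈ lieG d p)
    (hσ : sigmaMat d p * (NormedSpace.exp (-B) * Y * NormedSpace.exp B) * sigmaMat d p =
      NormedSpace.exp (-B) * Y * NormedSpace.exp B) (X : Mat d p) :
    mixedForm f a (NormedSpace.exp B) X Y = 0 := by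
  have hB' : -B ∈ lieG d p := neg_mem hB
  have hmem : NormedSpace.exp (-B) * Y * NormedSpace.exp B ∈ lieG d p := by
    simpa using exp_conj_mem_lieG hB' hY
  rw [mixedForm_eq_deriv hf ha (exp_mem_G hB), projG_eq_self hY]
  have key : ∀ s t : ℝ, f (a * NormedSpace.exp (s • projG d p X) * NormedSpace.exp (t • Y) *
      NormedSpace.exp B) = f (a * NormedSpace.exp (s • projG d p X) * NormedSpace.exp B) := by
    intro s t
    have h1 : NormedSpace.exp (t • Y) * NormedSpace.exp B =
        NormedSpace.exp B * NormedSpace.exp (t • (NormedSpace.exp (-B) * Y * NormedSpace.exp B)) := by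
      refine exp_mul_eq_mul_exp ?_
      rw [smul_conj, ← Matrix.mul_assoc, ← Matrix.mul_assoc, exp_mul_exp_neg, Matrix.one_mul]
    have h2 : NormedSpace.exp (t • (NormedSpace.exp (-B) * Y * NormedSpace.exp B)) ∈ H d p := by
      refine exp_mem_H (Submodule.smul_mem _ t hmem) ?_
      rw [← smul_conj, hσ]
    have h3 := hf.invariant (a * NormedSpace.exp (s • projG d p X) * NormedSpace.exp B)
      (mul_mem_G (mul_mem_G ha (exp_mem_G (Submodule.smul_mem _ s (projG_mem X))))
        (exp_mem_G hB)) 1 one_mem_H _ h2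
    rw [← h3, Matrix.mul_assoc _ _ (NormedSpace.exp B), h1]
    simp only [Matrix.mul_assoc, Matrix.one_mul]
  simp_rw [key]
  simp

theorem mixedForm_sub_swap (hf : IsDefectBlock d p f) (ha : a ∈ G d p) (hb : b ∈ G d p)
    {X Y : Mat d p} (hX : X ∈ lieG d p) (hY : Y ∈ lieG d p) :
    mixedForm f a b X Y - mixedForm f a b Y X = firstForm f a b (X * Y - Y * X) := by
  refine fderiv_fderiv_sub_swap (contDiff_twoParam hf ha hb) fun s t => ?_
  have hs : s • X ∈ lieG d p := Submodule.smul_mem _ s hX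
  have hm := Submodule.smul_mem _ t (exp_conj_mem_lieG hs hY)
  change f (a * NormedSpace.exp (projG d p (s • X)) * NormedSpace.exp (projG d p (t • Y)) * b) =
    f (a * NormedSpace.exp (projG d p (t • (NormedSpace.exp (s • X) * Y *
      NormedSpace.exp (-(s • X))))) * NormedSpace.exp (projG d p (s • X)) * b)
  rw [projG_eq_self hs, projG_eq_self hm, projG_eq_self (Submodule.smul_mem _ t hY),
    Matrix.mul_assoc a (NormedSpace.exp (s • X)),
    Matrix.mul_assoc a _ (NormedSpace.exp (s • X))]
  have e : NormedSpace.exp (t • (NormedSpace.exp (s • X) * Y * NormedSpace.exp (-(s • X)))) *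
      NormedSpace.exp (s • X) = NormedSpace.exp (s • X) * NormedSpace.exp (t • Y) := by
    rw [smul_conj]
    exact mul_exp_conj (exp_neg_mul_exp _) _
  rw [e]

/-- Left-invariant fields insert their exponentials to the right of `exp B`; moving them past `exp
B` costs a conjugation by it. All Casimir terms are thereby expressed by one bilinear form at a
fixed position in the product. -/
theorem leftInv_leftInv (hf : IsDefectBlock d p f) (ha : a ∈ G d p) {B : Mat d p}
    (hB : B ∈ lieG d p) {X Y : Mat d p} (hX : X ∈ lieG d p) (hY : Y ∈ lieG d p) :
    leftInv X (leftInv Y f) (a * NormedSpace.exp B) =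
      mixedForm f a (NormedSpace.exp B) (NormedSpace.exp B * X * NormedSpace.exp (-B))
        (NormedSpace.exp B * Y * NormedSpace.exp (-B)) := by
  rw [mixedForm_eq_deriv hf ha (exp_mem_G hB), projG_eq_self (exp_conj_mem_lieG hB hX),
    projG_eq_self (exp_conj_mem_lieG hB hY)]
  unfold leftInv
  congr 1; ext s; congr 1; ext t; congr 1
  have e := mul_exp_conj (exp_neg_mul_exp B)
  rw [smul_conj, smul_conj, Matrix.mul_assoc _ (NormedSpace.exp (_ * (t • Y) * _)), e,
    ← Matrix.mul_assoc, Matrix.mul_assoc a _ (NormedSpace.exp B), e]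
  simp only [Matrix.mul_assoc]

theorem rightInv_rightInv (hf : IsDefectBlock d p f) {A : Mat d p} (hA : A ∈ lieG d p)
    (hb : b ∈ G d p) {X Y : Mat d p} (hX : X ∈ lieG d p) (hY : Y ∈ lieG d p) :
    rightInv Y (rightInv X f) (NormedSpace.exp A * b) =
      mixedForm f (NormedSpace.exp A) b (NormedSpace.exp (-A) * X * NormedSpace.exp A)
        (NormedSpace.exp (-A) * Y * NormedSpace.exp A) := by
  have hA' : -A ∈ lieG d p := neg_mem hA
  have hmX : NormedSpace.exp (-A) * X * NormedSpace.exp A ∈ lieG d p := by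
    simpa using exp_conj_mem_lieG hA' hX
  have hmY : NormedSpace.exp (-A) * Y * NormedSpace.exp A ∈ lieG d p := by
    simpa using exp_conj_mem_lieG hA' hY
  have key : ∀ (s : ℝ) (W : Mat d p), NormedSpace.exp A *
      NormedSpace.exp (s • (NormedSpace.exp (-A) * W * NormedSpace.exp A)) =
      NormedSpace.exp (s • W) * NormedSpace.exp A := by
    intro s W
    refine (exp_mul_eq_mul_exp ?_).symm
    rw [smul_conj, ← Matrix.mul_assoc, ← Matrix.mul_assoc, exp_mul_exp_neg, Matrix.one_mul]
  rw [mixedForm_eq_deriv_swap hf (exp_mem_G hA) hb, projG_eq_self hmX, projG_eq_self hmY]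
  unfold rightInv
  congr 1; ext s; congr 1; ext t; congr 1
  rw [key, Matrix.mul_assoc (NormedSpace.exp (t • X)), key]
  simp only [Matrix.mul_assoc]

/-! ### Restriction to a commutative subspace -/

variable {c' : Submodule ℝ (Mat d p)}

theorem contDiff_restrict (hf : IsDefectBlock d p f) (hc : c' ≤ lieG d p) (hb : b ∈ G d p) :
    ContDiff ℝ ∞ fun Y : c' => f (NormedSpace.exp (Y : Mat d p) * b) := by
  have hs : ContDiffOn ℝ ∞ f (G d p) := hf.smooth
  refine hs.comp_contDiff (f := fun Y : c' => NormedSpace.exp (Y : Mat d p) * b) ?_ ?_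
  · exact (contDiff_matrix_exp.comp c'.subtypeL.contDiff).mul contDiff_const
  · intro Y
    exact mul_mem_G (exp_mem_G (hc Y.2)) hb

theorem exp_add_of_mem (hcomm : IsComm c') {X Y : Mat d p} (hX : X ∈ c') (hY : Y ∈ c') :
    NormedSpace.exp (X + Y) = NormedSpace.exp X * NormedSpace.exp Y :=
  Matrix.exp_add_of_commute _ _ (hcomm X hX Y hY)

theorem firstForm_restrict (hf : IsDefectBlock d p f) (hc : c' ≤ lieG d p) (hcomm : IsComm c')
    (hb : b ∈ G d p) (A Z : c') :
    fderiv ℝ (fun Y : c' => f (NormedSpace.exp (Y : Mat d p) * b)) A Z =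
      firstForm f (NormedSpace.exp (A : Mat d p)) b Z := by
  rw [firstForm_eq_deriv hf (exp_mem_G (hc A.2)) hb, projG_eq_self (hc Z.2)]
  refine (deriv_line (contDiff_restrict hf hc hb) A Z).symm.trans ?_
  congr 1; ext s
  have := exp_add_of_mem hcomm A.2 (c'.smul_mem s Z.2)
  simp only [Submodule.coe_add, Submodule.coe_smul, this]

/-- On a commutative subspace `exp(A + sZ + tW)` is the product of the three exponentials, so the
Hessian of the restriction is the mixed form itself. -/
theorem mixedForm_restrict (hf : IsDefectBlock d p f) (hc : c' ≤ lieG d p) (hcomm : IsComm c')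
    (hb : b ∈ G d p) (A Z W : c') :
    fderiv ℝ (fderiv ℝ (fun Y : c' => f (NormedSpace.exp (Y : Mat d p) * b))) A Z W =
      mixedForm f (NormedSpace.exp (A : Mat d p)) b Z W := by
  rw [mixedForm_eq_deriv hf (exp_mem_G (hc A.2)) hb, projG_eq_self (hc Z.2),
    projG_eq_self (hc W.2)]
  refine (deriv_deriv_line (contDiff_restrict hf hc hb) A Z W).symm.trans ?_
  congr 1; ext s; congr 1; ext t
  have h1 := exp_add_of_mem hcomm A.2 (c'.smul_mem s Z.2)
  have h2 := exp_add_of_mem hcomm (c'.add_mem A.2 (c'.smul_mem s Z.2)) (c'.smul_mem t W.2)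
  simp only [Submodule.coe_add, Submodule.coe_smul, h2, h1]

theorem sum_lineDeriv {E ι : Type*} [NormedAddCommGroup E] [NormedSpace ℝ E] {u : E → ℂ}
    (hu : ContDiff ℝ ∞ u) (s : Finset ι) (k : ι → ℂ) (v : ι → E) (A : E) :
    ∑ i ∈ s, k i * lineDeriv ℝ u A (v i) = ∑ i ∈ s, k i * fderiv ℝ u A (v i) :=
  Finset.sum_congr rfl fun i _ => by
    rw [((hu.differentiable (by simp)).differentiableAt).lineDeriv_eq_fderiv]

theorem sum_lineDeriv_sum_lineDeriv {E ι : Type*} [NormedAddCommGroup E] [NormedSpace ℝ E]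
    {u : E → ℂ} (hu : ContDiff ℝ ∞ u) (s : Finset ι) (k l : ι → ℂ) (v : ι → E) (A : E) :
    ∑ i ∈ s, k i * lineDeriv ℝ (fun Y => ∑ j ∈ s, l j * lineDeriv ℝ u Y (v j)) A (v i) =
      ∑ i ∈ s, ∑ j ∈ s, k i * l j * fderiv ℝ (fderiv ℝ u) A (v i) (v j) := by
  have h1 : (fun Y => ∑ j ∈ s, l j * lineDeriv ℝ u Y (v j)) =
      fun Y => ∑ j ∈ s, l j * fderiv ℝ u Y (v j) :=
    funext fun Y => sum_lineDeriv hu s l v Y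
  have hd := ((contDiff_fderiv hu).differentiable (by simp)).differentiableAt (x := A)
  have h2 : ∀ j, DifferentiableAt ℝ (fun Y => l j * fderiv ℝ u Y (v j)) A := fun j =>
    (differentiableAt_const _).mul (hd.clm_apply (differentiableAt_const _))
  rw [h1]
  refine Finset.sum_congr rfl fun i _ => ?_
  rw [(DifferentiableAt.fun_sum fun j _ => h2 j).lineDeriv_eq_fderiv,
    fderiv_fun_sum fun j _ => h2 j, _root_.sum_apply, Finset.mul_sum]
  refine Finset.sum_congr rfl fun j _ => ?_
  rw [fderiv_const_mul (hd.clm_apply (differentiableAt_const _)),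
    fderiv_clm_apply hd (differentiableAt_const _)]
  simp [mul_assoc]

theorem dirDeriv_restrict (hf : IsDefectBlock d p f) (hc : c' ≤ lieG d p) (hcomm : IsComm c')
    (hb : b ∈ G d p) {m : ℕ} (D : TraceDualBases c' m) (lam : Form c') (A : c') :
    dirDeriv D lam (fun Y : c' => f (NormedSpace.exp (Y : Mat d p) * b)) A =
      ∑ i, lam (D.b i) * firstForm f (NormedSpace.exp (A : Mat d p)) b (D.b' i) := by
  refine (sum_lineDeriv (contDiff_restrict hf hc hb) Finset.univ (fun i => lam (D.b i)) D.b' A).trans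
    (Finset.sum_congr rfl fun i _ => ?_)
  exact congrArg (lam (D.b i) * ·) (firstForm_restrict hf hc hcomm hb A (D.b' i))

theorem dirDeriv_dirDeriv_restrict (hf : IsDefectBlock d p f) (hc : c' ≤ lieG d p)
    (hcomm : IsComm c') (hb : b ∈ G d p) {m : ℕ} (D : TraceDualBases c' m) (lam mu : Form c')
    (A : c') :
    dirDeriv D lam (dirDeriv D mu (fun Y : c' => f (NormedSpace.exp (Y : Mat d p) * b))) A =
      ∑ i, ∑ j, lam (D.b i) * mu (D.b j) *
        mixedForm f (NormedSpace.exp (A : Mat d p)) b (D.b' i) (D.b' j) := by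
  refine (sum_lineDeriv_sum_lineDeriv (contDiff_restrict hf hc hb) Finset.univ
    (fun i => lam (D.b i)) (fun i => mu (D.b i)) D.b' A).trans
    (Finset.sum_congr rfl fun i _ => Finset.sum_congr rfl fun j _ => ?_)
  exact congrArg (lam (D.b i) * mu (D.b j) * ·)
    (mixedForm_restrict hf hc hcomm hb A (D.b' i) (D.b' j))

end Calculus

end Defect

end

noncomputable section

namespace Defect

/-! ### Weight bases adapted to a Cartan subspace -/

/-- Index set of a weight basis of `ℂ^(d+2)`: the weights `δ i`, the weights `-δ i`, and
the weight zero. -/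
abbrev WIdx (N n₀ : ℕ) : Type := (Fin N ⊕ Fin N) ⊕ Fin n₀

/-- The involution of the index set that negates the weights. -/
def opp {N n₀ : ℕ} (a : WIdx N n₀) : WIdx N n₀ := Sum.map Sum.swap id a

/-- The coordinates of the weights with respect to the `δ i`. -/
def wt {N n₀ : ℕ} : WIdx N n₀ → Fin N → ℤ
  | Sum.inl (Sum.inl i) => Pi.single i 1
  | Sum.inl (Sum.inr i) => Pi.single i (-1)
  | Sum.inr _ => 0

@[simp] theorem opp_opp {N n₀ : ℕ} (a : WIdx N n₀) : opp (opp a) = a := by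
  rcases a with (a | a) | a <;> rfl

theorem opp_injective {N n₀ : ℕ} : Function.Injective (opp : WIdx N n₀ → WIdx N n₀) :=
  fun a b h => by rw [← opp_opp a, h, opp_opp]

theorem opp_eq_iff {N n₀ : ℕ} {a b : WIdx N n₀} : opp a = b ↔ a = opp b :=
  ⟨fun h => by rw [← h, opp_opp], fun h => by rw [h, opp_opp]⟩

theorem wt_opp {N n₀ : ℕ} (a : WIdx N n₀) : wt (opp a) = -wt a := by
  rcases a with (a | a) | a <;> simp [opp, wt, ← Pi.single_neg]

/-- The sign by which the involution acts on basis vectors. -/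
def sgn {N n₀ : ℕ} (s : ℂ) : WIdx N n₀ → ℂ
  | Sum.inl _ => 1
  | Sum.inr _ => s

theorem sgn_opp {N n₀ : ℕ} (s : ℂ) (a : WIdx N n₀) : sgn s (opp a) = sgn s a := by
  rcases a with (a | a) | a <;> rfl

theorem sgn_mul_self {N n₀ : ℕ} {s : ℂ} (hs : s * s = 1) (a : WIdx N n₀) :
    sgn s a * sgn s a = 1 := by
  rcases a with a | a <;> simp [sgn, hs]

/-- The complexification of `eta`. -/
def etaC (d p : ℕ) : MatC d p := diagonal fun i => (sig d p i : ℂ)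

/-- The complexification of `sigmaMat`. -/
def sigmaMatC (d p : ℕ) : MatC d p := (sigmaMat d p).map Complex.ofReal

/-- A basis of `ℂ^(d+2)` (the columns of `P`) that consists of weight vectors of `𝔠'`, such that
vectors of opposite weights are dual to each other and are exchanged by the involution. -/
structure WeightFrame {d p : ℕ} (c' : Submodule ℝ (Mat d p)) (N n₀ : ℕ) where
  P : Matrix (Idx d p) (WIdx N n₀) ℂ
  Q : Matrix (WIdx N n₀) (Idx d p) ℂ
  s : ℂ
  δ : Module.Basis (Fin N) ℂ (Form c')
  s_mul : s * s = 1
  QP : Q * P = 1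
  PQ : P * Q = 1
  Q_eq : ∀ a i, Q a i = (Pᵀ * etaC d p) (opp a) i
  eig : ∀ Z : c', (Z : Mat d p).map Complex.ofReal * P = 
    P * (diagonal (fun a => comb δ (wt a) Z) : Matrix (WIdx N n₀) (WIdx N n₀) ℂ)
  sigma_P : ∀ i a, (sigmaMatC d p * P) i a = sgn s a * P i (opp a)

theorem etaC_transpose {d p : ℕ} : (etaC d p)ᵀ = etaC d p := diagonal_transpose _

theorem mem_lieGC {d p : ℕ} {X : MatC d p} :
    X ∈ lieGC d p ↔ Xᵀ * etaC d p = -(etaC d p * X) := by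
  rw [lieGC, mem_skewAdjointMatricesSubmodule, Matrix.IsSkewAdjoint, Matrix.IsAdjointPair,
    Matrix.mul_neg]; rfl

theorem comb_sub {d p N : ℕ} {c' : Submodule ℝ (Mat d p)} (ε : Fin N → Form c')
    (v w : Fin N → ℤ) : comb ε (v - w) = comb ε v - comb ε w := by
  simp [comb, sub_smul, Finset.sum_sub_distrib]

theorem comb_neg {d p N : ℕ} {c' : Submodule ℝ (Mat d p)} (ε : Fin N → Form c')
    (v : Fin N → ℤ) : comb ε (-v) = -comb ε v := by
  simp [comb]

theorem comb_injective {d p N : ℕ} {c' : Submodule ℝ (Mat d p)}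
    (ε : Module.Basis (Fin N) ℂ (Form c')) : Function.Injective (comb ε) := by
  intro v w h
  have h1 : comb ε (v - w) = 0 := by rw [comb_sub, h, sub_self]
  have h2 := Fintype.linearIndependent_iff.1 ε.linearIndependent (fun i => ((v - w) i : ℂ)) h1
  ext i
  have := h2 i
  rw [Int.cast_eq_zero, Pi.sub_apply, sub_eq_zero] at this
  exact this

theorem comb_single {d p N : ℕ} {c' : Submodule ℝ (Mat d p)} (ε : Fin N → Form c') (i : Fin N)
    (s : ℤ) : comb ε (Pi.single i s) = (s : ℂ) • ε i := by
  rw [comb, Finset.sum_eq_single i]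
  · simp
  · intro j _ hj; simp [Pi.single_eq_of_ne hj]
  · simp

/-! ### Coordinates in a weight basis and the dimensions of root spaces. -/

namespace WeightFrame

variable {d p N n₀ : ℕ} {c' : Submodule ℝ (Mat d p)} (F : WeightFrame c' N n₀)

/-- The weights. -/
def w (a : WIdx N n₀) : Form c' := comb F.δ (wt a)

/-- The coordinates of a matrix in the weight basis. -/
def coord (X : MatC d p) : Matrix (WIdx N n₀) (WIdx N n₀) ℂ := F.Q * X * F.P

/-- The matrix with given coordinates. -/
def ofCoord (M : Matrix (WIdx N n₀) (WIdx N n₀) ℂ) : MatC d p := F.P * M * F.Q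

theorem coord_ofCoord (M) : F.coord (F.ofCoord M) = M := by
  rw [coord, ofCoord]
  calc F.Q * (F.P * M * F.Q) * F.P = (F.Q * F.P) * M * (F.Q * F.P) := by
        simp only [Matrix.mul_assoc]
    _ = M := by rw [F.QP, Matrix.one_mul, Matrix.mul_one]

theorem ofCoord_coord (X) : F.ofCoord (F.coord X) = X := by
  rw [coord, ofCoord]
  calc F.P * (F.Q * X * F.P) * F.Q = (F.P * F.Q) * X * (F.P * F.Q) := by
        simp only [Matrix.mul_assoc]
    _ = X := by rw [F.PQ, Matrix.one_mul, Matrix.mul_one]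

theorem coord_injective : Function.Injective F.coord :=
  fun X Y h => by rw [← F.ofCoord_coord X, h, F.ofCoord_coord]

theorem coord_mul (X Y) : F.coord (X * Y) = F.coord X * F.coord Y := by
  rw [coord, coord, coord]
  calc F.Q * (X * Y) * F.P = F.Q * X * (1 : MatC d p) * Y * F.P := by
        simp only [Matrix.mul_assoc, Matrix.mul_one]
    _ = _ := by rw [← F.PQ]; simp only [Matrix.mul_assoc]

theorem coord_sub (X Y) : F.coord (X - Y) = F.coord X - F.coord Y := by
  rw [coord, coord, coord, Matrix.mul_sub, Matrix.sub_mul]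

theorem coord_add (X Y) : F.coord (X + Y) = F.coord X + F.coord Y := by
  rw [coord, coord, coord, Matrix.mul_add, Matrix.add_mul]

theorem coord_smul (z : ℂ) (X) : F.coord (z • X) = z • F.coord X := by
  rw [coord, coord, Matrix.mul_smul, Matrix.smul_mul]

theorem ofCoord_sub (X Y) : F.ofCoord (X - Y) = F.ofCoord X - F.ofCoord Y := by
  rw [ofCoord, ofCoord, ofCoord, Matrix.mul_sub, Matrix.sub_mul]

theorem trace_coord (X) : (F.coord X).trace = X.trace := by
  rw [coord, Matrix.trace_mul_comm, ← Matrix.mul_assoc, F.PQ, Matrix.one_mul]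

theorem coord_restrict (Z : c') :
    F.coord ((Z : Mat d p).map Complex.ofReal) = diagonal fun a => F.w a Z := by
  rw [coord, Matrix.mul_assoc, F.eig, ← Matrix.mul_assoc, F.QP, Matrix.one_mul]; rfl

theorem coord_apply_opp (X : MatC d p) (a b : WIdx N n₀) :
    F.coord X (opp a) b = (F.Pᵀ * etaC d p * X * F.P) a b := by
  have h : ∀ i, F.Q (opp a) i = (F.Pᵀ * etaC d p) a i := fun i => by rw [F.Q_eq, opp_opp]
  simp only [coord, Matrix.mul_apply (M := F.Q * X), Matrix.mul_apply (M := F.Q),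
    Matrix.mul_apply (M := F.Pᵀ * etaC d p * X), Matrix.mul_apply (M := F.Pᵀ * etaC d p), h]

/-- Since `Q` is `Pᵀ η` with rows permuted by `opp`, the matrix `coord X` is, up to this
permutation, the matrix of the bilinear form `η(·, X ·)`. Membership in `𝔤_ℂ` is skew-symmetry of
that form. -/
theorem mem_lieGC_iff {X : MatC d p} :
    X ∈ lieGC d p ↔ ∀ a b, F.coord X a b = -F.coord X (opp b) (opp a) := by
  have hM : (F.Pᵀ * etaC d p * X * F.P)ᵀ = F.Pᵀ * (Xᵀ * etaC d p) * F.P := by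
    simp only [transpose_mul, transpose_transpose, etaC_transpose, Matrix.mul_assoc]
  rw [mem_lieGC]
  constructor
  · intro h a b
    rw [← opp_opp a, coord_apply_opp, coord_apply_opp, opp_opp]
    have := congrFun (congrFun hM (b)) (opp a)
    rw [h, transpose_apply] at this
    rw [this]
    simp only [Matrix.mul_neg, Matrix.neg_mul, Matrix.neg_apply, Matrix.mul_assoc]
  · intro h
    have h1 : (F.Pᵀ * etaC d p * X * F.P)ᵀ = -(F.Pᵀ * etaC d p * X * F.P) := by
      ext a b
      have := h (opp b) a
      rw [coord_apply_opp, opp_opp, coord_apply_opp] at this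
      rw [transpose_apply, this, Matrix.neg_apply]
    rw [hM] at h1
    have h2 : F.Pᵀ * (Xᵀ * etaC d p + etaC d p * X) * F.P = 0 := by
      rw [Matrix.mul_add, Matrix.add_mul, h1]
      simp only [Matrix.mul_assoc, neg_add_cancel]
    have h3 : F.Qᵀ * F.Pᵀ = 1 := by rw [← transpose_mul, F.PQ, transpose_one]
    have h4 : Xᵀ * etaC d p + etaC d p * X = 0 := by
      calc Xᵀ * etaC d p + etaC d p * X
          = (F.Qᵀ * F.Pᵀ) * (Xᵀ * etaC d p + etaC d p * X) * (F.P * F.Q) := by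
            rw [h3, F.PQ, Matrix.one_mul, Matrix.mul_one]
        _ = F.Qᵀ * (F.Pᵀ * (Xᵀ * etaC d p + etaC d p * X) * F.P) * F.Q := by
            simp only [Matrix.mul_assoc]
        _ = 0 := by rw [h2]; simp
    exact eq_neg_of_add_eq_zero_left h4

/-- In the weight basis `sigmaMatC` is monomial: column `b` has its only non-zero entry, a sign, in
row `opp b`. -/
theorem coord_sigma (X : MatC d p) (a b : WIdx N n₀) :
    F.coord (sigmaMatC d p * X * sigmaMatC d p) a b =
      sgn F.s a * sgn F.s b * F.coord X (opp a) (opp b) := by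
  have hT : ∀ a b, F.coord (sigmaMatC d p) a b = if a = opp b then sgn F.s b else 0 := by
    intro a b
    have h1 : F.coord (sigmaMatC d p) a b = sgn F.s b * (F.Q * F.P) a (opp b) := by
      simp only [coord, Matrix.mul_assoc, Matrix.mul_apply (M := F.Q), F.sigma_P, Finset.mul_sum]
      refine Finset.sum_congr rfl fun i _ => by ring
    rw [h1, F.QP, Matrix.one_apply]
    split_ifs <;> simp
  rw [coord_mul, coord_mul, Matrix.mul_apply, Finset.sum_eq_single (opp b)]
  · rw [Matrix.mul_apply, Finset.sum_eq_single (opp a)]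
    · rw [hT, hT, if_pos (by simp), if_pos rfl, sgn_opp]; ring
    · intro c _ hc
      rw [hT, if_neg (fun h => hc (by rw [h, opp_opp])), zero_mul]
    · simp
  · intro c _ hc
    rw [hT, if_neg hc, mul_zero]
  · simp

theorem w_opp (a : WIdx N n₀) : F.w (opp a) = -F.w a := by
  rw [w, wt_opp, comb_neg]; rfl

theorem w_sub_w (a b : WIdx N n₀) : F.w a - F.w b = comb F.δ (wt a - wt b) :=
  (comb_sub _ _ _).symm

/-- `𝔠'` acts by diagonal matrices, so `ad Z` multiplies the entry `(a, b)` by the difference of the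
two weights at `Z`. A root vector can only have entries where this difference is `γ`. -/
theorem mem_rootSpace {γ : Form c'} {X : MatC d p} :
    X ∈ rootSpace c' γ ↔ (∀ a b, F.coord X a b = -F.coord X (opp b) (opp a)) ∧
      ∀ a b, F.coord X a b ≠ 0 → F.w a - F.w b = γ := by
  have h : X ∈ rootSpace c' γ ↔ X ∈ lieGC d p ∧ ∀ Z : c',
    (Z : Mat d p).map Complex.ofReal * X - X * (Z : Mat d p).map Complex.ofReal = γ Z • X := Iff.rfl
  rw [h, F.mem_lieGC_iff]
  refine and_congr_right fun _ => ?_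
  have key : ∀ Z : c', (Z : Mat d p).map Complex.ofReal * X -
      X * (Z : Mat d p).map Complex.ofReal = γ Z • X ↔
      ∀ a b, (F.w a Z - F.w b Z) * F.coord X a b = γ Z * F.coord X a b := by
    intro Z
    rw [← F.coord_injective.eq_iff, coord_sub, coord_mul, coord_mul, coord_smul, coord_restrict,
      ← Matrix.ext_iff]
    refine forall_congr' fun a => forall_congr' fun b => ?_
    rw [Matrix.sub_apply, diagonal_mul, mul_diagonal, Matrix.smul_apply, smul_eq_mul, sub_mul,
      mul_comm (F.coord X a b)]
  constructor
  · intro h1 a b hab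
    ext Z
    exact mul_right_cancel₀ hab ((key Z).1 (h1 Z) a b)
  · intro h1 Z
    refine (key Z).2 fun a b => ?_
    by_cases hab : F.coord X a b = 0
    · simp [hab]
    · rw [← h1 a b hab]; rfl

/-- The elementary elements of `𝔤_ℂ` in the weight basis. -/
def rootVec (a b : WIdx N n₀) : MatC d p :=
  F.ofCoord (Matrix.single a b 1 - Matrix.single (opp b) (opp a) 1)

theorem coord_rootVec (a b : WIdx N n₀) :
    F.coord (F.rootVec a b) = Matrix.single a b 1 - Matrix.single (opp b) (opp a) 1 :=
  F.coord_ofCoord _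

theorem coord_rootVec_apply (a b c e : WIdx N n₀) :
    F.coord (F.rootVec a b) c e =
      (if a = c ∧ b = e then 1 else 0) - (if opp b = c ∧ opp a = e then 1 else 0) := by
  rw [coord_rootVec, Matrix.sub_apply, Matrix.single_apply, Matrix.single_apply]

theorem rootVec_mem_rootSpace (a b : WIdx N n₀) :
    F.rootVec a b ∈ rootSpace c' (F.w a - F.w b) := by
  rw [F.mem_rootSpace]
  constructor
  · intro c e
    rw [coord_rootVec_apply, coord_rootVec_apply, neg_sub]
    congr 1
    · refine if_congr ?_ rfl rfl
      rw [opp_injective.eq_iff, opp_injective.eq_iff, and_comm]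
    · refine if_congr ?_ rfl rfl
      rw [opp_eq_iff, opp_eq_iff, and_comm]
  · intro c e h
    rw [coord_rootVec_apply] at h
    by_cases h1 : a = c ∧ b = e
    · rw [h1.1, h1.2]
    · rw [if_neg h1] at h
      by_cases h2 : opp b = c ∧ opp a = e
      · rw [← h2.1, ← h2.2, w_opp, w_opp]; abel
      · rw [if_neg h2] at h; simp at h

/-- The position `(a, opp a)` is its own mirror image, so its entry equals its negative. This is why
`pairs` excludes these positions, and why twice a `δ i` is never a root. -/
theorem coord_opp_self {X : MatC d p} (hX : X ∈ lieGC d p) (a : WIdx N n₀) :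
    F.coord X a (opp a) = 0 := by
  have := F.mem_lieGC_iff.1 hX a (opp a)
  rw [opp_opp] at this
  exact self_eq_neg.1 this

theorem rootVec_ne_zero {a b : WIdx N n₀} (h : b ≠ opp a) : F.rootVec a b ≠ 0 := by
  intro h0
  have h1 := F.coord_rootVec_apply a b a b
  rw [h0] at h1
  rw [if_pos ⟨rfl, rfl⟩, if_neg (fun hh => h hh.2.symm)] at h1
  simp [coord] at h1

/-- The pairs of indices that contribute to the root space of `γ`. -/
def pairs (γ : Form c') : Finset (WIdx N n₀ × WIdx N n₀) :=
  open Classical in Finset.univ.filter fun x => x.2 ≠ opp x.1 ∧ F.w x.1 - F.w x.2 = γ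

theorem mem_pairs {γ : Form c'} {x : WIdx N n₀ × WIdx N n₀} :
    x ∈ F.pairs γ ↔ x.2 ≠ opp x.1 ∧ F.w x.1 - F.w x.2 = γ := by
  simp [pairs]

theorem rootSpace_ne_bot_iff {γ : Form c'} : rootSpace c' γ ≠ ⊥ ↔ (F.pairs γ).Nonempty := by
  rw [Submodule.ne_bot_iff]
  constructor
  · rintro ⟨X, hX, hX0⟩
    have hne : ∃ a b, F.coord X a b ≠ 0 := by
      by_contra! hcon
      apply hX0
      apply F.coord_injective
      ext a b
      rw [hcon]; simp [coord]
    obtain ⟨a, b, hab⟩ := hne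
    refine ⟨(a, b), F.mem_pairs.2 ⟨?_, (F.mem_rootSpace.1 hX).2 a b hab⟩⟩
    rintro (rfl : b = opp a)
    exact hab (F.coord_opp_self hX.1 a)
  · rintro ⟨⟨a, b⟩, hx⟩
    rw [mem_pairs] at hx
    exact ⟨F.rootVec a b, hx.2 ▸ F.rootVec_mem_rootSpace a b, F.rootVec_ne_zero hx.1⟩

theorem mem_roots_iff {γ : Form c'} : γ ∈ roots c' ↔ γ ≠ 0 ∧ (F.pairs γ).Nonempty := by
  rw [← F.rootSpace_ne_bot_iff]; rfl

/-- The involution `(a, b) ↦ (opp b, opp a)` of pairs. -/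
def flip (x : WIdx N n₀ × WIdx N n₀) : WIdx N n₀ × WIdx N n₀ := (opp x.2, opp x.1)

theorem flip_flip (x : WIdx N n₀ × WIdx N n₀) : flip (flip x) = x := by simp [flip]

theorem flip_mem_pairs {γ : Form c'} {x} (hx : x ∈ F.pairs γ) : flip x ∈ F.pairs γ := by
  rw [mem_pairs] at hx ⊢
  refine ⟨?_, ?_⟩
  · simp only [flip, opp_opp]
    intro h
    exact hx.1 (by rw [h])
  · simp only [flip, w_opp]
    rw [← hx.2]; abel

theorem flip_ne {γ : Form c'} {x} (hx : x ∈ F.pairs γ) : flip x ≠ x := by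
  rw [mem_pairs] at hx
  intro h
  exact hx.1 (congrArg Prod.snd h).symm

/-- A set of representatives of the pairs up to `flip`. -/
def halfPairs (γ : Form c') : Finset (WIdx N n₀ × WIdx N n₀) :=
  (F.pairs γ).filter fun x => Fintype.equivFin _ x < Fintype.equivFin _ (flip x)

/-- `flip` is an involution without fixed points on `pairs`. The enumeration `Fintype.equivFin`
serves only as an arbitrary total order that selects one element of each orbit. -/
theorem card_pairs (γ : Form c') : (F.pairs γ).card = 2 * (F.halfPairs γ).card := by
  classical
  have h1 := Finset.card_filter_add_card_filter_not (s := F.pairs γ)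
    (fun x => Fintype.equivFin _ x < Fintype.equivFin _ (flip x))
  rw [← h1, two_mul]
  congr 1
  refine Finset.card_bij (fun x _ => flip x) ?_ ?_ ?_
  · intro x hx
    rw [Finset.mem_filter] at hx
    refine Finset.mem_filter.2 ⟨F.flip_mem_pairs hx.1, ?_⟩
    rw [flip_flip]
    exact lt_of_le_of_ne (not_lt.1 hx.2) fun h => F.flip_ne hx.1 ((Fintype.equivFin _).injective h)
  · intro x _ y _ h
    rw [← flip_flip x, h, flip_flip]
  · intro x hx
    rw [halfPairs, Finset.mem_filter] at hx
    refine ⟨flip x, Finset.mem_filter.2 ⟨F.flip_mem_pairs hx.1, ?_⟩, flip_flip x⟩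
    rw [flip_flip]
    exact not_lt.2 hx.2.le

/-- The entries at the representatives are free coordinates on the root space: skew-symmetry
determines the mirrored ones, all others vanish, and the vectors `rootVec` realize each coordinate
separately. -/
theorem finrank_rootSpace (γ : Form c') :
    Module.finrank ℂ (rootSpace c' γ) = (F.halfPairs γ).card := by
  classical
  let L : rootSpace c' γ →ₗ[ℂ] (F.halfPairs γ → ℂ) :=
    { toFun := fun X x => F.coord X x.1.1 x.1.2
      map_add' := fun X Y => by ext x; simp [coord_add]
      map_smul' := fun z X => by ext x; simp [coord_smul] }
  have hinj : Function.Injective L := by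
    rw [← LinearMap.ker_eq_bot, LinearMap.ker_eq_bot']
    rintro ⟨X, hX⟩ hLX
    have hX' := F.mem_rootSpace.1 hX
    have hz : ∀ x ∈ F.halfPairs γ, F.coord X x.1 x.2 = 0 := fun x hx => congrFun hLX ⟨x, hx⟩
    ext1
    apply F.coord_injective
    ext a b
    have h00 : F.coord (0 : MatC d p) a b = 0 := by simp [coord]
    change F.coord X a b = F.coord 0 a b
    rw [h00]
    by_contra hab
    have hp : (a, b) ∈ F.pairs γ := by
      refine F.mem_pairs.2 ⟨?_, hX'.2 a b hab⟩
      rintro (rfl : b = opp a)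
      exact hab (F.coord_opp_self hX.1 a)
    rcases lt_trichotomy (Fintype.equivFin _ (a, b)) (Fintype.equivFin _ (flip (a, b)))
      with h | h | h
    · exact hab (hz (a, b) (Finset.mem_filter.2 ⟨hp, h⟩))
    · exact F.flip_ne hp ((Fintype.equivFin _).injective h.symm)
    · have := hz (flip (a, b)) (Finset.mem_filter.2 ⟨F.flip_mem_pairs hp, by rwa [flip_flip]⟩)
      rw [hX'.1 a b] at hab
      exact hab (by rw [show F.coord X (opp b) (opp a) = 0 from this, neg_zero])
  have hsurj : Function.Surjective L := by
    intro y
    have hmem : ∀ x ∈ F.halfPairs γ, F.rootVec x.1 x.2 ∈ rootSpace c' γ := by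
      intro x hx
      have := F.mem_pairs.1 (Finset.mem_filter.1 hx).1
      rw [← this.2]
      exact F.rootVec_mem_rootSpace _ _
    refine ⟨∑ x : F.halfPairs γ, y x • ⟨F.rootVec x.1.1 x.1.2, hmem x.1 x.2⟩, ?_⟩
    rw [map_sum]
    ext z
    rw [Finset.sum_apply, Finset.sum_eq_single z]
    · rw [map_smul]
      change y z * F.coord (F.rootVec z.1.1 z.1.2) z.1.1 z.1.2 = y z
      have hz := F.mem_pairs.1 (Finset.mem_filter.1 z.2).1
      rw [coord_rootVec_apply, if_pos ⟨rfl, rfl⟩, if_neg (fun h => hz.1 h.2.symm)]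
      ring
    · intro x _ hxz
      rw [map_smul]
      change y x * F.coord (F.rootVec x.1.1 x.1.2) z.1.1 z.1.2 = 0
      have hx2 := (Finset.mem_filter.1 x.2).2
      have hz2 := (Finset.mem_filter.1 z.2).2
      rw [coord_rootVec_apply, if_neg, if_neg]
      · simp
      · rintro ⟨e1, e2⟩
        have e : z.1 = flip x.1 := Prod.ext e1.symm e2.symm
        rw [e, flip_flip] at hz2
        exact lt_asymm hx2 hz2
      · rintro ⟨e1, e2⟩
        exact hxz (Subtype.ext (Prod.ext e1 e2))
    · simp
  rw [(LinearEquiv.ofBijective L ⟨hinj, hsurj⟩).finrank_eq, Module.finrank_fintype_fun_eq_card,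
    Fintype.card_coe]

theorem finrank_rootSpace_mul_two (γ : Form c') :
    2 * Module.finrank ℂ (rootSpace c' γ) = (F.pairs γ).card := by
  rw [finrank_rootSpace, card_pairs]

end WeightFrame

/-! ### Counting index pairs with a given weight difference. -/

/-- The index with weight `s • δ i`. -/
def signedIdx {N n₀ : ℕ} (i : Fin N) (s : ℤ) : WIdx N n₀ :=
  if s = 1 then Sum.inl (Sum.inl i) else Sum.inl (Sum.inr i)

theorem wt_signedIdx {N n₀ : ℕ} (i : Fin N) {s : ℤ} (hs : s = 1 ∨ s = -1) :
    wt (signedIdx i s : WIdx N n₀) = Pi.single i s := by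
  rcases hs with rfl | rfl <;> simp [signedIdx, wt]

theorem opp_signedIdx {N n₀ : ℕ} (i : Fin N) {s : ℤ} (hs : s = 1 ∨ s = -1) :
    opp (signedIdx i s : WIdx N n₀) = signedIdx i (-s) := by
  rcases hs with rfl | rfl <;> simp [signedIdx, opp]

theorem exists_signedIdx {N n₀ : ℕ} (a : WIdx N n₀) :
    (∃ z, a = Sum.inr z) ∨ ∃ i s, (s = 1 ∨ s = -1) ∧ a = signedIdx i s := by
  rcases a with (i | i) | z
  · exact Or.inr ⟨i, 1, Or.inl rfl, by simp [signedIdx]⟩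
  · exact Or.inr ⟨i, -1, Or.inr rfl, by simp [signedIdx]⟩
  · exact Or.inl ⟨z, rfl⟩

theorem signedIdx_ne_inr {N n₀ : ℕ} (i : Fin N) (s : ℤ) (z : Fin n₀) :
    (signedIdx i s : WIdx N n₀) ≠ Sum.inr z := by
  unfold signedIdx; split_ifs <;> simp

theorem signedIdx_inj {N n₀ : ℕ} {i j : Fin N} {s r : ℤ} (hs : s = 1 ∨ s = -1)
    (hr : r = 1 ∨ r = -1) :
    (signedIdx i s : WIdx N n₀) = signedIdx j r ↔ i = j ∧ s = r := by
  rcases hs with rfl | rfl <;> rcases hr with rfl | rfl <;> simp [signedIdx]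

/-- The pairs of indices whose weights have a given difference. -/
def wtPairs (N n₀ : ℕ) (v : Fin N → ℤ) : Finset (WIdx N n₀ × WIdx N n₀) :=
  Finset.univ.filter fun x => x.2 ≠ opp x.1 ∧ wt x.1 - wt x.2 = v

theorem mem_wtPairs {N n₀ : ℕ} {v : Fin N → ℤ} {x : WIdx N n₀ × WIdx N n₀} :
    x ∈ wtPairs N n₀ v ↔ x.2 ≠ opp x.1 ∧ wt x.1 - wt x.2 = v := by
  simp [wtPairs]

theorem single_add_single_eq {N : ℕ} {i j k l : Fin N} {s r u v : ℤ} (hij : i ≠ j)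
    (hs : s = 1 ∨ s = -1) (hr : r = 1 ∨ r = -1) (hu : u = 1 ∨ u = -1) (hv : v = 1 ∨ v = -1)
    (h : (Pi.single k u + Pi.single l v : Fin N → ℤ) = Pi.single i s + Pi.single j r) :
    (k = i ∧ u = s ∧ l = j ∧ v = r) ∨ (k = j ∧ u = r ∧ l = i ∧ v = s) := by
  have h1 := congrFun h i
  have h2 := congrFun h j
  simp only [Pi.add_apply, Pi.single_apply] at h1 h2
  grind

theorem single_add_single_ne_single {N : ℕ} {i k l : Fin N} {s u v : ℤ}
    (hs : s = 1 ∨ s = -1) (hu : u = 1 ∨ u = -1) (hv : v = 1 ∨ v = -1) :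
    (Pi.single k u + Pi.single l v : Fin N → ℤ) ≠ Pi.single i s := by
  intro h
  have h1 := congrFun h i
  have h2 := congrFun h k
  have h3 := congrFun h l
  simp only [Pi.add_apply, Pi.single_apply] at h1 h2 h3
  grind

theorem single_ne_single_add_single {N : ℕ} {i j k : Fin N} {s r u : ℤ} (hij : i ≠ j)
    (hs : s = 1 ∨ s = -1) (hr : r = 1 ∨ r = -1) :
    (Pi.single k u : Fin N → ℤ) ≠ Pi.single i s + Pi.single j r := by
  intro h
  have h1 := congrFun h i
  have h2 := congrFun h j
  simp only [Pi.add_apply, Pi.single_apply] at h1 h2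
  grind

theorem mem_wtPairs_signedIdx {N n₀ : ℕ} {i j : Fin N} {s r : ℤ} (hij : i ≠ j)
    (hs : s = 1 ∨ s = -1) (hr : r = 1 ∨ r = -1) :
    ((signedIdx i s, opp (signedIdx j r)) : WIdx N n₀ × WIdx N n₀) ∈
      wtPairs N n₀ (Pi.single i s + Pi.single j r) := by
  rw [mem_wtPairs, wt_opp, wt_signedIdx i hs, wt_signedIdx j hr, sub_neg_eq_add]
  refine ⟨fun h => hij ?_, rfl⟩
  exact ((signedIdx_inj hr hs).1 (opp_injective h)).1.symm

/-- A vector with two entries `±1` can only be split as one signed unit vector minus another, in two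
ways that `flip` exchanges. Long root spaces are therefore lines. -/
theorem card_wtPairs_long {N n₀ : ℕ} {v : Fin N → ℤ} (hv : v ∈ longRoots N) :
    (wtPairs N n₀ v).card = 2 := by
  obtain ⟨i, j, hij, s, r, hs, hr, rfl⟩ := hv
  have : wtPairs N n₀ (Pi.single i s + Pi.single j r) =
      {(signedIdx i s, opp (signedIdx j r)), (signedIdx j r, opp (signedIdx i s))} := by
    ext ⟨a, b⟩
    rw [Finset.mem_insert, Finset.mem_singleton]
    constructor
    · intro h
      rw [mem_wtPairs] at h
      -- Writing the second index as an opposite turns the weight difference into a sum.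
      obtain ⟨b, rfl⟩ : ∃ b', b = opp b' := ⟨opp b, (opp_opp b).symm⟩
      simp only [wt_opp, sub_neg_eq_add, Prod.mk.injEq, opp_injective.eq_iff] at h ⊢
      rcases exists_signedIdx a with ⟨z, rfl⟩ | ⟨k, u, hu, rfl⟩ <;>
      rcases exists_signedIdx b with ⟨z', rfl⟩ | ⟨l, v, hv, rfl⟩
      · have := h.2
        simp only [wt, add_zero] at this
        exact absurd ((Pi.single_zero i).trans this) (single_ne_single_add_single hij hs hr)
      · have := h.2
        rw [wt_signedIdx l hv] at this
        simp only [wt, zero_add] at this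
        exact absurd this (single_ne_single_add_single hij hs hr)
      · have := h.2
        rw [wt_signedIdx k hu] at this
        simp only [wt, add_zero] at this
        exact absurd this (single_ne_single_add_single hij hs hr)
      · have := h.2
        rw [wt_signedIdx k hu, wt_signedIdx l hv] at this
        rcases single_add_single_eq hij hs hr hu hv this with ⟨rfl, rfl, rfl, rfl⟩ | ⟨rfl, rfl, rfl, rfl⟩
        · exact Or.inl ⟨rfl, rfl⟩
        · exact Or.inr ⟨rfl, rfl⟩
    · rintro (h | h) <;> rw [h]
      · exact mem_wtPairs_signedIdx hij hs hr
      · rw [add_comm]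
        exact mem_wtPairs_signedIdx hij.symm hr hs
  rw [this, Finset.card_pair]
  intro h
  exact hij ((signedIdx_inj hs hr).1 (congrArg Prod.fst h)).1

/-- One index must have weight `±δ i` and the other weight zero. There are `n₀` choices for the
latter and two orders, which `flip` exchanges, so short root spaces have dimension `n₀`. -/
theorem card_wtPairs_short {N n₀ : ℕ} {v : Fin N → ℤ} (hv : v ∈ shortRoots N) :
    (wtPairs N n₀ v).card = 2 * n₀ := by
  classical
  obtain ⟨i, s, hs, rfl⟩ := hv
  have : wtPairs N n₀ (Pi.single i s) =
      Finset.univ.image (fun z : Fin n₀ => ((signedIdx i s, Sum.inr z) : WIdx N n₀ × WIdx N n₀)) ∪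
      Finset.univ.image (fun z : Fin n₀ =>
        ((Sum.inr z, opp (signedIdx i s)) : WIdx N n₀ × WIdx N n₀)) := by
    ext ⟨a, b⟩
    simp only [Finset.mem_union, Finset.mem_image, Finset.mem_univ, true_and, Prod.mk.injEq]
    constructor
    · intro h
      rw [mem_wtPairs] at h
      obtain ⟨b, rfl⟩ : ∃ b', b = opp b' := ⟨opp b, (opp_opp b).symm⟩
      simp only [wt_opp, sub_neg_eq_add, opp_injective.eq_iff] at h ⊢
      rcases exists_signedIdx a with ⟨z, rfl⟩ | ⟨k, u, hu, rfl⟩ <;>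
      rcases exists_signedIdx b with ⟨z', rfl⟩ | ⟨l, v, hv, rfl⟩
      · have := congrFun h.2 i
        simp only [wt, add_zero, Pi.zero_apply, Pi.single_eq_same] at this
        omega
      · have := h.2
        rw [wt_signedIdx l hv] at this
        simp only [wt, zero_add] at this
        have h1 := congrFun this i
        simp only [Pi.single_apply] at h1
        have : i = l ∧ s = v := by grind
        exact Or.inr ⟨z, rfl, by rw [this.1, this.2]⟩
      · have := h.2
        rw [wt_signedIdx k hu] at this
        simp only [wt, add_zero] at this
        have h1 := congrFun this i
        simp only [Pi.single_apply] at h1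
        have : i = k ∧ s = u := by grind
        exact Or.inl ⟨z', by rw [this.1, this.2], rfl⟩
      · have := h.2
        rw [wt_signedIdx k hu, wt_signedIdx l hv] at this
        exact absurd this (single_add_single_ne_single hs hu hv)
    · rintro (⟨z, rfl, rfl⟩ | ⟨z, rfl, rfl⟩) <;> rw [mem_wtPairs]
      · refine ⟨fun h => ?_, by rw [wt_signedIdx i hs]; simp [wt]⟩
        rw [opp_signedIdx i hs] at h
        exact signedIdx_ne_inr _ _ _ h.symm
      · refine ⟨fun h => ?_, by rw [wt_opp, wt_signedIdx i hs]; simp [wt]⟩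
        exact signedIdx_ne_inr _ _ _ (opp_injective h)
  rw [this, Finset.card_union_of_disjoint, Finset.card_image_of_injective,
    Finset.card_image_of_injective, Finset.card_univ, Fintype.card_fin, two_mul]
  · intro x y h; simpa using h
  · intro x y h; simpa using h
  · rw [Finset.disjoint_left]
    rintro x hx hy
    simp only [Finset.mem_image, Finset.mem_univ, true_and] at hx hy
    obtain ⟨z, rfl⟩ := hx
    obtain ⟨z', h⟩ := hy
    exact signedIdx_ne_inr i s z' (congrArg Prod.fst h).symm

/-- Two indices over the same `δ i` contribute nothing: with equal signs (after passing to the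
opposite) they form an excluded pair, with different signs their weights cancel. Short roots need a
zero weight, hence `n₀ ≠ 0`. -/
theorem wtPairs_nonempty_iff {N n₀ : ℕ} {v : Fin N → ℤ} :
    (v ≠ 0 ∧ (wtPairs N n₀ v).Nonempty) ↔ v ∈ longRoots N ∨ (n₀ ≠ 0 ∧ v ∈ shortRoots N) := by
  constructor
  · rintro ⟨hv0, ⟨a, b⟩, h⟩
    rw [mem_wtPairs] at h
    obtain ⟨b, rfl⟩ : ∃ b', b = opp b' := ⟨opp b, (opp_opp b).symm⟩
    simp only [wt_opp, sub_neg_eq_add] at h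
    obtain ⟨hne, rfl⟩ := h
    rcases exists_signedIdx a with ⟨z, rfl⟩ | ⟨k, u, hu, rfl⟩ <;>
    rcases exists_signedIdx b with ⟨z', rfl⟩ | ⟨l, v, hv, rfl⟩
    · simp [wt] at hv0
    · exact Or.inr ⟨(Fin.pos z).ne', l, v, hv, by rw [wt_signedIdx l hv]; simp [wt]⟩
    · exact Or.inr ⟨(Fin.pos z').ne', k, u, hu, by rw [wt_signedIdx k hu]; simp [wt]⟩
    · rw [wt_signedIdx k hu, wt_signedIdx l hv] at hv0 ⊢
      refine Or.inl ⟨k, l, ?_, u, v, hu, hv, rfl⟩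
      rintro rfl
      by_cases huv : u = v
      · exact hne (by rw [huv])
      · apply hv0
        rw [← Pi.single_add, show u + v = 0 by omega, Pi.single_zero]
  · rintro (h | ⟨h0, h⟩)
    · refine ⟨?_, Finset.card_pos.1 (by rw [card_wtPairs_long h]; norm_num)⟩
      obtain ⟨i, j, hij, s, r, hs, hr, rfl⟩ := h
      intro h0
      exact single_ne_single_add_single (k := i) (u := 0) hij hs hr (by rw [h0, Pi.single_zero])
    · refine ⟨?_, Finset.card_pos.1 (by rw [card_wtPairs_short h]; omega)⟩
      obtain ⟨i, s, hs, rfl⟩ := h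
      intro h0
      have := congrFun h0 i
      simp at this
      omega

end Defect

end

noncomputable section

namespace Defect

/-! ### Dual bases for the trace form, and the type of the root system -/

section TraceDual

variable {n : Type} [Fintype n] {V : Submodule ℝ (Matrix n n ℝ)} {m : ℕ}

theorem TraceDualBases.sum_trace_left (D : TraceDualBases V m) (X : V) :
    ∑ k, trace ((D.b k : Matrix n n ℝ) * (X : Matrix n n ℝ)) • D.b' k = X := by
  conv_rhs => rw [← D.b'.sum_repr X]
  refine Finset.sum_congr rfl fun k _ => ?_
  congr 1
  conv_lhs => rw [← D.b'.sum_repr X]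
  rw [Submodule.coe_sum, Finset.mul_sum, trace_sum, Finset.sum_eq_single k]
  · rw [Submodule.coe_smul, Matrix.mul_smul, trace_smul, D.dual, if_pos rfl, smul_eq_mul, mul_one]
  · intro j _ hj
    rw [Submodule.coe_smul, Matrix.mul_smul, trace_smul, D.dual, if_neg hj.symm, smul_zero]
  · simp

theorem TraceDualBases.sum_trace_right (D : TraceDualBases V m) (X : V) :
    ∑ k, trace ((X : Matrix n n ℝ) * (D.b' k : Matrix n n ℝ)) • D.b k = X := by
  conv_rhs => rw [← D.b.sum_repr X]
  refine Finset.sum_congr rfl fun k _ => ?_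
  congr 1
  conv_lhs => rw [← D.b.sum_repr X]
  rw [Submodule.coe_sum, Finset.sum_mul, trace_sum, Finset.sum_eq_single k]
  · rw [Submodule.coe_smul, Matrix.smul_mul, trace_smul, D.dual, if_pos rfl, smul_eq_mul, mul_one]
  · intro j _ hj
    rw [Submodule.coe_smul, Matrix.smul_mul, trace_smul, D.dual, if_neg hj, smul_zero]
  · simp

theorem nonempty_traceDualBases [DecidableEq n]
    (h : ∀ X ∈ V, (∀ Y ∈ V, trace (X * Y) = 0) → X = 0) :
    Nonempty (TraceDualBases V (Module.finrank ℝ V)) := by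
  let B : LinearMap.BilinForm ℝ V := LinearMap.mk₂ ℝ
    (fun X Y => trace ((X : Matrix n n ℝ) * (Y : Matrix n n ℝ)))
    (fun X X' Y => by simp [Matrix.add_mul]) (fun c X Y => by simp)
    (fun X Y Y' => by simp [Matrix.mul_add]) (fun c X Y => by simp)
  have hsymm : B.IsSymm := ⟨fun X Y => trace_mul_comm _ _⟩
  have hB : B.Nondegenerate := by
    refine (LinearMap.IsRefl.nondegenerate_iff_separatingLeft hsymm.isRefl).2 fun X hX => ?_
    exact Subtype.ext (h X X.2 fun Y hY => hX ⟨Y, hY⟩)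
  let b := Module.finBasis ℝ V
  exact ⟨⟨b, B.dualBasis hB b, fun i j => by
    have := LinearMap.BilinForm.apply_dualBasis_right hB hsymm b i j
    exact this⟩⟩

end TraceDual

variable {d p : ℕ}

/-- `𝔤` is closed under transposition, so `Xᵀ` is an admissible test element, and `tr(X Xᵀ)` is the
sum of the squares of the entries. -/
theorem trace_nondegenerate_lieG (X : Mat d p) (hX : X ∈ lieG d p)
    (h : ∀ Y ∈ lieG d p, trace (X * Y) = 0) : X = 0 := by
  have hXt : Xᵀ ∈ lieG d p := by
    rw [mem_lieG] at hX ⊢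
    have h1 : Xᵀ = -(eta d p * X * eta d p) := by
      calc Xᵀ = Xᵀ * eta d p * eta d p := by
            rw [Matrix.mul_assoc, eta_mul_eta, Matrix.mul_one]
        _ = _ := by rw [hX, Matrix.neg_mul]
    rw [transpose_transpose, h1, Matrix.mul_neg, neg_neg, Matrix.mul_assoc (eta d p),
      ← Matrix.mul_assoc, eta_mul_eta, Matrix.one_mul]
  have h2 := h _ hXt
  have h3 : (X * Xᴴ).trace = 0 := by
    rw [conjTranspose_eq_transpose_of_trivial]; exact h2
  exact Matrix.trace_mul_conjTranspose_self_eq_zero_iff.1 h3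

theorem dualForm_smul_left {m : ℕ} {c' : Submodule ℝ (Mat d p)} (D : TraceDualBases c' m)
    (z : ℂ) (lam nu : Form c') : dualForm D (z • lam) nu = z * dualForm D lam nu := by
  simp [dualForm, mul_assoc, Finset.mul_sum]

theorem dualForm_smul_right {m : ℕ} {c' : Submodule ℝ (Mat d p)} (D : TraceDualBases c' m)
    (z : ℂ) (lam nu : Form c') : dualForm D lam (z • nu) = z * dualForm D lam nu := by
  simp only [dualForm, Finset.mul_sum, LinearMap.smul_apply, smul_eq_mul]
  exact Finset.sum_congr rfl fun i _ => by ring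

namespace WeightFrame

variable {N n₀ : ℕ} {c' : Submodule ℝ (Mat d p)} (F : WeightFrame c' N n₀)

theorem finrank_eq (F : WeightFrame c' N n₀) : Module.finrank ℝ c' = N := by
  have h1 : Module.finrank ℂ (Form c') = N := by
    rw [Module.finrank_eq_card_basis F.δ, Fintype.card_fin]
  have h2 := Module.finrank_linearMap ℝ ℂ c' ℂ
  rw [h1, Module.finrank_self, mul_one] at h2
  exact h2.symm

/-- The trace can be computed in the weight basis. The weights `δ i` and `-δ i` contribute equally,
hence the factor `2`; the zero weights contribute nothing. -/
theorem trace_mul_eq (Z W : c') :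
    ((trace ((Z : Mat d p) * (W : Mat d p)) : ℝ) : ℂ) = 2 * ∑ i, F.δ i Z * F.δ i W := by
  have h1 : ((trace ((Z : Mat d p) * (W : Mat d p)) : ℝ) : ℂ) =
      trace ((Z : Mat d p).map Complex.ofReal * (W : Mat d p).map Complex.ofReal) := by
    have h2 : (Z : Mat d p).map Complex.ofReal * (W : Mat d p).map Complex.ofReal =
        ((Z : Mat d p) * (W : Mat d p)).map Complex.ofReal :=
      (Matrix.map_mul (f := Complex.ofRealHom)).symm
    rw [h2]
    simp [trace]
  rw [h1, ← F.trace_coord, coord_mul, coord_restrict, coord_restrict, diagonal_mul_diagonal,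
    trace_diagonal, Fintype.sum_sum_type, Fintype.sum_sum_type]
  simp only [w, wt, comb, LinearMap.sum_apply, LinearMap.smul_apply, smul_eq_mul, Pi.zero_apply,
    Int.cast_zero, zero_mul, Finset.sum_const_zero, mul_zero, add_zero]
  rw [two_mul]
  congr 1 <;> refine Finset.sum_congr rfl fun i _ => ?_
  · rw [Finset.sum_eq_single i, Finset.sum_eq_single i] <;> simp +contextual
  · rw [Finset.sum_eq_single i, Finset.sum_eq_single i] <;> simp +contextual

/-- By `trace_mul_eq` an element of the radical satisfies `∑ i, δ i X • δ i = 0`. Independence of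
the `δ i` makes all of them, and hence every linear form, vanish at `X`. -/
theorem trace_nondegenerate (F : WeightFrame c' N n₀) (X : Mat d p) (hX : X ∈ c')
    (h : ∀ Y ∈ c', trace (X * Y) = 0) : X = 0 := by
  have h1 : ∑ i, (F.δ i ⟨X, hX⟩) • F.δ i = 0 := by
    ext W
    have := F.trace_mul_eq ⟨X, hX⟩ W
    rw [h W W.2] at this
    simpa using this
  have h2 := Fintype.linearIndependent_iff.1 F.δ.linearIndependent _ h1
  have h3 : ∀ lam : Form c', lam ⟨X, hX⟩ = 0 := by
    intro lam
    have := LinearMap.congr_fun (F.δ.sum_repr lam) ⟨X, hX⟩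
    simp only [LinearMap.sum_apply, LinearMap.smul_apply, h2, smul_zero,
      Finset.sum_const_zero] at this
    exact this.symm
  by_contra hX0
  have h4 : (⟨X, hX⟩ : c') ≠ 0 := fun h => hX0 (congrArg Subtype.val h)
  obtain ⟨ψ, hψ⟩ : ∃ ψ : Module.Dual ℝ c', ψ ⟨X, hX⟩ ≠ 0 := by
    by_contra! hcon
    exact h4 ((Module.forall_dual_apply_eq_zero_iff ℝ _).1 hcon)
  have := h3 (Complex.ofRealLI.toLinearMap ∘ₗ ψ)
  simp at this
  exact hψ this

theorem form_eq_sum {m : ℕ} (D : TraceDualBases c' m) (lam : Form c') :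
    lam = ∑ j, (2 * dualForm D lam (F.δ j)) • F.δ j := by
  ext Z
  conv_lhs => rw [← D.sum_trace_right Z]
  simp only [map_sum, map_smul, LinearMap.sum_apply, LinearMap.smul_apply, Complex.real_smul,
    F.trace_mul_eq, smul_eq_mul, dualForm, Finset.mul_sum, Finset.sum_mul]
  rw [Finset.sum_comm]
  refine Finset.sum_congr rfl fun j _ => Finset.sum_congr rfl fun k _ => by ring

theorem dualForm_basis {m : ℕ} (D : TraceDualBases c' m) (i j : Fin N) :
    dualForm D (F.δ i) (F.δ j) = if i = j then 1 / 2 else 0 := by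
  have h := congrArg (fun x => F.δ.repr x j) (F.form_eq_sum D (F.δ i))
  simp only [Module.Basis.repr_self, map_sum, map_smul, Finsupp.coe_finsetSum, Finsupp.coe_smul,
    Finset.sum_apply, Pi.smul_apply, Finsupp.single_apply, smul_eq_mul, mul_ite, mul_one,
    mul_zero, Finset.sum_ite_eq', Finset.mem_univ, if_true] at h
  split_ifs at h ⊢
  · linear_combination (-1 / 2 : ℂ) * h
  · linear_combination (-1 / 2 : ℂ) * h

theorem pairs_comb (v : Fin N → ℤ) : F.pairs (comb F.δ v) = wtPairs N n₀ v := by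
  ext x
  rw [mem_pairs, mem_wtPairs, w_sub_w, (comb_injective F.δ).eq_iff]

theorem exists_comb_of_mem_pairs {γ : Form c'} {x} (hx : x ∈ F.pairs γ) :
    γ = comb F.δ (wt x.1 - wt x.2) := by
  rw [mem_pairs] at hx
  rw [← w_sub_w, hx.2]

theorem comb_mem_roots_iff (v : Fin N → ℤ) :
    comb F.δ v ∈ roots c' ↔ v ∈ longRoots N ∨ (n₀ ≠ 0 ∧ v ∈ shortRoots N) := by
  rw [F.mem_roots_iff, pairs_comb, ← wtPairs_nonempty_iff (n₀ := n₀)]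
  refine and_congr_left fun _ => not_congr ?_
  have h0 : comb F.δ 0 = 0 := by simp [comb]
  rw [← h0, (comb_injective F.δ).eq_iff]

theorem isTypeBD (F : WeightFrame c' N n₀) (h0 : n₀ = 0 ↔ d = 2 * p + 2) (hn : (n₀ : ℝ) = |(d : ℝ) - 2 - 2 * p|) :
    IsTypeBD d p N c' := by
  -- The root set is doubled, so the basis is as well. The common square length `1/2` of the `δ i`
  -- becomes `2`.
  let ε : Module.Basis (Fin N) ℂ (Form c') :=
    F.δ.unitsSMul fun _ => Units.mk0 (2 : ℂ) two_ne_zero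
  have hε : ∀ i, ε i = (2 : ℂ) • F.δ i := fun i => by
    rw [Module.Basis.unitsSMul_apply]; rfl
  have hcomb : ∀ v, comb ε v = (2 : ℂ) • comb F.δ v := by
    intro v
    simp only [comb, hε, Finset.smul_sum]
    exact Finset.sum_congr rfl fun i _ => smul_comm _ _ _
  have hhalf : ∀ v, (1 / 2 : ℂ) • comb ε v = comb F.δ v := by
    intro v
    rw [hcomb, smul_smul]; norm_num
  have hmult : ∀ v, mult c' (comb ε v) = ((wtPairs N n₀ v).card : ℝ) / 4 := by
    intro v
    have := F.finrank_rootSpace_mul_two (comb F.δ v)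
    rw [pairs_comb] at this
    rw [mult, hhalf, ← this]
    push_cast; ring
  refine ⟨ε, ⟨2, two_pos, fun m D i j => ?_⟩, ?_, fun v hv => ?_, fun v hv => ?_⟩
  · rw [hε, hε, dualForm_smul_left, dualForm_smul_right, F.dualForm_basis]
    split_ifs <;> norm_num
  · have hset : (if d = 2 * p + 2 then longRoots N else longRoots N ∪ shortRoots N) =
        {v | v ∈ longRoots N ∨ (n₀ ≠ 0 ∧ v ∈ shortRoots N)} := by
      split_ifs with hd
      · have : n₀ = 0 := h0.2 hd
        ext v; simp [this]
      · have : n₀ ≠ 0 := fun h => hd (h0.1 h)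
        ext v; simp [this]
    rw [hset]
    ext α
    constructor
    · rintro ⟨γ, hγ, rfl⟩
      obtain ⟨x, hx⟩ := (F.mem_roots_iff.1 hγ).2
      have hγ' := F.exists_comb_of_mem_pairs hx
      rw [hγ'] at hγ ⊢
      exact ⟨_, (F.comb_mem_roots_iff _).1 hγ, hcomb _⟩
    · rintro ⟨v, hv, rfl⟩
      exact ⟨comb F.δ v, (F.comb_mem_roots_iff v).2 hv, hcomb v⟩
  · rw [hmult, card_wtPairs_short hv, ← hn]
    push_cast; ring
  · rw [hmult, card_wtPairs_long hv]
    norm_num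

end WeightFrame

end Defect

end

noncomputable section

namespace Defect

attribute [local instance] Matrix.linftyOpNormedAddCommGroup Matrix.linftyOpNormedSpace
  Matrix.linftyOpNormedRing Matrix.linftyOpNormedAlgebra

/-! ### Complexification -/

section Complexify

variable {d p : ℕ}

/-- The entrywise real part. -/
def reM (X : MatC d p) : Mat d p := X.map Complex.re

/-- The entrywise imaginary part. -/
def imM (X : MatC d p) : Mat d p := X.map Complex.im

/-- The complex matrix with the same entries as a real one. -/
def toC (X : Mat d p) : MatC d p := X.map Complex.ofReal

theorem toC_mul (X Y : Mat d p) : toC (X * Y) = toC X * toC Y :=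
  Matrix.map_mul (f := Complex.ofRealHom)

theorem toC_one : toC (1 : Mat d p) = 1 := by simp [toC]

theorem toC_smul (s : ℝ) (X : Mat d p) : toC (s • X) = (s : ℂ) • toC X := by
  ext; simp [toC]

theorem toC_sum {ι : Type*} (s : Finset ι) (X : ι → Mat d p) :
    toC (∑ i ∈ s, X i) = ∑ i ∈ s, toC (X i) :=
  map_sum (Complex.ofRealHom.mapMatrix : Mat d p →+* MatC d p) X s

theorem trace_toC (X : Mat d p) : trace (toC X) = ((trace X : ℝ) : ℂ) := by simp [toC, trace]

theorem toC_exp (X : Mat d p) : toC (NormedSpace.exp X) = NormedSpace.exp (toC X) :=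
  (exp_map_ofReal X).symm

theorem toC_neg (X : Mat d p) : toC (-X) = -toC X := by ext; simp [toC]

theorem toC_eta : toC (eta d p) = etaC d p := by
  simp [toC, eta, etaC, diagonal_map]

theorem reM_toC (X : Mat d p) : reM (toC X) = X := by ext; simp [reM, toC]

theorem imM_toC (X : Mat d p) : imM (toC X) = 0 := by ext; simp [imM, toC]

theorem reM_add (X Y : MatC d p) : reM (X + Y) = reM X + reM Y := by ext; simp [reM]

theorem imM_add (X Y : MatC d p) : imM (X + Y) = imM X + imM Y := by ext; simp [imM]

theorem reM_sub (X Y : MatC d p) : reM (X - Y) = reM X - reM Y := by ext; simp [reM]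

theorem imM_sub (X Y : MatC d p) : imM (X - Y) = imM X - imM Y := by ext; simp [imM]

theorem reM_neg (X : MatC d p) : reM (-X) = -reM X := by ext; simp [reM]

theorem imM_neg (X : MatC d p) : imM (-X) = -imM X := by ext; simp [imM]

theorem reM_transpose (X : MatC d p) : reM Xᵀ = (reM X)ᵀ := rfl

theorem imM_transpose (X : MatC d p) : imM Xᵀ = (imM X)ᵀ := rfl

theorem reM_smul (z : ℂ) (X : MatC d p) : reM (z • X) = z.re • reM X - z.im • imM X := by
  ext; simp [reM, imM]

theorem imM_smul (z : ℂ) (X : MatC d p) : imM (z • X) = z.re • imM X + z.im • reM X := by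
  ext; simp [reM, imM]

theorem eq_re_add_im (X : MatC d p) : X = toC (reM X) + Complex.I • toC (imM X) := by
  ext i j
  simp [toC, reM, imM, mul_comm Complex.I, Complex.re_add_im]

theorem reM_mul (X Y : MatC d p) : reM (X * Y) = reM X * reM Y - imM X * imM Y := by
  ext i j; simp [reM, imM, Matrix.mul_apply, Finset.sum_sub_distrib]; ring

theorem imM_mul (X Y : MatC d p) : imM (X * Y) = reM X * imM Y + imM X * reM Y := by
  ext i j; simp [reM, imM, Matrix.mul_apply, Finset.sum_add_distrib]; ring

theorem reM_conj (B C : Mat d p) (X : MatC d p) : reM (toC B * X * toC C) = B * reM X * C := by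
  simp [reM_mul, imM_mul, reM_toC, imM_toC]

theorem imM_conj (B C : Mat d p) (X : MatC d p) : imM (toC B * X * toC C) = B * imM X * C := by
  simp [reM_mul, imM_mul, reM_toC, imM_toC]

theorem mem_lieGC_iff_re_im {X : MatC d p} :
    X ∈ lieGC d p ↔ reM X ∈ lieG d p ∧ imM X ∈ lieG d p := by
  rw [mem_lieGC, mem_lieG, mem_lieG, ← toC_eta]
  have e1 : ∀ Y : MatC d p, reM (Y * toC (eta d p)) = reM Y * eta d p := fun Y => by
    simp [reM_mul, reM_toC, imM_toC]
  have e2 : ∀ Y : MatC d p, imM (Y * toC (eta d p)) = imM Y * eta d p := fun Y => by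
    simp [imM_mul, reM_toC, imM_toC]
  have e3 : ∀ Y : MatC d p, reM (toC (eta d p) * Y) = eta d p * reM Y := fun Y => by
    simp [reM_mul, reM_toC, imM_toC]
  have e4 : ∀ Y : MatC d p, imM (toC (eta d p) * Y) = eta d p * imM Y := fun Y => by
    simp [imM_mul, reM_toC, imM_toC]
  constructor
  · intro h
    have h1 := congrArg reM h
    have h2 := congrArg imM h
    rw [e1, reM_neg, e3, reM_transpose] at h1
    rw [e2, imM_neg, e4, imM_transpose] at h2
    exact ⟨h1, h2⟩
  · rintro ⟨h1, h2⟩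
    rw [eq_re_add_im (Xᵀ * _), eq_re_add_im (-_), e1, e2, reM_neg, imM_neg, e3, e4, reM_transpose,
      imM_transpose, h1, h2]

/-- The complex-linear extension of a linear form. -/
def linC (ℓ : Mat d p →ₗ[ℝ] ℂ) : MatC d p →ₗ[ℂ] ℂ where
  toFun X := ℓ (reM X) + Complex.I * ℓ (imM X)
  map_add' X Y := by rw [reM_add, imM_add, map_add, map_add]; ring
  map_smul' z X := by
    rw [reM_smul, imM_smul, map_sub, map_add, map_smul, map_smul, map_smul, map_smul]
    simp only [Complex.real_smul, RingHom.id_apply, smul_eq_mul]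
    conv_rhs => rw [← Complex.re_add_im z]
    linear_combination (z.im : ℂ) * ℓ (imM X) * (Complex.I_mul_I).symm

/-- The complex-bilinear extension of a bilinear form. -/
def bilC (r : Mat d p →ₗ[ℝ] Mat d p →ₗ[ℝ] ℂ) : MatC d p →ₗ[ℂ] MatC d p →ₗ[ℂ] ℂ :=
  LinearMap.mk₂ ℂ (fun X Y => linC (r (reM X)) Y + Complex.I * linC (r (imM X)) Y)
    (fun X X' Y => by
      simp only [linC, reM_add, imM_add, map_add, LinearMap.add_apply, LinearMap.coe_mk,
        AddHom.coe_mk]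
      ring)
    (fun z X Y => by
      simp only [linC, reM_smul, imM_smul, map_add, map_sub, map_smul, LinearMap.add_apply,
        LinearMap.sub_apply, LinearMap.smul_apply, LinearMap.coe_mk, AddHom.coe_mk,
        Complex.real_smul, smul_eq_mul]
      conv_rhs => rw [← Complex.re_add_im z]
      linear_combination (z.im : ℂ) * (r (imM X) (reM Y) + Complex.I * r (imM X) (imM Y)) *
        (Complex.I_mul_I).symm)
    (fun X Y Y' => by rw [map_add, map_add]; ring)
    (fun z X Y => by rw [map_smul, map_smul, smul_eq_mul, smul_eq_mul, smul_eq_mul]; ring)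

theorem linC_apply (ℓ : Mat d p →ₗ[ℝ] ℂ) (X : MatC d p) :
    linC ℓ X = ℓ (reM X) + Complex.I * ℓ (imM X) := rfl

theorem bilC_apply (r : Mat d p →ₗ[ℝ] Mat d p →ₗ[ℝ] ℂ) (X Y : MatC d p) :
    bilC r X Y = r (reM X) (reM Y) + Complex.I * r (reM X) (imM Y) +
      Complex.I * (r (imM X) (reM Y) + Complex.I * r (imM X) (imM Y)) := rfl

theorem linC_toC (ℓ : Mat d p →ₗ[ℝ] ℂ) (X : Mat d p) : linC ℓ (toC X) = ℓ X := by
  simp [linC_apply, reM_toC, imM_toC]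

theorem bilC_toC (r : Mat d p →ₗ[ℝ] Mat d p →ₗ[ℝ] ℂ) (X Y : Mat d p) :
    bilC r (toC X) (toC Y) = r X Y := by
  simp [bilC_apply, reM_toC, imM_toC]

end Complexify

/-! ### Radial bilinear forms and the Casimir sum in the weight basis. -/

variable {d p : ℕ} {c' : Submodule ℝ (Mat d p)}

/-- Conjugation by `exp(-A)` scales the root spaces. -/
theorem exp_conj_rootSpace {γ : Form c'} {E : MatC d p} (hE : E ∈ rootSpace c' γ) (A : c') :
    toC (NormedSpace.exp (-(A : Mat d p))) * E * toC (NormedSpace.exp (A : Mat d p)) =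
      Complex.exp (-γ A) • E := by
  have h := hE.2 A
  -- `E` intertwines `A` with `A + γ(A)`. The shift is scalar, so exponentiating it produces just a
  -- number.
  have h1 : toC (A : Mat d p) * E = E * (toC (A : Mat d p) + γ A • (1 : MatC d p)) := by
    rw [Matrix.mul_add, Matrix.mul_smul, Matrix.mul_one, ← h]
    simp only [toC]; abel
  have h2 : -toC (A : Mat d p) * E = E * (-toC (A : Mat d p) + (-γ A) • (1 : MatC d p)) := by
    rw [Matrix.neg_mul, h1, ← Matrix.mul_neg]
    congr 1
    rw [neg_add, neg_smul]
  have h3 := exp_mul_eq_mul_exp h2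
  have h4 : NormedSpace.exp ((-γ A) • (1 : MatC d p)) = Complex.exp (-γ A) • (1 : MatC d p) := by
    rw [← Matrix.diagonal_one, ← Matrix.diagonal_smul, Matrix.exp_diagonal, ← Matrix.diagonal_smul]
    congr 1
    ext i
    rw [Pi.exp_def]
    simp [Complex.exp_eq_exp_ℂ]
  rw [toC_exp, toC_exp, toC_neg, h3, Matrix.exp_add_of_commute _ _ (Commute.smul_right (Commute.one_right _) _),
    h4, Matrix.mul_smul, Matrix.mul_one, Matrix.mul_smul, Matrix.smul_mul, Matrix.mul_assoc,
    exp_neg_mul_exp, Matrix.mul_one]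

/-- A bilinear form that has the invariance properties of the second derivatives at `exp A` of
a function that is invariant under `H` from both sides. -/
structure IsRadial (A : Mat d p) (r : Mat d p →ₗ[ℝ] Mat d p →ₗ[ℝ] ℂ) (ℓ : Mat d p →ₗ[ℝ] ℂ) :
    Prop where
  left : ∀ Y ∈ lieG d p, sigmaMat d p * Y * sigmaMat d p = Y → ∀ X,
    r (NormedSpace.exp (-A) * Y * NormedSpace.exp A) X = 0
  right : ∀ Y ∈ lieG d p, sigmaMat d p * Y * sigmaMat d p = Y → ∀ X, r X Y = 0
  swap : ∀ X ∈ lieG d p, ∀ Y ∈ lieG d p, r X Y - r Y X = ℓ (X * Y - Y * X)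

section Radial

variable {A : Mat d p} {r : Mat d p →ₗ[ℝ] Mat d p →ₗ[ℝ] ℂ} {ℓ : Mat d p →ₗ[ℝ] ℂ}

theorem sigma_re_im {Y : MatC d p} (hσ : sigmaMatC d p * Y * sigmaMatC d p = Y) :
    sigmaMat d p * reM Y * sigmaMat d p = reM Y ∧
      sigmaMat d p * imM Y * sigmaMat d p = imM Y := by
  rw [← reM_conj, ← imM_conj]
  exact ⟨congrArg reM hσ, congrArg imM hσ⟩

theorem IsRadial.leftC (h : IsRadial A r ℓ) {Y : MatC d p} (hY : Y ∈ lieGC d p)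
    (hσ : sigmaMatC d p * Y * sigmaMatC d p = Y) (X : MatC d p) :
    bilC r (toC (NormedSpace.exp (-A)) * Y * toC (NormedSpace.exp A)) X = 0 := by
  obtain ⟨h1, h2⟩ := mem_lieGC_iff_re_im.1 hY
  obtain ⟨h3, h4⟩ := sigma_re_im hσ
  rw [bilC_apply, reM_conj, imM_conj, h.left _ h1 h3, h.left _ h1 h3, h.left _ h2 h4,
    h.left _ h2 h4]
  simp

theorem IsRadial.rightC (h : IsRadial A r ℓ) {Y : MatC d p} (hY : Y ∈ lieGC d p)
    (hσ : sigmaMatC d p * Y * sigmaMatC d p = Y) (X : MatC d p) : bilC r X Y = 0 := by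
  obtain ⟨h1, h2⟩ := mem_lieGC_iff_re_im.1 hY
  obtain ⟨h3, h4⟩ := sigma_re_im hσ
  rw [bilC_apply, h.right _ h1 h3, h.right _ h1 h3, h.right _ h2 h4, h.right _ h2 h4]
  simp

theorem IsRadial.swapC (h : IsRadial A r ℓ) {X Y : MatC d p} (hX : X ∈ lieGC d p)
    (hY : Y ∈ lieGC d p) : bilC r X Y - bilC r Y X = linC ℓ (X * Y - Y * X) := by
  obtain ⟨h1, h2⟩ := mem_lieGC_iff_re_im.1 hX
  obtain ⟨h3, h4⟩ := mem_lieGC_iff_re_im.1 hY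
  have e1 := h.swap _ h1 _ h3
  have e2 := h.swap _ h1 _ h4
  have e3 := h.swap _ h2 _ h3
  have e4 := h.swap _ h2 _ h4
  rw [bilC_apply, bilC_apply, linC_apply, reM_sub, imM_sub, reM_mul, reM_mul, imM_mul, imM_mul]
  simp only [map_add, map_sub] at e1 e2 e3 e4 ⊢
  linear_combination e1 + Complex.I * e2 + Complex.I * e3 + Complex.I * Complex.I * e4 +
    (ℓ (imM X * imM Y) - ℓ (imM Y * imM X)) * Complex.I_mul_I

end Radial

namespace WeightFrame

variable {N n₀ : ℕ} (F : WeightFrame c' N n₀)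

theorem coord_sum {ι : Type*} (s : Finset ι) (X : ι → MatC d p) :
    F.coord (∑ i ∈ s, X i) = ∑ i ∈ s, F.coord (X i) := by
  simp only [coord, Matrix.mul_sum, Matrix.sum_mul]

theorem rootVec_opp (a : WIdx N n₀) : F.rootVec a (opp a) = 0 := by
  rw [rootVec, opp_opp, sub_self]
  simp [ofCoord]

theorem sigma_rootVec (a b : WIdx N n₀) :
    sigmaMatC d p * F.rootVec a b * sigmaMatC d p =
      -(sgn F.s a * sgn F.s b) • F.rootVec b a := by
  apply F.coord_injective
  ext c e
  rw [coord_sigma, coord_smul, Matrix.smul_apply, coord_rootVec_apply, coord_rootVec_apply,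
    smul_eq_mul]
  simp only [opp_injective.eq_iff]
  by_cases h1 : a = opp c ∧ b = opp e
  · obtain ⟨rfl, rfl⟩ := h1
    simp only [opp_opp, sgn_opp, and_self, if_true]
    ring
  · have h1' : ¬(opp a = c ∧ opp b = e) := by
      rwa [opp_eq_iff, opp_eq_iff]
    rw [if_neg h1, if_neg h1']
    by_cases h2 : b = c ∧ a = e
    · rw [if_pos h2, ← h2.1, ← h2.2]; ring
    · rw [if_neg h2]; ring

theorem rootVec_mem_lieGC (a b : WIdx N n₀) : F.rootVec a b ∈ lieGC d p :=
  (F.rootVec_mem_rootSpace a b).1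

/-- By `sigma_rootVec` this element is the sum of `rootVec a b` and its image under the involution.
It is the part of `𝔥_ℂ` that the pair of opposite root spaces provides. -/
theorem sub_sigma_fixed (a b : WIdx N n₀) :
    sigmaMatC d p * (F.rootVec a b - (sgn F.s a * sgn F.s b) • F.rootVec b a) * sigmaMatC d p =
      F.rootVec a b - (sgn F.s a * sgn F.s b) • F.rootVec b a := by
  have h : (sgn F.s a * sgn F.s b) * (sgn F.s b * sgn F.s a) = 1 := by
    rw [mul_mul_mul_comm, mul_mul_mul_comm, mul_comm (sgn F.s b) (sgn F.s a), mul_mul_mul_comm,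
      sgn_mul_self F.s_mul, sgn_mul_self F.s_mul, one_mul]
  rw [Matrix.mul_sub, Matrix.sub_mul, Matrix.mul_smul, Matrix.smul_mul, sigma_rootVec,
    sigma_rootVec, smul_smul, mul_neg, h, neg_smul, neg_smul, one_smul]
  abel


/-- With `z = ±1` the element `E - z S` lies in `𝔥_ℂ`. Left invariance, after conjugation, reads
`q⁻¹ r(E, ·) = z q r(S, ·)`, and right invariance reads `r(·, E) = z r(·, S)`. Both are evaluated
against `S`; eliminating `r(S, S)` gives `r(E, S) = q² r(S, E)`. The commutator relation then
determines both values, since `q² ≠ 1`. -/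
theorem bilC_rootVec_add {A : c'} {r : Mat d p →ₗ[ℝ] Mat d p →ₗ[ℝ] ℂ} {ℓ : Mat d p →ₗ[ℝ] ℂ}
    (h : IsRadial (A : Mat d p) r ℓ) (a b : WIdx N n₀)
    (hq : Complex.exp (((2 : ℂ) • (F.w a - F.w b)) A) ≠ 1) :
    bilC r (F.rootVec a b) (F.rootVec b a) + bilC r (F.rootVec b a) (F.rootVec a b) =
      (Complex.exp (((2 : ℂ) • (F.w a - F.w b)) A) + 1) /
        (Complex.exp (((2 : ℂ) • (F.w a - F.w b)) A) - 1) *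
      linC ℓ (F.rootVec a b * F.rootVec b a - F.rootVec b a * F.rootVec a b) := by
  set γ := F.w a - F.w b with hγ
  set E := F.rootVec a b with hE
  set S := F.rootVec b a with hS
  set z := sgn F.s a * sgn F.s b with hz
  set q := Complex.exp (γ A) with hqdef
  have hzz : z * z = 1 := by
    rw [hz, mul_mul_mul_comm, sgn_mul_self F.s_mul, sgn_mul_self F.s_mul, one_mul]
  have hq0 : q ≠ 0 := Complex.exp_ne_zero _
  have hqq : Complex.exp (((2 : ℂ) • γ) A) = q * q := by
    rw [LinearMap.smul_apply, smul_eq_mul, two_mul, Complex.exp_add]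
  have hEm : E ∈ lieGC d p := F.rootVec_mem_lieGC a b
  have hSm : S ∈ lieGC d p := F.rootVec_mem_lieGC b a
  have hYm : E - z • S ∈ lieGC d p := sub_mem hEm (Submodule.smul_mem _ _ hSm)
  have hYσ := F.sub_sigma_fixed a b
  have hEc : toC (NormedSpace.exp (-(A : Mat d p))) * E * toC (NormedSpace.exp (A : Mat d p)) =
      q⁻¹ • E := by
    rw [exp_conj_rootSpace (F.rootVec_mem_rootSpace a b) A, Complex.exp_neg]
  have hSc : toC (NormedSpace.exp (-(A : Mat d p))) * S * toC (NormedSpace.exp (A : Mat d p)) =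
      q • S := by
    rw [exp_conj_rootSpace (F.rootVec_mem_rootSpace b a) A, ← neg_sub (F.w a), ← hγ,
      LinearMap.neg_apply, neg_neg]
  have hl := fun X => h.leftC hYm hYσ X
  rw [Matrix.mul_sub, Matrix.sub_mul, Matrix.mul_smul, Matrix.smul_mul, hEc, hSc] at hl
  have hr := fun X => h.rightC hYm hYσ X
  simp only [map_sub, map_smul, LinearMap.sub_apply, LinearMap.smul_apply, smul_eq_mul] at hl hr
  have e1 := hl S
  have e2 := hr S
  have e3 := h.swapC hEm hSm
  rw [hqq] at hq ⊢
  rw [← e3]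
  have hne : q * q - 1 ≠ 0 := sub_ne_zero.2 hq
  have e4 : bilC r E S = q * q * bilC r S E := by
    have : q * (q⁻¹ * bilC r E S - z * (q * bilC r S S)) = 0 := by rw [e1, mul_zero]
    rw [mul_sub, ← mul_assoc, mul_inv_cancel₀ hq0, one_mul] at this
    linear_combination this - q * q * e2
  rw [e4, div_mul_eq_mul_div, eq_div_iff hne]
  ring

/-- Such an element commutes with `𝔠'`, so conjugation by `exp(-A)` does not move it, and the common
sign `s` on all zero weights makes it fixed by the involution. Left invariance then kills it. -/
theorem bilC_rootVec_zero {A : c'} {r : Mat d p →ₗ[ℝ] Mat d p →ₗ[ℝ] ℂ} {ℓ : Mat d p →ₗ[ℝ] ℂ}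
    (h : IsRadial (A : Mat d p) r ℓ) (y z : Fin n₀) (X : MatC d p) :
    bilC r (F.rootVec (Sum.inr y) (Sum.inr z)) X = 0 := by
  set E := F.rootVec (Sum.inr y) (Sum.inr z) with hE
  have hS : F.rootVec (Sum.inr z) (Sum.inr y) = -E := by
    rw [hE, rootVec, rootVec, ofCoord_sub, ofCoord_sub]
    exact (neg_sub _ _).symm
  have hσ : sigmaMatC d p * E * sigmaMatC d p = E := by
    rw [hE, sigma_rootVec, hS]
    simp only [sgn, F.s_mul, neg_smul, one_smul, neg_neg]
    rfl
  have hm : E ∈ rootSpace c' 0 := by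
    have := F.rootVec_mem_rootSpace (Sum.inr y) (Sum.inr z)
    have h0 : F.w (Sum.inr y) - F.w (Sum.inr z) = 0 := by rw [w, w]; exact sub_self _
    rwa [h0] at this
  have := h.leftC hm.1 hσ X
  rw [exp_conj_rootSpace hm A] at this
  simpa using this

theorem rootVec_commutator {a b : WIdx N n₀} (hab : b ≠ opp a) :
    F.rootVec a b * F.rootVec b a - F.rootVec b a * F.rootVec a b =
      F.rootVec a a - F.rootVec b b := by
  have key : ∀ a b : WIdx N n₀, b ≠ opp a →
      F.coord (F.rootVec a b) * F.coord (F.rootVec b a) =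
        Matrix.single a a 1 + Matrix.single (opp b) (opp b) 1 := by
    intro a b hab
    have hab' : opp a ≠ b := fun h => hab h.symm
    have hab2 : a ≠ opp b := fun h => hab (by rw [h, opp_opp])
    rw [coord_rootVec, coord_rootVec, Matrix.sub_mul, Matrix.mul_sub, Matrix.mul_sub,
      Matrix.single_mul_single_same, Matrix.single_mul_single_of_ne _ _ _ _ hab,
      Matrix.single_mul_single_of_ne _ _ _ _ hab', Matrix.single_mul_single_same]
    simp
  have hba : a ≠ opp b := fun h => hab (by rw [h, opp_opp])
  apply F.coord_injective
  rw [coord_sub, coord_mul, coord_mul, coord_sub, key a b hab, key b a hba, coord_rootVec,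
    coord_rootVec]
  abel

theorem dualForm_comb {m : ℕ} (D : TraceDualBases c' m) (v u : Fin N → ℤ) :
    2 * dualForm D (comb F.δ v) (comb F.δ u) = ((∑ i, v i * u i : ℤ) : ℂ) := by
  have h1 : dualForm D (comb F.δ v) (comb F.δ u) =
      ∑ i, ∑ j, (v i : ℂ) * u j * dualForm D (F.δ i) (F.δ j) := by
    simp only [dualForm, comb, LinearMap.sum_apply, LinearMap.smul_apply, smul_eq_mul,
      Finset.sum_mul_sum]
    simp only [Finset.mul_sum]
    rw [Finset.sum_comm]
    refine Finset.sum_congr rfl fun i _ => ?_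
    rw [Finset.sum_comm]
    exact Finset.sum_congr rfl fun j _ => Finset.sum_congr rfl fun k _ => by ring
  rw [h1, Finset.mul_sum]
  push_cast
  refine Finset.sum_congr rfl fun i _ => ?_
  simp only [F.dualForm_basis, mul_ite, mul_zero, Finset.sum_ite_eq, Finset.mem_univ, if_true]
  ring

theorem two_mul_dualForm_w {m : ℕ} (D : TraceDualBases c' m) (a b : WIdx N n₀) :
    2 * dualForm D (F.w a) (F.w b) = (if a = b then 1 else 0) - (if opp a = b then 1 else 0) := by
  rw [w, w, dualForm_comb]
  rcases a with (a | a) | a <;> rcases b with (b | b) | b <;>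
    simp [wt, opp, Pi.single_apply, eq_comm] <;> split_ifs <;> simp

/-- The vector of `𝔠'_ℂ` that corresponds to a linear form under the trace form. -/
def dualVec {m : ℕ} (D : TraceDualBases c' m) (lam : Form c') : MatC d p :=
  ∑ k, lam (D.b k) • toC (D.b' k : Mat d p)

theorem dualVec_sub {m : ℕ} (D : TraceDualBases c' m) (lam mu : Form c') :
    dualVec D (lam - mu) = dualVec D lam - dualVec D mu := by
  simp [dualVec, sub_smul, Finset.sum_sub_distrib]

theorem coord_dualVec {m : ℕ} (D : TraceDualBases c' m) (lam : Form c') :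
    F.coord (dualVec D lam) = diagonal fun a => dualForm D lam (F.w a) := by
  have h : F.coord (dualVec D lam) = ∑ k, lam (D.b k) • F.coord (toC (D.b' k : Mat d p)) := by
    simp only [dualVec, coord_sum, coord_smul]
  rw [h]
  have h2 : ∀ k, F.coord (toC (D.b' k : Mat d p)) = diagonal fun a => F.w a (D.b' k) :=
    fun k => F.coord_restrict _
  ext a b
  rw [Matrix.sum_apply]
  simp only [h2, Matrix.smul_apply, diagonal_apply, smul_eq_mul, mul_ite, mul_zero]
  split_ifs with hab
  · rfl
  · simp

/-- Both sides are diagonal. The factor `2` compensates for the length `1/2` of the weights in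
`two_mul_dualForm_w`. -/
theorem rootVec_self {m : ℕ} (D : TraceDualBases c' m) (a : WIdx N n₀) :
    F.rootVec a a = (2 : ℂ) • dualVec D (F.w a) := by
  apply F.coord_injective
  rw [coord_smul, coord_dualVec]
  ext b e
  rw [coord_rootVec_apply, Matrix.smul_apply, diagonal_apply, smul_eq_mul]
  rcases eq_or_ne b e with rfl | hbe
  · rw [if_pos rfl, two_mul_dualForm_w]
    simp only [and_self]
  · rw [if_neg hbe, if_neg fun h => hbe (h.1.symm.trans h.2),
      if_neg fun h => hbe (h.1.symm.trans h.2), sub_self, mul_zero]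

theorem linC_dualVec {m : ℕ} (D : TraceDualBases c' m) (ℓ : Mat d p →ₗ[ℝ] ℂ) (lam : Form c') :
    linC ℓ (dualVec D lam) = ∑ k, lam (D.b k) * ℓ (D.b' k) := by
  simp [dualVec, linC_toC]

theorem linC_commutator {m : ℕ} (D : TraceDualBases c' m) (ℓ : Mat d p →ₗ[ℝ] ℂ)
    {a b : WIdx N n₀} (hab : b ≠ opp a) :
    linC ℓ (F.rootVec a b * F.rootVec b a - F.rootVec b a * F.rootVec a b) =
      2 * ∑ k, (F.w a - F.w b) (D.b k) * ℓ (D.b' k) := by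
  rw [F.rootVec_commutator hab, F.rootVec_self D, F.rootVec_self D, ← smul_sub, ← dualVec_sub,
    map_smul, linC_dualVec, smul_eq_mul]

theorem sum_w_mul_w (Z W : c') :
    ∑ a, F.w a Z * F.w a W = ((trace ((Z : Mat d p) * (W : Mat d p)) : ℝ) : ℂ) := by
  rw [← trace_toC, ← F.trace_coord, toC_mul, coord_mul]
  have h : ∀ Z : c', F.coord (toC (Z : Mat d p)) = diagonal fun a => F.w a Z := F.coord_restrict
  rw [h, h, diagonal_mul_diagonal, trace_diagonal]

theorem sum_bilC_rootVec_self {m : ℕ} (D : TraceDualBases c' m)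
    (r : Mat d p →ₗ[ℝ] Mat d p →ₗ[ℝ] ℂ) :
    ∑ a, bilC r (F.rootVec a a) (F.rootVec a a) = 4 * ∑ k, ∑ l,
      ((trace ((D.b k : Mat d p) * (D.b l : Mat d p)) : ℝ) : ℂ) * r (D.b' k) (D.b' l) := by
  have h : ∀ a, bilC r (F.rootVec a a) (F.rootVec a a) =
      4 * ∑ k, ∑ l, F.w a (D.b k) * F.w a (D.b l) * r (D.b' k) (D.b' l) := by
    intro a
    rw [F.rootVec_self D, map_smul, map_smul, LinearMap.smul_apply, smul_eq_mul, smul_eq_mul,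
      ← mul_assoc, show (2 : ℂ) * 2 = 4 by norm_num]
    congr 1
    simp only [dualVec, map_sum, map_smul, LinearMap.sum_apply, LinearMap.smul_apply, smul_eq_mul,
      bilC_toC]
    rw [Finset.sum_comm]
    exact Finset.sum_congr rfl fun k _ => by
      try rw [Finset.mul_sum]
      exact Finset.sum_congr rfl fun l _ => by ring
  simp only [h, ← Finset.mul_sum]
  congr 1
  rw [Finset.sum_comm]
  refine Finset.sum_congr rfl fun k _ => ?_
  rw [Finset.sum_comm]
  refine Finset.sum_congr rfl fun l _ => ?_
  rw [← Finset.sum_mul, F.sum_w_mul_w]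

theorem trace_mul_rootVec {X : MatC d p} (hX : X ∈ lieGC d p) (a b : WIdx N n₀) :
    trace (X * F.rootVec b a) = 2 * F.coord X a b := by
  rw [← F.trace_coord, coord_mul, coord_rootVec, Matrix.mul_sub, trace_sub,
    Matrix.trace_mul_single, Matrix.trace_mul_single, F.mem_lieGC_iff.1 hX (opp b) (opp a)]
  simp
  ring

/-- The factor `1/4` has two sources: the trace against `rootVec b a` is twice a coordinate of `X`,
and the mirrored pairs `(a, b)` and `(opp b, opp a)` give the same summand. -/
theorem eq_sum_rootVec {X : MatC d p} (hX : X ∈ lieGC d p) :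
    X = (1 / 4 : ℂ) • ∑ a, ∑ b, trace (X * F.rootVec b a) • F.rootVec a b := by
  apply F.coord_injective
  have hs : F.coord (∑ a, ∑ b, trace (X * F.rootVec b a) • F.rootVec a b) =
      ∑ a, ∑ b, trace (X * F.rootVec b a) • F.coord (F.rootVec a b) := by
    simp only [coord_sum, coord_smul]
  rw [coord_smul, hs]
  ext c e
  simp only [Matrix.smul_apply, Matrix.sum_apply, F.trace_mul_rootVec hX, coord_rootVec_apply,
    smul_eq_mul, mul_sub, Finset.sum_sub_distrib]
  have e1 : ∑ a, ∑ b, 2 * F.coord X a b * (if a = c ∧ b = e then 1 else 0) =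
      2 * F.coord X c e := by
    rw [Finset.sum_eq_single c, Finset.sum_eq_single e] <;> simp +contextual
  have e2 : ∑ a, ∑ b, 2 * F.coord X a b * (if opp b = c ∧ opp a = e then 1 else 0) =
      2 * F.coord X (opp e) (opp c) := by
    rw [Finset.sum_eq_single (opp e), Finset.sum_eq_single (opp c)] <;>
      simp +contextual [opp_eq_iff]
  rw [e1, e2, F.mem_lieGC_iff.1 hX c e]
  ring

theorem sum_trace_toC {m : ℕ} {x y : Fin m → Mat d p}
    (hxy : ∀ X ∈ lieG d p, ∑ i, trace (x i * X) • y i = X) {X : MatC d p} (hX : X ∈ lieGC d p) :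
    ∑ i, trace (toC (x i) * X) • toC (y i) = X := by
  obtain ⟨h1, h2⟩ := mem_lieGC_iff_re_im.1 hX
  have e : ∀ W, W ∈ lieG d p → ∑ i, trace (toC (x i) * toC W) • toC (y i) = toC W := by
    intro W hW
    conv_rhs => rw [← hxy W hW, toC_sum]
    refine Finset.sum_congr rfl fun i _ => ?_
    rw [toC_smul, ← toC_mul, trace_toC]
  rw [eq_re_add_im X]
  simp only [Matrix.mul_add, Matrix.mul_smul, trace_add, trace_smul, add_smul, Finset.sum_add_distrib,
    smul_assoc, ← Finset.smul_sum]
  rw [e _ h1, e _ h2]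

/-- The Casimir sum in terms of the weight basis. -/
theorem sum_eq_sum_rootVec {m : ℕ} {x y : Fin m → Mat d p} (hx : ∀ i, x i ∈ lieG d p)
    (hxy : ∀ X ∈ lieG d p, ∑ i, trace (x i * X) • y i = X)
    (r : Mat d p →ₗ[ℝ] Mat d p →ₗ[ℝ] ℂ) :
    ∑ i, r (x i) (y i) = (1 / 4 : ℂ) * ∑ a, ∑ b, bilC r (F.rootVec a b) (F.rootVec b a) := by
  have h1 : ∀ i, r (x i) (y i) = (1 / 4 : ℂ) * ∑ a, ∑ b,
      trace (toC (x i) * F.rootVec b a) * bilC r (F.rootVec a b) (toC (y i)) := by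
    intro i
    have hm : toC (x i) ∈ lieGC d p := by
      rw [mem_lieGC_iff_re_im, reM_toC, imM_toC]
      exact ⟨hx i, zero_mem _⟩
    rw [← bilC_toC]
    conv_lhs => rw [F.eq_sum_rootVec hm]
    simp only [map_smul, map_sum, LinearMap.smul_apply, LinearMap.sum_apply, smul_eq_mul]
  simp only [h1, ← Finset.mul_sum]
  congr 1
  rw [Finset.sum_comm]
  refine Finset.sum_congr rfl fun a _ => ?_
  rw [Finset.sum_comm]
  refine Finset.sum_congr rfl fun b _ => ?_
  conv_rhs => rw [← sum_trace_toC hxy (F.rootVec_mem_lieGC b a)]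
  simp only [map_smul, map_sum, smul_eq_mul]

end WeightFrame

end Defect

end

noncomputable section

namespace Defect

/-! ### The radial part of the Casimir element -/

section Orthonormal

variable {d p m N : ℕ} {c' : Submodule ℝ (Mat d p)}

theorem dualForm_symm (D : TraceDualBases c' m) (F : Form c') (Z : c') :
    ∑ k, ((trace ((Z : Mat d p) * (D.b k : Mat d p)) : ℝ) : ℂ) * F (D.b' k) = F Z := by
  have h := congrArg F (D.sum_trace_left Z)
  rw [map_sum] at h
  rw [← h]
  refine Finset.sum_congr rfl fun k _ => ?_
  rw [map_smul, Complex.real_smul, trace_mul_comm]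

/-- The linear form that corresponds to a vector under the trace form. -/
def traceForm (c' : Submodule ℝ (Mat d p)) (Z : c') : Form c' :=
  Complex.ofRealLI.toLinearMap ∘ₗ (Matrix.traceLinearMap (Idx d p) ℝ ℝ) ∘ₗ
    (LinearMap.mulLeft ℝ (Z : Mat d p)) ∘ₗ c'.subtype

theorem traceForm_apply (Z W : c') :
    traceForm c' Z W = ((trace ((Z : Mat d p) * (W : Mat d p)) : ℝ) : ℂ) := rfl

/-- Parseval's identity: the form `tr(Z ·)` is expanded in the basis `ξ`, and its coefficients are
the values `ξ i Z`. Orthonormality and the dimension count make `ξ` a basis over `ℂ`. It lets an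
arbitrary orthonormal frame be traded for the trace form in the second-order term. -/
theorem sum_orthonormal_mul (D : TraceDualBases c' m) {ξ : Fin N → Form c'}
    (hξ : ∀ i j, dualForm D (ξ i) (ξ j) = if i = j then 1 else 0)
    (hN : Module.finrank ℂ (Form c') = N) (Z W : c') :
    ∑ i, ξ i Z * ξ i W = ((trace ((Z : Mat d p) * (W : Mat d p)) : ℝ) : ℂ) := by
  have hlin : LinearIndependent ℂ ξ := by
    rw [Fintype.linearIndependent_iff]
    intro g hg j
    have h1 : dualForm D (∑ i, g i • ξ i) (ξ j) = ∑ i, g i * dualForm D (ξ i) (ξ j) := by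
      simp only [dualForm, LinearMap.sum_apply, LinearMap.smul_apply, smul_eq_mul,
        Finset.sum_mul, Finset.mul_sum]
      rw [Finset.sum_comm]
      exact Finset.sum_congr rfl fun i _ => Finset.sum_congr rfl fun k _ => by ring
    have h0 : dualForm D 0 (ξ j) = 0 := by simp [dualForm]
    rw [hg, h0] at h1
    simpa [hξ] using h1.symm
  have hspan : ⊤ ≤ Submodule.span ℂ (Set.range ξ) := by
    rw [hlin.span_eq_top_of_card_eq_finrank' (by rw [hN, Fintype.card_fin])]
  let B := Module.Basis.mk hlin hspan
  have hB : ∀ i, B i = ξ i := fun i => Module.Basis.mk_apply hlin hspan i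
  have hexp : ∀ lam : Form c', lam = ∑ i, dualForm D lam (ξ i) • ξ i := by
    intro lam
    have h1 : lam = ∑ i, B.repr lam i • ξ i := by
      conv_lhs => rw [← B.sum_repr lam]
      simp only [hB]
    have h2 : ∀ j, dualForm D lam (ξ j) = B.repr lam j := by
      intro j
      have h3 : dualForm D (∑ i, B.repr lam i • ξ i) (ξ j) =
          ∑ i, B.repr lam i * dualForm D (ξ i) (ξ j) := by
        simp only [dualForm, LinearMap.sum_apply, LinearMap.smul_apply, smul_eq_mul,
          Finset.sum_mul, Finset.mul_sum]
        rw [Finset.sum_comm]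
        exact Finset.sum_congr rfl fun i _ => Finset.sum_congr rfl fun k _ => by ring
      rw [← h1] at h3
      simpa [hξ] using h3
    simp only [h2]
    exact h1
  have h1 := LinearMap.congr_fun (hexp (traceForm c' Z)) W
  have h2 : ∀ i, dualForm D (traceForm c' Z) (ξ i) = ξ i Z := fun i => by
    rw [← dualForm_symm D (ξ i) Z]; rfl
  simp only [h2, LinearMap.sum_apply, LinearMap.smul_apply, smul_eq_mul] at h1
  rw [← h1, traceForm_apply]

end Orthonormal

namespace WeightFrame

variable {d p N n₀ : ℕ} {c' : Submodule ℝ (Mat d p)} (F : WeightFrame c' N n₀)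

/-- The first-order term of a root, up to the multiplicity. -/
def rootTerm {m : ℕ} (D : TraceDualBases c' m) (ℓ : Mat d p →ₗ[ℝ] ℂ) (A : c') (α : Form c') : ℂ :=
  (1 + Complex.exp (-α A)) / (1 - Complex.exp (-α A)) * ∑ k, α (D.b k) * ℓ (D.b' k)

/-- Both factors are odd in `α`. Hence a sum over all roots folds onto any system of positive roots.
-/
theorem rootTerm_neg {m : ℕ} (D : TraceDualBases c' m) (ℓ : Mat d p →ₗ[ℝ] ℂ) (A : c')
    (α : Form c') : rootTerm D ℓ A (-α) = rootTerm D ℓ A α := by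
  have h1 : ∑ k, (-α) (D.b k) * ℓ (D.b' k) = -∑ k, α (D.b k) * ℓ (D.b' k) := by
    simp [Finset.sum_neg_distrib]
  have h0 : Complex.exp (α A) ≠ 0 := Complex.exp_ne_zero _
  have h2 : (1 + Complex.exp (-(-α) A)) / (1 - Complex.exp (-(-α) A)) =
      -((1 + Complex.exp (-α A)) / (1 - Complex.exp (-α A))) := by
    rw [LinearMap.neg_apply, neg_neg, Complex.exp_neg]
    -- When the denominators vanish, both quotients are zero by the convention for division by zero,
    -- so no regularity is needed here.
    by_cases h3 : Complex.exp (α A) = 1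
    · simp [h3]
    · have h4 : 1 - Complex.exp (α A) ≠ 0 := sub_ne_zero.2 (Ne.symm h3)
      have h5 : 1 - (Complex.exp (α A))⁻¹ ≠ 0 := by
        rw [sub_ne_zero]
        intro h
        exact h3 (by rw [← inv_inv (Complex.exp (α A)), ← h, inv_one])
      have h6 : 1 - (Complex.exp (α A))⁻¹ = -(1 - Complex.exp (α A)) * (Complex.exp (α A))⁻¹ := by
        field_simp; ring
      rw [h6]
      field_simp
      ring
  rw [rootTerm, rootTerm, h1, h2]; ring

theorem rootTerm_zero {m : ℕ} (D : TraceDualBases c' m) (ℓ : Mat d p →ₗ[ℝ] ℂ) (A : c') :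
    rootTerm D ℓ A 0 = 0 := by
  simp [rootTerm]

/-- Only the weight zero has multiplicity greater than one. -/
theorem wt_eq_of_ne {a b : WIdx N n₀} (h : wt a = wt b) (hab : a ≠ b) :
    ∃ y z, a = Sum.inr y ∧ b = Sum.inr z := by
  rcases exists_signedIdx a with ⟨y, rfl⟩ | ⟨i, s, hs, rfl⟩ <;>
  rcases exists_signedIdx b with ⟨z, rfl⟩ | ⟨j, r, hr, rfl⟩
  · exact ⟨y, z, rfl, rfl⟩
  · rw [wt_signedIdx j hr] at h
    have := congrFun h j
    simp only [wt, Pi.zero_apply, Pi.single_eq_same] at this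
    omega
  · rw [wt_signedIdx i hs] at h
    have := congrFun h i
    simp only [wt, Pi.zero_apply, Pi.single_eq_same] at this
    omega
  · rw [wt_signedIdx i hs, wt_signedIdx j hr] at h
    have h1 := congrFun h i
    simp only [Pi.single_apply] at h1
    have : i = j ∧ s = r := by grind
    exact absurd (by rw [this.1, this.2]) hab

theorem two_smul_mem_doubledRoots {a b : WIdx N n₀} (hab : b ≠ opp a) (hw : F.w a ≠ F.w b) :
    (2 : ℂ) • (F.w a - F.w b) ∈ doubledRoots c' :=
  ⟨_, F.mem_roots_iff.2 ⟨sub_ne_zero.2 hw, ⟨(a, b), F.mem_pairs.2 ⟨hab, rfl⟩⟩⟩, rfl⟩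

/-- The contribution of a pair of indices to the Casimir element. -/
theorem bilC_add_swap {m : ℕ} (D : TraceDualBases c' m) {A : c'}
    {r : Mat d p →ₗ[ℝ] Mat d p →ₗ[ℝ] ℂ} {ℓ : Mat d p →ₗ[ℝ] ℂ}
    (h : IsRadial (A : Mat d p) r ℓ) (hreg : ∀ α ∈ doubledRoots c', Complex.exp (α A) ≠ 1)
    {a b : WIdx N n₀} (hne : a ≠ b) (hab : b ≠ opp a) :
    bilC r (F.rootVec a b) (F.rootVec b a) + bilC r (F.rootVec b a) (F.rootVec a b) =
      rootTerm D ℓ A ((2 : ℂ) • (F.w a - F.w b)) := by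
  by_cases hw : F.w a = F.w b
  · obtain ⟨y, z, rfl, rfl⟩ := wt_eq_of_ne (comb_injective F.δ hw) hne
    rw [F.bilC_rootVec_zero h, F.bilC_rootVec_zero h, hw, sub_self, smul_zero, rootTerm_zero,
      add_zero]
  · have hq := hreg _ (F.two_smul_mem_doubledRoots hab hw)
    rw [F.bilC_rootVec_add h a b hq, F.linC_commutator D ℓ hab, rootTerm, Complex.exp_neg]
    set q := Complex.exp (((2 : ℂ) • (F.w a - F.w b)) A) with hqdef
    have hq0 : q ≠ 0 := Complex.exp_ne_zero _
    have h1 : q - 1 ≠ 0 := sub_ne_zero.2 hq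
    have h2 : (1 + q⁻¹) / (1 - q⁻¹) = (q + 1) / (q - 1) := by
      have : 1 - q⁻¹ = (q - 1) * q⁻¹ := by field_simp
      rw [this]
      field_simp
    rw [h2]
    congr 1
    simp only [LinearMap.smul_apply, smul_eq_mul, Finset.mul_sum, mul_assoc]

/-- Doubling symmetrizes the sum in `a` and `b`, which is what `bilC_add_swap` needs. Diagonal pairs
give the second-order part, pairs `(a, opp a)` vanish, and all others give first-order terms.
Diagonal pairs inside the last sum are harmless because `rootTerm` is zero at `0`. -/
theorem sum_rootVec_eq {m : ℕ} (D : TraceDualBases c' m) {A : c'}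
    {r : Mat d p →ₗ[ℝ] Mat d p →ₗ[ℝ] ℂ} {ℓ : Mat d p →ₗ[ℝ] ℂ}
    (h : IsRadial (A : Mat d p) r ℓ) (hreg : ∀ α ∈ doubledRoots c', Complex.exp (α A) ≠ 1) :
    2 * ∑ a, ∑ b, bilC r (F.rootVec a b) (F.rootVec b a) =
      2 * ∑ a, bilC r (F.rootVec a a) (F.rootVec a a) +
      ∑ x : WIdx N n₀ × WIdx N n₀ with x.2 ≠ opp x.1,
        rootTerm D ℓ A ((2 : ℂ) • (F.w x.1 - F.w x.2)) := by
  have h1 : ∀ a b, bilC r (F.rootVec a b) (F.rootVec b a) + bilC r (F.rootVec b a) (F.rootVec a b) =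
      2 * (if a = b then bilC r (F.rootVec a a) (F.rootVec a a) else 0) +
      if b ≠ opp a then rootTerm D ℓ A ((2 : ℂ) • (F.w a - F.w b)) else 0 := by
    intro a b
    by_cases hne : a = b
    · subst hne
      rw [sub_self, smul_zero, rootTerm_zero, ite_self, if_pos rfl]; ring
    · rw [if_neg hne, mul_zero, zero_add]
      by_cases hab : b = opp a
      · subst hab
        rw [F.rootVec_opp, if_neg (not_not.2 rfl)]
        simp
      · rw [if_pos hab, F.bilC_add_swap D h hreg hne hab]
  have h2 : 2 * ∑ a, ∑ b, bilC r (F.rootVec a b) (F.rootVec b a) =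
      ∑ a, ∑ b, (bilC r (F.rootVec a b) (F.rootVec b a) +
        bilC r (F.rootVec b a) (F.rootVec a b)) := by
    simp only [Finset.sum_add_distrib]
    rw [two_mul]
    congr 1
    exact Finset.sum_comm
  rw [h2, Finset.sum_filter, Fintype.sum_prod_type]
  simp only [h1, Finset.sum_add_distrib, Finset.sum_ite_eq, Finset.mem_univ, if_true,
    ← Finset.mul_sum]

/-- Swapping the two indices negates the root, which accounts for the factor `2`. The fibre over a
positive root `α` is `pairs` of `α / 2`, whose size is twice the dimension of the root space, that
is `4 * mult c' α`. -/
theorem sum_rootTerm_eq {m : ℕ} (D : TraceDualBases c' m) (A : c') (ℓ : Mat d p →ₗ[ℝ] ℂ)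
    {P : Finset (Form c')} (hP : IsPositiveSystem (doubledRoots c') P) :
    ∑ x : WIdx N n₀ × WIdx N n₀ with x.2 ≠ opp x.1,
        rootTerm D ℓ A ((2 : ℂ) • (F.w x.1 - F.w x.2)) =
      2 * ∑ α ∈ P, 4 * (mult c' α : ℂ) * rootTerm D ℓ A α := by
  classical
  obtain ⟨lin, hlin, hPeq⟩ := hP
  have hmemP : ∀ α, α ∈ P ↔ α ∈ doubledRoots c' ∧ 0 < lin α := fun α => by
    rw [← Finset.mem_coe, hPeq]; rfl
  set U : Finset (WIdx N n₀ × WIdx N n₀) := Finset.univ.filter fun x => x.2 ≠ opp x.1 with hU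
  set φ : WIdx N n₀ × WIdx N n₀ → Form c' := fun x => (2 : ℂ) • (F.w x.1 - F.w x.2) with hφ
  have hswap : ∀ x, φ x.swap = -φ x := fun x => by
    simp only [hφ, Prod.fst_swap, Prod.snd_swap, ← smul_neg, neg_sub]
  have hUswap : ∀ x ∈ U, x.swap ∈ U := by
    intro x hx
    rw [hU, Finset.mem_filter] at hx ⊢
    exact ⟨Finset.mem_univ _, fun h => hx.2 (by
      rw [Prod.snd_swap, Prod.fst_swap] at h; rw [h, opp_opp])⟩
  have hroot : ∀ x ∈ U, φ x ≠ 0 → φ x ∈ doubledRoots c' := by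
    intro x hx h0
    refine F.two_smul_mem_doubledRoots (Finset.mem_filter.1 hx).2 fun hw => h0 ?_
    simp only [hφ, hw, sub_self, smul_zero]
  -- split according to the sign of the linear form
  have hsplit : ∀ x ∈ U, rootTerm D ℓ A (φ x) =
      (if φ x ∈ P then rootTerm D ℓ A (φ x) else 0) +
      (if -φ x ∈ P then rootTerm D ℓ A (-φ x) else 0) := by
    intro x hx
    rw [rootTerm_neg]
    by_cases h0 : φ x = 0
    · rw [h0, neg_zero, rootTerm_zero]; simp
    · have hr := hroot x hx h0
      have hr' : -φ x ∈ doubledRoots c' := by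
        rw [← hswap]
        exact hroot _ (hUswap x hx) (by rw [hswap]; exact neg_ne_zero.2 h0)
      rcases lt_or_gt_of_ne (hlin _ hr) with hneg | hpos
      · have h1 : φ x ∉ P := fun h => by linarith [((hmemP _).1 h).2]
        have h2 : -φ x ∈ P := (hmemP _).2 ⟨hr', by rw [map_neg]; linarith⟩
        rw [if_neg h1, if_pos h2, zero_add]
      · have h1 : φ x ∈ P := (hmemP _).2 ⟨hr, hpos⟩
        have h2 : -φ x ∉ P := fun h => by
          have := ((hmemP _).1 h).2
          rw [map_neg] at this; linarith
        rw [if_pos h1, if_neg h2, add_zero]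
  rw [Finset.sum_congr rfl hsplit, Finset.sum_add_distrib]
  have hsecond : ∑ x ∈ U, (if -φ x ∈ P then rootTerm D ℓ A (-φ x) else 0) =
      ∑ x ∈ U, (if φ x ∈ P then rootTerm D ℓ A (φ x) else 0) := by
    refine Finset.sum_bij' (fun x _ => x.swap) (fun x _ => x.swap) hUswap hUswap
      (fun x _ => Prod.swap_swap x) (fun x _ => Prod.swap_swap x) fun x _ => ?_
    rw [hswap]
  rw [hsecond, ← two_mul, ← Finset.sum_filter]
  congr 1
  rw [← Finset.sum_fiberwise_of_maps_to (g := φ) (t := P)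
    (fun x hx => (Finset.mem_filter.1 hx).2)]
  refine Finset.sum_congr rfl fun α hα => ?_
  have hfib : (U.filter (fun x => φ x ∈ P)).filter (fun x => φ x = α) =
      F.pairs ((1 / 2 : ℂ) • α) := by
    ext x
    rw [Finset.mem_filter, Finset.mem_filter, hU, Finset.mem_filter, mem_pairs]
    constructor
    · rintro ⟨⟨⟨-, h1⟩, -⟩, h2⟩
      refine ⟨h1, ?_⟩
      rw [← h2, hφ, smul_smul]; norm_num
    · rintro ⟨h1, h2⟩
      have h3 : φ x = α := by
        simp only [hφ, h2, smul_smul]; norm_num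
      exact ⟨⟨⟨Finset.mem_univ _, h1⟩, h3 ▸ hα⟩, h3⟩
  rw [hfib, Finset.sum_congr rfl (g := fun _ => rootTerm D ℓ A α), Finset.sum_const,
    ← F.finrank_rootSpace_mul_two, nsmul_eq_mul, mult]
  · push_cast; ring
  · intro x hx
    have h2 := (F.mem_pairs.1 hx).2
    have h3 : φ x = α := by
      simp only [hφ, h2, smul_smul]; norm_num
    rw [h3]

/-- The radial part of the quadratic Casimir element is the Heckman-Opdam Laplacian. -/
theorem casimir_radial {m m' : ℕ} (F : WeightFrame c' N n₀) (D : TraceDualBases c' m) {A : c'}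
    {r : Mat d p →ₗ[ℝ] Mat d p →ₗ[ℝ] ℂ} {ℓ : Mat d p →ₗ[ℝ] ℂ}
    (h : IsRadial (A : Mat d p) r ℓ) (hreg : ∀ α ∈ doubledRoots c', Complex.exp (α A) ≠ 1)
    {ξ : Fin N → Form c'} {P : Finset (Form c')}
    (hξ : IsOrthonormalFrame D (doubledRoots c') ξ) (hP : IsPositiveSystem (doubledRoots c') P)
    {x y : Fin m' → Mat d p} (hx : ∀ i, x i ∈ lieG d p)
    (hxy : ∀ X ∈ lieG d p, ∑ i, trace (x i * X) • y i = X) :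
    ∑ i, r (x i) (y i) =
      ∑ i, (∑ k, ∑ l, ξ i (D.b k) * ξ i (D.b l) * r (D.b' k) (D.b' l)) +
      ∑ α ∈ P, (mult c' α : ℂ) * ((1 + Complex.exp (-α A)) / (1 - Complex.exp (-α A))) *
        ∑ k, α (D.b k) * ℓ (D.b' k) := by
  have hfin : Module.finrank ℂ (Form c') = N := by
    rw [Module.finrank_eq_card_basis F.δ, Fintype.card_fin]
  have h1 := F.sum_rootVec_eq D h hreg
  rw [F.sum_rootTerm_eq D A ℓ hP, F.sum_bilC_rootVec_self D] at h1
  have h2 : ∑ i, (∑ k, ∑ l, ξ i (D.b k) * ξ i (D.b l) * r (D.b' k) (D.b' l)) =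
      ∑ k, ∑ l, ((trace ((D.b k : Mat d p) * (D.b l : Mat d p)) : ℝ) : ℂ) *
        r (D.b' k) (D.b' l) := by
    rw [Finset.sum_comm]
    refine Finset.sum_congr rfl fun k _ => ?_
    rw [Finset.sum_comm]
    refine Finset.sum_congr rfl fun l _ => ?_
    rw [← Finset.sum_mul, sum_orthonormal_mul D hξ.1 hfin]
  have h3 : ∑ α ∈ P, 4 * (mult c' α : ℂ) * rootTerm D ℓ A α =
      4 * ∑ α ∈ P, (mult c' α : ℂ) * ((1 + Complex.exp (-α A)) / (1 - Complex.exp (-α A))) *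
        ∑ k, α (D.b k) * ℓ (D.b' k) := by
    rw [Finset.mul_sum]
    exact Finset.sum_congr rfl fun α _ => by rw [rootTerm]; ring
  rw [F.sum_eq_sum_rootVec hx hxy r, h2]
  rw [h3] at h1
  -- The symmetrized identity carries the factor `2` on the left and `8` on both terms on the right,
  -- while the Casimir sum is `1/4` of the sum over index pairs.
  linear_combination (1 / 8 : ℂ) * h1

end WeightFrame

end Defect

end

noncomputable section

namespace Defect

/-! ### Regular elements -/

variable {d p : ℕ} {c' : Submodule ℝ (Mat d p)}

/-- The involution is an automorphism that acts by `-1` on `𝔠'`, so it negates roots. -/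
theorem sigma_mem_rootSpace (hc : c' ≤ lieGMinus d p) {γ : Form c'} {E : MatC d p}
    (hE : E ∈ rootSpace c' γ) : sigmaMatC d p * E * sigmaMatC d p ∈ rootSpace c' (-γ) := by
  have hSS : sigmaMatC d p * sigmaMatC d p = 1 := by
    have := congrArg toC (sigmaMat_mul_self (d := d) (p := p))
    rwa [toC_mul, toC_one] at this
  have hSη : sigmaMatC d p * etaC d p = etaC d p * sigmaMatC d p := by
    have := congrArg toC (sigmaMat_mul_eta (d := d) (p := p))
    rwa [toC_mul, toC_mul, toC_eta] at this
  have hST : (sigmaMatC d p)ᵀ = sigmaMatC d p := congrArg toC (sigmaMat_transpose (d := d) (p := p))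
  refine ⟨?_, fun Z => ?_⟩
  · have h1 := mem_lieGC.1 hE.1
    rw [mem_lieGC, transpose_mul, transpose_mul, hST]
    calc sigmaMatC d p * (Eᵀ * sigmaMatC d p) * etaC d p
        = sigmaMatC d p * (Eᵀ * (sigmaMatC d p * etaC d p)) := by simp only [Matrix.mul_assoc]
      _ = sigmaMatC d p * (Eᵀ * etaC d p) * sigmaMatC d p := by
          rw [hSη]; simp only [Matrix.mul_assoc]
      _ = -((sigmaMatC d p * etaC d p) * E * sigmaMatC d p) := by
          rw [h1, Matrix.mul_neg, Matrix.neg_mul]; simp only [Matrix.mul_assoc]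
      _ = _ := by rw [hSη]; simp only [Matrix.mul_assoc]
  · have hZ := congrArg toC (mem_lieGMinus.1 (hc Z.2)).2
    rw [toC_mul, toC_mul, toC_neg] at hZ
    change sigmaMatC d p * toC (Z : Mat d p) * sigmaMatC d p = -toC (Z : Mat d p) at hZ
    have h2 := hE.2 Z
    change toC (Z : Mat d p) * E - E * toC (Z : Mat d p) = γ Z • E at h2
    change toC (Z : Mat d p) * (sigmaMatC d p * E * sigmaMatC d p) -
      (sigmaMatC d p * E * sigmaMatC d p) * toC (Z : Mat d p) = _
    have h3 : toC (Z : Mat d p) * sigmaMatC d p = -(sigmaMatC d p * toC (Z : Mat d p)) := by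
      calc toC (Z : Mat d p) * sigmaMatC d p
          = -(sigmaMatC d p * toC (Z : Mat d p) * sigmaMatC d p) * sigmaMatC d p := by
            rw [hZ, neg_neg]
        _ = _ := by rw [Matrix.neg_mul, Matrix.mul_assoc (sigmaMatC d p * _), hSS, Matrix.mul_one]
    calc toC (Z : Mat d p) * (sigmaMatC d p * E * sigmaMatC d p) -
        (sigmaMatC d p * E * sigmaMatC d p) * toC (Z : Mat d p)
        = (toC (Z : Mat d p) * sigmaMatC d p) * E * sigmaMatC d p -
          sigmaMatC d p * E * (sigmaMatC d p * toC (Z : Mat d p)) := by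
            simp only [Matrix.mul_assoc]
      _ = -(sigmaMatC d p * (toC (Z : Mat d p) * E - E * toC (Z : Mat d p)) * sigmaMatC d p) := by
          have hR : sigmaMatC d p * (toC (Z : Mat d p) * E - E * toC (Z : Mat d p)) *
              sigmaMatC d p = sigmaMatC d p * toC (Z : Mat d p) * E * sigmaMatC d p -
                sigmaMatC d p * E * (toC (Z : Mat d p) * sigmaMatC d p) := by
            rw [Matrix.mul_sub, Matrix.sub_mul]; simp only [Matrix.mul_assoc]
          rw [hR, h3, Matrix.mul_neg, Matrix.neg_mul, Matrix.neg_mul]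
          abel
      _ = _ := by
          rw [h2, Matrix.mul_smul, Matrix.smul_mul, LinearMap.neg_apply, neg_smul]

theorem conj_mem_lieGMinus {T₀ X : Mat d p} (hT₀ : T₀ ∈ lieG d p)
    (hsq : NormedSpace.exp T₀ * NormedSpace.exp T₀ = 1)
    (hS : sigmaMat d p * NormedSpace.exp T₀ = NormedSpace.exp T₀ * sigmaMat d p)
    (hX : X ∈ lieGMinus d p) :
    NormedSpace.exp T₀ * X * NormedSpace.exp T₀ ∈ lieGMinus d p := by
  rw [mem_lieGMinus] at hX ⊢
  refine ⟨conj_mem_lieG (exp_transpose_eta hT₀) hsq hX.1, ?_⟩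
  calc sigmaMat d p * (NormedSpace.exp T₀ * X * NormedSpace.exp T₀) * sigmaMat d p
      = (sigmaMat d p * NormedSpace.exp T₀) * X * (NormedSpace.exp T₀ * sigmaMat d p) := by
        simp only [Matrix.mul_assoc]
    _ = NormedSpace.exp T₀ * (sigmaMat d p * X * sigmaMat d p) * NormedSpace.exp T₀ := by
        rw [← hS, hS]; simp only [Matrix.mul_assoc]; rw [hS]
    _ = _ := by rw [hX.2, Matrix.mul_neg, Matrix.neg_mul]

/-- If `e^{2γ(A)} = 1`, then `e^{±γ(A)}` is one common sign `ε`. For a root vector `E` with image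
`E'` under the involution, `E - E'` is antiinvariant, and `Ad(exp(-A))` scales it by `ε`. Its real
and imaginary parts therefore lie in `𝔤^{-σ} ∩ Ad(x) 𝔤^{-σ}` for `x = exp(A) t₀`, as does `𝔠'`.
Regularity makes them commute with `𝔠'`, and comparing weights forces `E = 0`. -/
theorem exp_doubledRoot_ne_one (hc : c' ≤ lieGMinus d p) (hcomm : IsComm c') {T₀ : Mat d p}
    (hT₀ : T₀ ∈ lieG d p) (hsq : NormedSpace.exp T₀ * NormedSpace.exp T₀ = 1)
    (hS : sigmaMat d p * NormedSpace.exp T₀ = NormedSpace.exp T₀ * sigmaMat d p) (A : c')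
    (hreg : IsRegularSemisimple d p (NormedSpace.exp (A : Mat d p) * NormedSpace.exp T₀))
    {α : Form c'} (hα : α ∈ doubledRoots c') : Complex.exp (α A) ≠ 1 := by
  obtain ⟨γ, ⟨hγ0, hγ⟩, rfl⟩ := hα
  intro hone
  obtain ⟨E, hE, hE0⟩ := Submodule.exists_mem_ne_zero_of_ne_bot hγ
  apply hE0
  set a := NormedSpace.exp (A : Mat d p) with ha
  set a' := NormedSpace.exp (-(A : Mat d p)) with ha'
  set t₀ := NormedSpace.exp T₀
  have hinv : (a * t₀)⁻¹ = t₀ * a' := by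
    apply Matrix.inv_eq_right_inv
    rw [Matrix.mul_assoc, ← Matrix.mul_assoc t₀, hsq, Matrix.one_mul, exp_mul_exp_neg]
  have hcrit : ∀ X, a' * X * a ∈ lieGMinus d p → (a * t₀)⁻¹ * X * (a * t₀) ∈ lieGMinus d p := by
    intro X hX
    rw [hinv]
    have := conj_mem_lieGMinus hT₀ hsq hS hX
    convert this using 1
    simp only [Matrix.mul_assoc]; rfl
  set E' := sigmaMatC d p * E * sigmaMatC d p with hE'
  have hE'mem : E' ∈ rootSpace c' (-γ) := sigma_mem_rootSpace hc hE
  have hSS : sigmaMatC d p * sigmaMatC d p = 1 := by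
    have := congrArg toC (sigmaMat_mul_self (d := d) (p := p))
    rwa [toC_mul, toC_one] at this
  have hE'E : sigmaMatC d p * E' * sigmaMatC d p = E := by
    rw [hE']
    calc _ = (sigmaMatC d p * sigmaMatC d p) * E * (sigmaMatC d p * sigmaMatC d p) := by
          simp only [Matrix.mul_assoc]
      _ = E := by rw [hSS, Matrix.one_mul, Matrix.mul_one]
  have hq : Complex.exp (γ A) * Complex.exp (γ A) = 1 := by
    rw [← Complex.exp_add, ← hone]; congr 1
    rw [LinearMap.smul_apply, smul_eq_mul, two_mul]
  obtain ⟨ε, hε⟩ : ∃ ε : ℝ, Complex.exp (γ A) = ε ∧ Complex.exp (-γ A) = ε := by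
    have hinv' : Complex.exp (-γ A) = Complex.exp (γ A) := by
      rw [Complex.exp_neg]; exact inv_eq_of_mul_eq_one_left hq
    rcases mul_self_eq_one_iff.1 hq with h | h
    · exact ⟨1, by simp [h], by simp [hinv', h]⟩
    · exact ⟨-1, by simp [h], by simp [hinv', h]⟩
  have hconj : toC a' * (E - E') * toC a = (ε : ℂ) • (E - E') := by
    have h1 := exp_conj_rootSpace hE A
    have h2 := exp_conj_rootSpace hE'mem A
    rw [hε.2] at h1
    rw [LinearMap.neg_apply, neg_neg, hε.1] at h2
    rw [Matrix.mul_sub, Matrix.sub_mul, smul_sub]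
    exact congrArg₂ _ h1 h2
  have hDmem : E - E' ∈ lieGC d p := sub_mem hE.1 hE'mem.1
  have hσD : sigmaMatC d p * (E - E') * sigmaMatC d p = -(E - E') := by
    rw [Matrix.mul_sub, Matrix.sub_mul, hE'E, neg_sub]
  have hre : reM (E - E') ∈ lieGMinus d p := by
    rw [mem_lieGMinus]
    refine ⟨(mem_lieGC_iff_re_im.1 hDmem).1, ?_⟩
    rw [← reM_conj, ← reM_neg, ← hσD]; rfl
  have him : imM (E - E') ∈ lieGMinus d p := by
    rw [mem_lieGMinus]
    refine ⟨(mem_lieGC_iff_re_im.1 hDmem).2, ?_⟩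
    rw [← imM_conj, ← imM_neg, ← hσD]; rfl
  have hre' : (a * t₀)⁻¹ * reM (E - E') * (a * t₀) ∈ lieGMinus d p := by
    apply hcrit
    rw [← reM_conj, hconj, reM_smul]
    simpa using Submodule.smul_mem _ ε hre
  have him' : (a * t₀)⁻¹ * imM (E - E') * (a * t₀) ∈ lieGMinus d p := by
    apply hcrit
    rw [← imM_conj, hconj, imM_smul]
    simpa using Submodule.smul_mem _ ε him
  have hZmem : ∀ Z : c', (a * t₀)⁻¹ * (Z : Mat d p) * (a * t₀) ∈ lieGMinus d p := by
    intro Z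
    apply hcrit
    have h1 : a' * (Z : Mat d p) = (Z : Mat d p) * a' :=
      exp_mul_eq_mul_exp (by rw [Matrix.neg_mul, Matrix.mul_neg, hcomm _ A.2 _ Z.2])
    rw [h1, Matrix.mul_assoc, exp_neg_mul_exp, Matrix.mul_one]
    exact hc Z.2
  have hcommD : ∀ Z : c', toC (Z : Mat d p) * (E - E') = (E - E') * toC (Z : Mat d p) := by
    intro Z
    have h1 := hreg.2 _ (hc Z.2) _ hre (hZmem Z) hre'
    have h2 := hreg.2 _ (hc Z.2) _ him (hZmem Z) him'
    rw [eq_re_add_im (E - E'), Matrix.mul_add, Matrix.add_mul, Matrix.mul_smul, Matrix.smul_mul,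
      ← toC_mul, ← toC_mul, ← toC_mul, ← toC_mul, h1, h2]
  obtain ⟨Z, hZ⟩ : ∃ Z, γ Z ≠ 0 := by
    by_contra hcon
    push Not at hcon
    exact hγ0 (LinearMap.ext hcon)
  have h1 := hE.2 Z
  have h2 := hE'mem.2 Z
  have h3 := hcommD Z
  rw [Matrix.mul_sub, Matrix.sub_mul] at h3
  -- The bracket with `Z` sends `E - E'` to `γ(Z)(E + E')`. Thus `E' = -E`, and the same commutation
  -- relation applied to `E - E' = 2E` then kills `E`.
  have h4 : γ Z • (E + E') = 0 := by
    rw [smul_add, ← h1, ← neg_neg (γ Z • E'), ← neg_smul, ← LinearMap.neg_apply, ← h2]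
    change (toC (Z : Mat d p) * E - E * toC (Z : Mat d p)) +
      -(toC (Z : Mat d p) * E' - E' * toC (Z : Mat d p)) = 0
    rw [← sub_eq_zero] at h3
    rw [← h3]; abel
  have h5 : E' = -E := by
    rcases smul_eq_zero.1 h4 with h | h
    · exact absurd h hZ
    · exact (neg_eq_of_add_eq_zero_right h).symm
  have h6 := hcommD Z
  rw [h5, sub_neg_eq_add, Matrix.mul_add, Matrix.add_mul, ← sub_eq_zero] at h6
  have h7 : (γ Z + γ Z) • E = 0 := by
    rw [add_smul, ← h1, ← h6]
    change (toC (Z : Mat d p) * E - E * toC (Z : Mat d p)) +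
      (toC (Z : Mat d p) * E - E * toC (Z : Mat d p)) = _
    abel
  rcases smul_eq_zero.1 h7 with h | h
  · exact absurd (by simpa [← two_mul] using h) hZ
  · exact h

end Defect

end

/-! ### The Casimir element acting on defect blocks. -/

noncomputable section

namespace Defect

variable {d p : ℕ} {c' : Submodule ℝ (Mat d p)}

/-- Conjugation preserves the trace form, so conjugated dual bases are again dual. This invariance
of the Casimir element is why its left and right actions can be reduced to the same sum. -/
theorem sum_trace_conj {m : ℕ} (D : TraceDualBases (lieG d p) m) {g g' : Mat d p}
    (hg : g * g' = 1) {X : Mat d p} (hX : g' * X * g ∈ lieG d p) :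
    ∑ i, trace ((g * (D.b i : Mat d p) * g') * X) • (g * (D.b' i : Mat d p) * g') = X := by
  have h1 := congrArg (Submodule.subtype _) (D.sum_trace_left ⟨g' * X * g, hX⟩)
  simp only [map_sum, map_smul, Submodule.subtype_apply] at h1
  have h2 : ∀ i, trace ((g * (D.b i : Mat d p) * g') * X) =
      trace ((D.b i : Mat d p) * (g' * X * g)) := fun i => by
    rw [Matrix.mul_assoc, Matrix.mul_assoc, trace_mul_comm]
    simp only [Matrix.mul_assoc]
  calc ∑ i, trace ((g * (D.b i : Mat d p) * g') * X) • (g * (D.b' i : Mat d p) * g')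
      = g * (∑ i, trace ((D.b i : Mat d p) * (g' * X * g)) • (D.b' i : Mat d p)) * g' := by
        simp only [h2, Matrix.mul_sum, Matrix.sum_mul, Matrix.mul_smul, Matrix.smul_mul]
    _ = (g * g') * X * (g * g') := by rw [h1]; simp only [Matrix.mul_assoc]
    _ = X := by rw [hg, Matrix.one_mul, Matrix.mul_one]

/-- Left invariance gives the first condition directly. For the second, `t₀` is its own inverse and
commutes with `sigmaMat`, so conjugation by `t₀` preserves the fixed points of the involution and
right invariance applies. -/
theorem isRadial_mixedForm (hc : c' ≤ lieGMinus d p) {T₀ : Mat d p} (hT₀ : T₀ ∈ lieG d p)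
    (hsq : NormedSpace.exp T₀ * NormedSpace.exp T₀ = 1)
    (hS : sigmaMat d p * NormedSpace.exp T₀ = NormedSpace.exp T₀ * sigmaMat d p) (A : c')
    {f : Mat d p → ℂ} (hf : IsDefectBlock d p f) :
    IsRadial (A : Mat d p) (mixedForm f (NormedSpace.exp (A : Mat d p)) (NormedSpace.exp T₀))
      (firstForm f (NormedSpace.exp (A : Mat d p)) (NormedSpace.exp T₀)) := by
  have hA : (A : Mat d p) ∈ lieG d p := (hc A.2).1
  refine ⟨fun Y hY hσ X => mixedForm_left hf hA (exp_mem_G hT₀) hY hσ X,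
    fun Y hY hσ X => mixedForm_right hf (exp_mem_G hA) hT₀ hY ?_ X,
    fun X hX Y hY => mixedForm_sub_swap hf (exp_mem_G hA) (exp_mem_G hT₀) hX hY⟩
  have hneg : NormedSpace.exp (-T₀) = NormedSpace.exp T₀ := by
    calc NormedSpace.exp (-T₀) = NormedSpace.exp (-T₀) * (NormedSpace.exp T₀ * NormedSpace.exp T₀) := by
          rw [hsq, Matrix.mul_one]
      _ = NormedSpace.exp T₀ := by rw [← Matrix.mul_assoc, exp_neg_mul_exp, Matrix.one_mul]
  rw [hneg]
  calc sigmaMat d p * (NormedSpace.exp T₀ * Y * NormedSpace.exp T₀) * sigmaMat d p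
      = (sigmaMat d p * NormedSpace.exp T₀) * Y * (NormedSpace.exp T₀ * sigmaMat d p) := by
        simp only [Matrix.mul_assoc]
    _ = NormedSpace.exp T₀ * (sigmaMat d p * Y * sigmaMat d p) * NormedSpace.exp T₀ := by
        rw [← hS, hS]; simp only [Matrix.mul_assoc]; rw [hS]
    _ = _ := by rw [hσ]

/-- The Casimir element acts on defect blocks by the Heckman-Opdam Laplacian. -/
theorem casimir_eq_heckmanOpdam {N n₀ : ℕ} (F : WeightFrame c' N n₀) (hc : c' ≤ lieGMinus d p)
    (hcomm : IsComm c') {T₀ : Mat d p} (hT₀ : T₀ ∈ lieG d p)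
    (hsq : NormedSpace.exp T₀ * NormedSpace.exp T₀ = 1)
    (hS : sigmaMat d p * NormedSpace.exp T₀ = NormedSpace.exp T₀ * sigmaMat d p) (A : c')
    (hreg : ∀ α ∈ doubledRoots c', Complex.exp (α A) ≠ 1)
    {f : Mat d p → ℂ} (hf : IsDefectBlock d p f) {m : ℕ} (Dg : TraceDualBases (lieG d p) m)
    {m' : ℕ} (Dc : TraceDualBases c' m') {ξ : Fin N → Form c'} {P : Finset (Form c')}
    (hξ : IsOrthonormalFrame Dc (doubledRoots c') ξ)
    (hP : IsPositiveSystem (doubledRoots c') P) :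
    casimirLeft Dg f (NormedSpace.exp (A : Mat d p) * NormedSpace.exp T₀) =
        heckmanOpdam Dc ξ P (mult c')
          (fun Y : c' => f (NormedSpace.exp (Y : Mat d p) * NormedSpace.exp T₀)) A ∧
      casimirRight Dg f (NormedSpace.exp (A : Mat d p) * NormedSpace.exp T₀) =
        heckmanOpdam Dc ξ P (mult c')
          (fun Y : c' => f (NormedSpace.exp (Y : Mat d p) * NormedSpace.exp T₀)) A := by
  have hc' : c' ≤ lieG d p := fun X hX => (hc hX).1
  have hA : (A : Mat d p) ∈ lieG d p := hc' A.2
  have hrad := isRadial_mixedForm hc hT₀ hsq hS A hf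
  have hconj : ∀ {B X : Mat d p}, B ∈ lieG d p → X ∈ lieG d p →
      NormedSpace.exp (-B) * X * NormedSpace.exp B ∈ lieG d p := fun {B X} hB hX => by
    simpa using exp_conj_mem_lieG (neg_mem hB) hX
  have hH : ∀ {x y : Fin m → Mat d p}, (∀ i, x i ∈ lieG d p) →
      (∀ X ∈ lieG d p, ∑ i, trace (x i * X) • y i = X) →
      ∑ i, mixedForm f (NormedSpace.exp (A : Mat d p)) (NormedSpace.exp T₀) (x i) (y i) =
        heckmanOpdam Dc ξ P (mult c')
          (fun Y : c' => f (NormedSpace.exp (Y : Mat d p) * NormedSpace.exp T₀)) A := by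
    intro x y hx hxy
    rw [WeightFrame.casimir_radial F Dc hrad hreg hξ hP hx hxy, heckmanOpdam]
    congr 1
    · exact Finset.sum_congr rfl fun i _ =>
        (dirDeriv_dirDeriv_restrict hf hc' hcomm (exp_mem_G hT₀) Dc (ξ i) (ξ i) A).symm
    · refine Finset.sum_congr rfl fun α _ => ?_
      rw [dirDeriv_restrict hf hc' hcomm (exp_mem_G hT₀) Dc α A]
  constructor
  -- Left-invariant fields act to the right of `t₀`, so the dual bases are conjugated by `t₀`. For
  -- right-invariant fields, treated next, the conjugation is by `exp(-A)`.
  · rw [← hH (x := fun i => NormedSpace.exp T₀ * (Dg.b i : Mat d p) * NormedSpace.exp (-T₀))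
      (y := fun i => NormedSpace.exp T₀ * (Dg.b' i : Mat d p) * NormedSpace.exp (-T₀))
      (fun i => exp_conj_mem_lieG hT₀ (Dg.b i).2)
      (fun X hX => sum_trace_conj Dg (exp_mul_exp_neg T₀) (hconj hT₀ hX))]
    exact Finset.sum_congr rfl fun i _ =>
      leftInv_leftInv hf (exp_mem_G hA) hT₀ (Dg.b i).2 (Dg.b' i).2
  · rw [← hH (x := fun i => NormedSpace.exp (-(A : Mat d p)) * (Dg.b i : Mat d p) *
        NormedSpace.exp (A : Mat d p))
      (y := fun i => NormedSpace.exp (-(A : Mat d p)) * (Dg.b' i : Mat d p) *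
        NormedSpace.exp (A : Mat d p))
      (fun i => hconj hA (Dg.b i).2)
      (fun X hX => sum_trace_conj Dg (exp_neg_mul_exp _) (exp_conj_mem_lieG hA hX))]
    exact Finset.sum_congr rfl fun i _ =>
      rightInv_rightInv hf hA (exp_mem_G hT₀) (Dg.b i).2 (Dg.b' i).2

end Defect

end

noncomputable section

namespace Defect

/-! ### Construction of weight bases -/

/-- The resolution of the identity by an orthonormal basis. -/
theorem sum_vecMulVec_eq_one {α κ : Type*} [Fintype α] [Fintype κ] [DecidableEq α] [DecidableEq κ]
    {R : Type*} [CommRing R] (v : α → κ → R) (hcard : Fintype.card α = Fintype.card κ)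
    (hv : ∀ i j, v i ⬝ᵥ v j = if i = j then 1 else 0) :
    ∑ i, vecMulVec (v i) (v i) = 1 := by
  have h1 : (Matrix.of v) * (Matrix.of v)ᵀ = 1 := by
    ext i j
    rw [Matrix.one_apply, ← hv i j]; rfl
  have h2 := (Matrix.mul_eq_one_comm_of_card_eq _ _ _ hcard).1 h1
  rw [← h2]
  ext i j
  simp [Matrix.sum_apply, vecMulVec_apply, Matrix.mul_apply]

/-- A complex vector can be normalized unless it is isotropic. -/
theorem exists_sq_mul_eq_one {z : ℂ} (hz : z ≠ 0) : ∃ κ : ℂ, κ * κ * z = 1 := by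
  obtain ⟨k, hk⟩ := IsAlgClosed.exists_eq_mul_self z⁻¹
  exact ⟨k, by rw [← hk, inv_mul_cancel₀ hz]⟩

/-- An orthonormal family for a nondegenerate complex symmetric bilinear form extends to an
orthonormal basis. -/
theorem exists_orthonormal_extension {κ : Type} [Fintype κ] [DecidableEq κ] (E : Matrix κ κ ℂ)
    (hE : Eᵀ = E) (hdet : IsUnit E) (k : ℕ) :
    ∀ (α : Type) [Fintype α] [DecidableEq α] (v : α → κ → ℂ),
      Fintype.card κ = Fintype.card α + k →
      (∀ i j, v i ⬝ᵥ E *ᵥ v j = if i = j then 1 else 0) →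
      ∃ z : Fin k → κ → ℂ, (∀ i j, z i ⬝ᵥ E *ᵥ z j = if i = j then 1 else 0) ∧
        ∀ i j, v i ⬝ᵥ E *ᵥ z j = 0 := by
  have hsymm : ∀ x y : κ → ℂ, x ⬝ᵥ E *ᵥ y = y ⬝ᵥ E *ᵥ x := fun x y => by
    rw [dotProduct_mulVec, ← mulVec_transpose, hE, dotProduct_comm]
  induction k with
  | zero => exact fun α _ _ v _ _ => ⟨fun i => i.elim0, fun i => i.elim0, fun _ j => j.elim0⟩
  | succ k ih =>
    intro α _ _ v hcard hv
    obtain ⟨z₀, hz₀, hperp⟩ : ∃ z : κ → ℂ, z ≠ 0 ∧ ∀ i, v i ⬝ᵥ E *ᵥ z = 0 := by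
      have hlt : Module.finrank ℂ (α → ℂ) < Module.finrank ℂ (κ → ℂ) := by
        rw [Module.finrank_fintype_fun_eq_card, Module.finrank_fintype_fun_eq_card]; omega
      have := LinearMap.ker_ne_bot_of_finrank_lt (f := (Matrix.of v * E).mulVecLin) hlt
      obtain ⟨z, hz, hz0⟩ := Submodule.exists_mem_ne_zero_of_ne_bot this
      refine ⟨z, hz0, fun i => ?_⟩
      have h1 := congrFun (LinearMap.mem_ker.1 hz) i
      rw [mulVecLin_apply, ← mulVec_mulVec] at h1
      exact h1
    -- The orthogonal complement is non-zero for reasons of dimension, but `z₀` may be isotropic. If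
    -- the whole complement were isotropic, polarization would make `z₀` orthogonal to it. Since
    -- `z₀` is also orthogonal to the given family, it would lie in the radical of `E`.
    obtain ⟨z₁, hz₁, hperp₁⟩ : ∃ z : κ → ℂ, z ⬝ᵥ E *ᵥ z ≠ 0 ∧ ∀ i, v i ⬝ᵥ E *ᵥ z = 0 := by
      by_contra! hcon
      apply hz₀
      have hiso : ∀ z, (∀ i, v i ⬝ᵥ E *ᵥ z = 0) → z ⬝ᵥ E *ᵥ z = 0 := fun z hz => by
        by_contra h
        obtain ⟨i, hi⟩ := hcon z h
        exact hi (hz i)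
      have hpol : ∀ z, (∀ i, v i ⬝ᵥ E *ᵥ z = 0) → z ⬝ᵥ E *ᵥ z₀ = 0 := by
        intro z hz
        have h1 := hiso (z + z₀) fun i => by rw [mulVec_add, dotProduct_add, hz, hperp, add_zero]
        rw [mulVec_add, dotProduct_add, add_dotProduct, add_dotProduct, hiso z hz, hiso z₀ hperp,
          hsymm z₀ z] at h1
        linear_combination h1 / 2
      have hall : ∀ x, x ⬝ᵥ E *ᵥ z₀ = 0 := by
        intro x
        have h1 := hpol (x - ∑ i, (v i ⬝ᵥ E *ᵥ x) • v i) fun j => by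
          rw [mulVec_sub, dotProduct_sub, mulVec_sum, dotProduct_sum]
          simp only [mulVec_smul, dotProduct_smul, hv, smul_eq_mul, mul_ite, mul_one, mul_zero,
            Finset.sum_ite_eq, Finset.mem_univ, if_true, sub_self]
        rw [sub_dotProduct, sum_dotProduct] at h1
        simpa [smul_dotProduct, hperp] using h1
      have h2 : E *ᵥ z₀ = 0 := dotProduct_eq_zero _ fun x => by rw [dotProduct_comm]; exact hall x
      have h3 := Matrix.mulVec_injective_of_isUnit hdet
      exact h3 (by rw [h2, mulVec_zero])
    obtain ⟨c, hc⟩ := exists_sq_mul_eq_one hz₁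
    set w := c • z₁ with hw
    have hww : w ⬝ᵥ E *ᵥ w = 1 := by
      rw [hw, mulVec_smul, dotProduct_smul, smul_dotProduct, smul_eq_mul, smul_eq_mul, ← hc]; ring
    have hvw : ∀ i, v i ⬝ᵥ E *ᵥ w = 0 := fun i => by
      rw [hw, mulVec_smul, dotProduct_smul, hperp₁, smul_zero]
    obtain ⟨z, hz, hvz⟩ := ih (Option α) (fun o => o.elim w v)
      (by rw [hcard, Fintype.card_option]; omega) (by
        rintro (_ | i) (_ | j)
        · simpa using hww
        · simpa [hsymm w] using hvw j
        · simpa using hvw i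
        · simpa using hv i j)
    refine ⟨Fin.cons w z, ?_, ?_⟩
    · intro i j
      refine Fin.cases ?_ (fun i => ?_) i <;> refine Fin.cases ?_ (fun j => ?_) j
      · simpa using hww
      · simpa [(Fin.succ_ne_zero j).symm] using hvz none j
      · simpa [Fin.succ_ne_zero i, hsymm _ w] using hvz none i
      · simpa using hz i j
    · intro i j
      refine Fin.cases ?_ (fun j => ?_) j
      · simpa using hvw i
      · simpa using hvz (some i) j

variable {d p N n₀ : ℕ} {c' : Submodule ℝ (Mat d p)}

/-- On each plane spanned by `x i` and `y i`, `𝔠'` acts as an infinitesimal rotation, so `x i ± I y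
i` are eigenvectors with weights `±δ i`. They are isotropic, dual to each other up to a scalar, and
exchanged by the involution because it fixes `x i` and negates `y i`. -/
theorem WeightFrame.nonempty_of_vectors (hdim : n₀ + 2 * N = (d - p) + (p + 2))
    (x y : Fin N → Idx d p → ℂ) (z : Fin n₀ → Idx d p → ℂ) (s : ℂ) (hs : s * s = 1)
    (δ : Module.Basis (Fin N) ℂ (Form c'))
    (hxx : ∀ i j, x i ⬝ᵥ etaC d p *ᵥ x j = if i = j then 1 else 0)
    (hyy : ∀ i j, y i ⬝ᵥ etaC d p *ᵥ y j = if i = j then 1 else 0)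
    (hzz : ∀ i j, z i ⬝ᵥ etaC d p *ᵥ z j = if i = j then 1 else 0)
    (hxy : ∀ i j, x i ⬝ᵥ etaC d p *ᵥ y j = 0) (hxz : ∀ i j, x i ⬝ᵥ etaC d p *ᵥ z j = 0)
    (hyz : ∀ i j, y i ⬝ᵥ etaC d p *ᵥ z j = 0)
    (hσx : ∀ i, sigmaMatC d p *ᵥ x i = x i) (hσy : ∀ i, sigmaMatC d p *ᵥ y i = -y i)
    (hσz : ∀ i, sigmaMatC d p *ᵥ z i = s • z i)
    (hAx : ∀ (A : c') i, toC (A : Mat d p) *ᵥ x i = (Complex.I * δ i A) • y i)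
    (hAy : ∀ (A : c') i, toC (A : Mat d p) *ᵥ y i = (-Complex.I * δ i A) • x i)
    (hAz : ∀ (A : c') i, toC (A : Mat d p) *ᵥ z i = 0) :
    Nonempty (WeightFrame c' N n₀) := by
  have hsymm : ∀ v w : Idx d p → ℂ, v ⬝ᵥ etaC d p *ᵥ w = w ⬝ᵥ etaC d p *ᵥ v := fun v w => by
    rw [dotProduct_mulVec, ← mulVec_transpose, etaC_transpose, dotProduct_comm]
  -- `x i + I y i` and `x i - I y i` pair to `2`, so both are scaled by a square root of `1/2`.
  obtain ⟨r, hr⟩ := exists_sq_mul_eq_one (two_ne_zero (α := ℂ))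
  let col : WIdx N n₀ → Idx d p → ℂ := fun a => match a with
    | Sum.inl (Sum.inl j) => r • (x j + Complex.I • y j)
    | Sum.inl (Sum.inr j) => r • (x j - Complex.I • y j)
    | Sum.inr k => z k
  let P : Matrix (Idx d p) (WIdx N n₀) ℂ := Matrix.of fun i a => col a i
  let Q : Matrix (WIdx N n₀) (Idx d p) ℂ := Matrix.of fun a i => (Pᵀ * etaC d p) (opp a) i
  have hyx : ∀ i j, y i ⬝ᵥ etaC d p *ᵥ x j = 0 := fun i j => by rw [hsymm, hxy]
  have hzx : ∀ i j, z i ⬝ᵥ etaC d p *ᵥ x j = 0 := fun i j => by rw [hsymm, hxz]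
  have hzy : ∀ i j, z i ⬝ᵥ etaC d p *ᵥ y j = 0 := fun i j => by rw [hsymm, hyz]
  have hI := Complex.I_mul_I
  have hgram : ∀ a b, col (opp a) ⬝ᵥ etaC d p *ᵥ col b = if a = b then 1 else 0 := by
    rintro ((a | a) | a) ((b | b) | b) <;>
      simp only [col, opp, Sum.map_inl, Sum.map_inr, Sum.swap_inl, Sum.swap_inr, id_eq,
        mulVec_smul, mulVec_add, mulVec_sub, dotProduct_smul, smul_dotProduct, dotProduct_add,
        add_dotProduct, dotProduct_sub, sub_dotProduct, hxx, hyy, hzz, hxy, hxz, hyz, hyx, hzx,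
        hzy, smul_eq_mul, Sum.inl.injEq, Sum.inr.injEq, reduceCtorEq, if_false, mul_zero,
        add_zero, sub_zero, zero_add, sub_self] <;>
      split_ifs <;>
      first
        | ring1
        | linear_combination hr - r ^ 2 * hI
        | linear_combination r ^ 2 * hI
  have hQP : Q * P = 1 := by
    ext a b
    rw [Matrix.one_apply, ← hgram a b, dotProduct_mulVec]
    rfl
  have hcard : Fintype.card (WIdx N n₀) = Fintype.card (Idx d p) := by
    simp only [Fintype.card_sum, Fintype.card_fin]; omega
  have hmul : ∀ (M : MatC d p) i a, (M * P) i a = (M *ᵥ col a) i := fun M i a => rfl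
  refine ⟨⟨P, Q, s, δ, hs, hQP, (Matrix.mul_eq_one_comm_of_card_eq _ _ _ hcard).1 hQP,
    fun a i => rfl, fun Z => ?_, fun i a => ?_⟩⟩
  · ext i a
    rw [Matrix.mul_diagonal]
    change (toC (Z : Mat d p) *ᵥ col a) i = col a i * _
    rcases a with (a | a) | a
    · simp only [col, mulVec_smul, mulVec_add, hAx, hAy, wt, comb_single, Pi.smul_apply,
        Pi.add_apply, smul_eq_mul, LinearMap.smul_apply, Int.cast_one]
      linear_combination -(r * δ a Z * x a i) * hI
    · simp only [col, mulVec_smul, mulVec_sub, hAx, hAy, wt, comb_single, Pi.smul_apply,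
        Pi.sub_apply, smul_eq_mul, LinearMap.smul_apply, Int.cast_neg, Int.cast_one]
      linear_combination (r * δ a Z * x a i) * hI
    · simp [col, hAz, wt, comb]
  · change (sigmaMatC d p *ᵥ col a) i = _ * col (opp a) i
    rcases a with (a | a) | a
    · simp only [col, opp, sgn, mulVec_smul, mulVec_add, hσx, hσy, Sum.map_inl, Sum.swap_inl,
        Pi.smul_apply, Pi.add_apply, Pi.sub_apply, Pi.neg_apply, smul_eq_mul]
      ring
    · simp only [col, opp, sgn, mulVec_smul, mulVec_sub, hσx, hσy, Sum.map_inl, Sum.swap_inr,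
        Pi.smul_apply, Pi.add_apply, Pi.sub_apply, Pi.neg_apply, smul_eq_mul]
      ring
    · simp [col, opp, sgn, hσz]

/-- The diagonal matrix of the form on the last `p + 2` coordinates. -/
def eta₂ (p : ℕ) : Matrix (Fin (p + 2)) (Fin (p + 2)) ℝ := diagonal (lorentz (p + 1))

/-- The element of `𝔤^{-σ}` with given upper right block (up to signs). -/
def offDiag (d p : ℕ) : Matrix (Fin (d - p)) (Fin (p + 2)) ℝ →ₗ[ℝ] Mat d p where
  toFun M := fromBlocks 0 (M * eta₂ p) (-Mᵀ) 0
  map_add' M M' := by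
    rw [fromBlocks_add, Matrix.add_mul, transpose_add, neg_add, add_zero, add_zero]
  map_smul' c M := by simp [fromBlocks_smul]

theorem offDiag_apply (M : Matrix (Fin (d - p)) (Fin (p + 2)) ℝ) :
    offDiag d p M = fromBlocks 0 (M * eta₂ p) (-Mᵀ) 0 := rfl

theorem toC_offDiag_mulVec (M : Matrix (Fin (d - p)) (Fin (p + 2)) ℝ) (x : Fin (d - p) → ℂ)
    (y : Fin (p + 2) → ℂ) :
    toC (offDiag d p M) *ᵥ Sum.elim x y =
      Sum.elim (M.map Complex.ofReal *ᵥ ((eta₂ p).map Complex.ofReal *ᵥ y))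
        (-((M.map Complex.ofReal)ᵀ *ᵥ x)) := by
  have h1 : (M * eta₂ p).map Complex.ofReal = M.map Complex.ofReal * (eta₂ p).map Complex.ofReal :=
    Matrix.map_mul (f := Complex.ofRealHom)
  have h2 : (-Mᵀ).map Complex.ofReal = -(M.map Complex.ofReal)ᵀ := by ext; simp
  rw [toC, offDiag_apply, fromBlocks_map, fromBlocks_mulVec, h1, h2, mulVec_mulVec, neg_mulVec]
  simp

theorem etaC_mulVec (x : Fin (d - p) → ℂ) (y : Fin (p + 2) → ℂ) :
    etaC d p *ᵥ Sum.elim x y = Sum.elim x ((eta₂ p).map Complex.ofReal *ᵥ y) := by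
  rw [← toC_eta, eta_eq_fromBlocks, toC, fromBlocks_map, fromBlocks_mulVec]
  simp [eta₂]

theorem sigmaMatC_mulVec (x : Fin (d - p) → ℂ) (y : Fin (p + 2) → ℂ) :
    sigmaMatC d p *ᵥ Sum.elim x y = Sum.elim x (-y) := by
  rw [sigmaMatC, sigmaMat, fromBlocks_map, fromBlocks_mulVec]
  have : (-1 : Matrix (Fin (p + 2)) (Fin (p + 2)) ℝ).map Complex.ofReal = -1 := by
    ext i j; simp [Matrix.one_apply, apply_ite]
  rw [this, neg_mulVec]
  simp

theorem map_sum_vecMulVec_mulVec {m n α : Type*} [Fintype n] [Fintype α] (a : α → ℝ)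
    (u : α → m → ℝ) (y : α → n → ℝ) (v : n → ℂ) :
    (∑ j, a j • vecMulVec (u j) (y j)).map Complex.ofReal *ᵥ v =
      ∑ j, ((a j : ℂ) * ((Complex.ofReal ∘ y j) ⬝ᵥ v)) • (Complex.ofReal ∘ u j) := by
  ext i
  simp only [mulVec, dotProduct, Matrix.map_apply, Matrix.sum_apply, Matrix.smul_apply,
    vecMulVec_apply, smul_eq_mul, Finset.sum_apply, Pi.smul_apply, Function.comp_apply,
    Complex.ofReal_sum, Complex.ofReal_mul, Finset.sum_mul, Finset.mul_sum]
  rw [Finset.sum_comm]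
  exact Finset.sum_congr rfl fun j _ => Finset.sum_congr rfl fun k _ => by ring

theorem ofReal_comp_dotProduct {n : Type*} [Fintype n] (x y : n → ℝ) :
    (Complex.ofReal ∘ x) ⬝ᵥ (Complex.ofReal ∘ y) = ((x ⬝ᵥ y : ℝ) : ℂ) := by
  simp [dotProduct]

theorem map_ofReal_mulVec {m n : Type*} [Fintype n] (M : Matrix m n ℝ) (y : n → ℝ) :
    M.map Complex.ofReal *ᵥ (Complex.ofReal ∘ y) = Complex.ofReal ∘ (M *ᵥ y) := by
  ext i; simp [mulVec, dotProduct]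

theorem eta₂_mul_self (p : ℕ) : eta₂ p * eta₂ p = 1 := by
  rw [eta₂, diagonal_mul_diagonal, ← diagonal_one]; congr 1; ext i; exact lorentz_mul_self _ i

theorem eta₂_transpose (p : ℕ) : (eta₂ p)ᵀ = eta₂ p := diagonal_transpose _

theorem offDiag_injective : Function.Injective (offDiag d p) := by
  intro M M' h
  rw [offDiag_apply, offDiag_apply, fromBlocks_inj] at h
  exact transpose_injective (neg_injective h.2.2.1)

theorem linearIndependent_offDiag {α : Type*} [Fintype α] [DecidableEq α]
    {u : α → Fin (d - p) → ℝ} {y : α → Fin (p + 2) → ℝ} {ε : α → ℝ}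
    (hu : ∀ i j, u i ⬝ᵥ u j = if i = j then 1 else 0) (hε : ∀ i, ε i ≠ 0)
    (hy : ∀ i j, y i ⬝ᵥ eta₂ p *ᵥ y j = if i = j then ε i else 0) :
    LinearIndependent ℝ fun j => offDiag d p (vecMulVec (u j) (y j)) := by
  rw [Fintype.linearIndependent_iff]
  intro g hg k
  have h1 : ∑ j, g j • vecMulVec (u j) (y j) = 0 := by
    apply offDiag_injective (d := d) (p := p)
    rw [map_sum, map_zero, ← hg]
    simp
  have h2 := congrArg (fun M => u k ⬝ᵥ M *ᵥ (eta₂ p *ᵥ y k)) h1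
  simp only [sum_mulVec, smul_mulVec, vecMulVec_mulVec, dotProduct_sum, dotProduct_smul, hu, hy,
    zero_mulVec, dotProduct_zero] at h2
  simpa [hε] using h2

/-- A weight basis for the span of rank two matrices that are built from an orthonormal family
of vectors in the first coordinates and an orthogonal one in the last coordinates. -/
theorem WeightFrame.nonempty_of_span (hN : N = d - p ∨ N = p + 2)
    (hdim : n₀ + 2 * N = (d - p) + (p + 2)) {u : Fin N → Fin (d - p) → ℝ}
    {y : Fin N → Fin (p + 2) → ℝ} {ε : Fin N → ℝ}
    (hu : ∀ i j, u i ⬝ᵥ u j = if i = j then 1 else 0) (hε : ∀ i, ε i ≠ 0)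
    (hy : ∀ i j, y i ⬝ᵥ eta₂ p *ᵥ y j = if i = j then ε i else 0)
    (hc : c' = Submodule.span ℝ (Set.range fun j => offDiag d p (vecMulVec (u j) (y j)))) :
    Nonempty (WeightFrame c' N n₀) := by
  subst hc
  have hlin := linearIndependent_offDiag hu hε hy
  set c' := Submodule.span ℝ (Set.range fun j => offDiag d p (vecMulVec (u j) (y j))) with hc'
  let B : Module.Basis (Fin N) ℝ c' := Module.Basis.span hlin
  have hB : ∀ A : c', (A : Mat d p) =
      offDiag d p (∑ j, B.repr A j • vecMulVec (u j) (y j)) := by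
    intro A
    conv_lhs => rw [← B.sum_repr A]
    rw [Submodule.coe_sum, map_sum]
    refine Finset.sum_congr rfl fun j _ => ?_
    rw [Submodule.coe_smul, map_smul]
    congr 1
    exact congrArg Subtype.val (Module.Basis.span_apply hlin j)
  -- Over `ℂ` the vectors `y j` can be normalized whatever the sign of `ε j`. For a boost, where `ε
  -- j < 0`, the factor is imaginary, which makes the weight real; for a rotation the weight is
  -- imaginary.
  choose κ hκ using fun i => exists_sq_mul_eq_one (Complex.ofReal_ne_zero.2 (hε i))
  have hκ0 : ∀ i, κ i ≠ 0 := fun i h => by have := hκ i; simp [h] at this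
  let δ' : Fin N → Form c' := fun j =>
    (Complex.I * (κ j)⁻¹) • (Complex.ofRealLI.toLinearMap ∘ₗ B.coord j)
  have hδ' : ∀ j (A : c'), δ' j A = Complex.I * (κ j)⁻¹ * (B.repr A j : ℝ) := fun j A => rfl
  have hlinδ : LinearIndependent ℂ δ' := by
    rw [Fintype.linearIndependent_iff]
    intro g hg k
    have h1 := LinearMap.congr_fun hg (B k)
    simp only [LinearMap.sum_apply, LinearMap.smul_apply, hδ', Module.Basis.repr_self,
      Finsupp.single_apply, smul_eq_mul, LinearMap.zero_apply] at h1
    simpa [hκ0, Complex.I_ne_zero, apply_ite Complex.ofReal] using h1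
  have hfin : Module.finrank ℂ (Form c') = N := by
    have h2 := Module.finrank_linearMap ℝ ℂ c' ℂ
    rwa [Module.finrank_self, mul_one, Module.finrank_eq_card_basis B, Fintype.card_fin] at h2
  have hspan : ⊤ ≤ Submodule.span ℂ (Set.range δ') := by
    rw [hlinδ.span_eq_top_of_card_eq_finrank' (by rw [hfin, Fintype.card_fin])]
  let δ := Module.Basis.mk hlinδ hspan
  have hδ : ∀ j (A : c'), δ j A = Complex.I * (κ j)⁻¹ * (B.repr A j : ℝ) := fun j A => by
    rw [← hδ' j A]; exact LinearMap.congr_fun (Module.Basis.mk_apply hlinδ hspan j) A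
  let U : Fin N → Fin (d - p) → ℂ := fun j => Complex.ofReal ∘ u j
  let Y : Fin N → Fin (p + 2) → ℂ := fun j => κ j • (Complex.ofReal ∘ y j)
  have hUU : ∀ i j, U i ⬝ᵥ U j = if i = j then 1 else 0 := fun i j => by
    rw [ofReal_comp_dotProduct, hu]; split_ifs <;> simp
  have hyyC : ∀ i j, (Complex.ofReal ∘ y i) ⬝ᵥ (eta₂ p).map Complex.ofReal *ᵥ
      (Complex.ofReal ∘ y j) = if i = j then (ε i : ℂ) else 0 := fun i j => by
    rw [map_ofReal_mulVec, ofReal_comp_dotProduct, hy]; split_ifs <;> simp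
  have hYY : ∀ i j, Y i ⬝ᵥ (eta₂ p).map Complex.ofReal *ᵥ Y j = if i = j then 1 else 0 := by
    intro i j
    rw [mulVec_smul, dotProduct_smul, smul_dotProduct, hyyC]
    split_ifs with h
    · subst h
      rw [← hκ i, smul_eq_mul, smul_eq_mul]; ring
    · simp
  have hAY : ∀ (A : c') (v : Fin (p + 2) → ℂ),
      toC (A : Mat d p) *ᵥ Sum.elim 0 v = Sum.elim (∑ j, ((B.repr A j : ℂ) *
        ((Complex.ofReal ∘ y j) ⬝ᵥ (eta₂ p).map Complex.ofReal *ᵥ v)) • U j) 0 := by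
    intro A v
    rw [hB A, toC_offDiag_mulVec, map_sum_vecMulVec_mulVec]
    simp [U]
  have hAU : ∀ (A : c') (v : Fin (d - p) → ℂ),
      toC (A : Mat d p) *ᵥ Sum.elim v 0 = Sum.elim (0 : Fin (d - p) → ℂ) (-∑ j, ((B.repr A j : ℂ) *
        (U j ⬝ᵥ v)) • (Complex.ofReal ∘ y j)) := by
    intro A v
    have hT : ((∑ j, B.repr A j • vecMulVec (u j) (y j)).map Complex.ofReal)ᵀ =
        (∑ j, B.repr A j • vecMulVec (y j) (u j)).map Complex.ofReal := by
      rw [← transpose_map, transpose_sum]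
      simp only [transpose_smul, transpose_vecMulVec]
    rw [hB A, toC_offDiag_mulVec, hT, map_sum_vecMulVec_mulVec,
      map_sum_vecMulVec_mulVec]
    simp [U]
  obtain ⟨z, s, hs, hzz, hxz, hyz, hσz, hAz⟩ : ∃ (z : Fin n₀ → Idx d p → ℂ) (s : ℂ), s * s = 1 ∧
      (∀ i j, z i ⬝ᵥ etaC d p *ᵥ z j = if i = j then 1 else 0) ∧
      (∀ i j, Sum.elim (U i) 0 ⬝ᵥ etaC d p *ᵥ z j = 0) ∧
      (∀ i j, Sum.elim 0 (Y i) ⬝ᵥ etaC d p *ᵥ z j = 0) ∧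
      (∀ i, sigmaMatC d p *ᵥ z i = s • z i) ∧ ∀ (A : c') i, toC (A : Mat d p) *ᵥ z i = 0 := by
    -- The `N` planes use up one of the two blocks entirely. The zero weight vectors can thus all be
    -- taken in the other block, and the involution has a single sign `s` on them.
    rcases hN with hN | hN
    · obtain ⟨z, hz, hYz⟩ := exists_orthonormal_extension ((eta₂ p).map Complex.ofReal)
        (by rw [← transpose_map, eta₂_transpose])
        (IsUnit.of_mul_eq_one ((eta₂ p).map Complex.ofReal) (by
          have := congrArg (fun M => Matrix.map M Complex.ofReal) (eta₂_mul_self p)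
          refine (Matrix.map_mul (f := Complex.ofRealHom)).symm.trans (this.trans ?_)
          simp)) n₀ (Fin N) Y (by simp only [Fintype.card_fin]; omega) hYY
      refine ⟨fun i => Sum.elim 0 (z i), -1, by norm_num, fun i j => ?_, fun i j => ?_,
        fun i j => ?_, fun i => ?_, fun A i => ?_⟩
      · rw [etaC_mulVec, sumElim_dotProduct_sumElim, hz]; simp
      · rw [etaC_mulVec, sumElim_dotProduct_sumElim]; simp
      · rw [etaC_mulVec, sumElim_dotProduct_sumElim, hYz]; simp
      · rw [sigmaMatC_mulVec]; ext (k | k) <;> simp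
      · have h1 : ∀ j, (Complex.ofReal ∘ y j) ⬝ᵥ (eta₂ p).map Complex.ofReal *ᵥ z i = 0 := by
          intro j
          have := hYz j i
          rw [smul_dotProduct, smul_eq_mul] at this
          exact (mul_eq_zero.1 this).resolve_left (hκ0 j)
        rw [hAY]; simp [h1]
    · obtain ⟨z, hz, hUz⟩ := exists_orthonormal_extension (1 : Matrix (Fin (d - p)) (Fin (d - p)) ℂ)
        (by simp) isUnit_one n₀ (Fin N) U (by simp only [Fintype.card_fin]; omega)
        (fun i j => by rw [one_mulVec, hUU])
      simp only [one_mulVec] at hz hUz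
      refine ⟨fun i => Sum.elim (z i) 0, 1, by norm_num, fun i j => ?_, fun i j => ?_,
        fun i j => ?_, fun i => ?_, fun A i => ?_⟩
      · rw [etaC_mulVec, sumElim_dotProduct_sumElim, hz]; simp
      · rw [etaC_mulVec, sumElim_dotProduct_sumElim, hUz]; simp
      · rw [etaC_mulVec, sumElim_dotProduct_sumElim]; simp
      · rw [sigmaMatC_mulVec]; ext (k | k) <;> simp
      · rw [hAU]; simp [hUz]
  refine WeightFrame.nonempty_of_vectors hdim (fun i => Sum.elim (U i) 0) (fun i => Sum.elim 0 (Y i))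
    z s hs δ (fun i j => ?_) (fun i j => ?_) hzz (fun i j => ?_) hxz hyz (fun i => ?_)
    (fun i => ?_) hσz (fun A i => ?_) (fun A i => ?_) hAz
  · rw [etaC_mulVec, sumElim_dotProduct_sumElim, hUU]; simp
  · rw [etaC_mulVec, sumElim_dotProduct_sumElim, hYY]; simp
  · rw [etaC_mulVec, sumElim_dotProduct_sumElim]; simp
  · rw [sigmaMatC_mulVec]; ext (k | k) <;> simp
  · rw [sigmaMatC_mulVec]; ext (k | k) <;> simp
  · rw [hAU, hδ]
    ext (k | k)
    · simp
    · simp only [hUU, Sum.elim_inr, Pi.smul_apply, Pi.neg_apply, Finset.sum_apply, smul_eq_mul,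
        mul_ite, mul_one, mul_zero, ite_mul, zero_mul, Finset.sum_ite_eq', Finset.mem_univ, if_true,
        Y, Function.comp_apply]
      have h1 := inv_mul_cancel₀ (hκ0 i)
      linear_combination (-(κ i)⁻¹ * κ i * (B.repr A i : ℂ) * (y i k : ℂ)) * Complex.I_mul_I +
        ((B.repr A i : ℂ) * (y i k : ℂ)) * h1
  · rw [hAY, hδ]
    ext (k | k)
    · have h2 : ∀ j, (Complex.ofReal ∘ y j) ⬝ᵥ (eta₂ p).map Complex.ofReal *ᵥ Y i =
          if j = i then (κ i)⁻¹ else 0 := by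
        intro j
        rw [mulVec_smul, dotProduct_smul, hyyC]
        split_ifs with h
        · subst h
          rw [smul_eq_mul]
          field_simp [hκ0 j]
          linear_combination hκ j
        · simp
      simp only [h2, Sum.elim_inl, Pi.smul_apply, Finset.sum_apply, smul_eq_mul,
        mul_ite, mul_zero, ite_mul, zero_mul, Finset.sum_ite_eq', Finset.mem_univ, if_true]
      linear_combination ((κ i)⁻¹ * (B.repr A i : ℂ) * U i k) * Complex.I_mul_I
    · simp

end Defect

end

noncomputable section

namespace Defect

/-! ### Simultaneous singular value decomposition -/

/-- A matrix that kills all joint eigenvectors of a commuting family of real symmetric matrices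
is zero. -/
theorem eq_zero_of_mulVec_jointEigenvector {n ι : Type} [Fintype n] [DecidableEq n]
    (T : ι → Matrix n n ℝ) (hsymm : ∀ i, (T i)ᵀ = T i) (hcomm : ∀ i j, T i * T j = T j * T i)
    (R : Matrix n n ℝ)
    (hR : ∀ (z : n → ℝ) (χ : ι → ℝ), (∀ i, T i *ᵥ z = χ i • z) → R *ᵥ z = 0) : R = 0 := by
  have h1 : ∀ i, (Matrix.toEuclideanLin (T i)).IsSymmetric := fun i => by
    exact Matrix.isSymmetric_toEuclideanLin_iff.2 (hsymm i)
  have h2 : Pairwise (Function.onFun Commute fun i => Matrix.toEuclideanLin (T i)) := by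
    intro i j _
    refine LinearMap.ext fun v => ?_
    have h := congrArg (fun M => WithLp.toLp 2 (M *ᵥ v.ofLp)) (hcomm i j)
    simpa [Matrix.toLpLin_apply, ← mulVec_mulVec] using h
  have h3 := LinearMap.IsSymmetric.iSup_iInf_eq_top_of_commute h1 h2
  have h4 : (⊤ : Submodule ℝ (EuclideanSpace ℝ n)) ≤ LinearMap.ker (Matrix.toEuclideanLin R) := by
    rw [← h3]
    refine iSup_le fun χ v hv => ?_
    rw [Submodule.mem_iInf] at hv
    have := hR v.ofLp χ fun i => by
      have := Module.End.mem_eigenspace_iff.1 (hv i)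
      exact congrArg WithLp.ofLp this
    rw [LinearMap.mem_ker, Matrix.toLpLin_apply, this]
    rfl
  apply Matrix.toEuclideanLin.injective
  rw [map_zero]
  exact LinearMap.ker_eq_top.1 (top_le_iff.1 h4)

/-- Pairs of singular vectors that are common to a set of matrices. -/
structure IsSingularSystem {ι κ : Type} [Fintype ι] [Fintype κ] (V : Set (Matrix ι κ ℝ))
    (e : κ → ℝ) {n : ℕ} (u : Fin n → ι → ℝ) (w : Fin n → κ → ℝ) : Prop where
  left : ∀ i j, u i ⬝ᵥ u j = if i = j then 1 else 0
  right : ∀ i j, w i ⬝ᵥ w j = if i = j then 1 else 0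
  perp : ∀ i, w i ⬝ᵥ e = 0
  singular : ∀ M ∈ V, ∀ j, ∃ c : ℝ, M *ᵥ w j = c • u j ∧ Mᵀ *ᵥ u j = c • w j

theorem exists_dotProduct_self_eq_one {n : Type*} [Fintype n] {v : n → ℝ} (hv : v ≠ 0) :
    ∃ c : ℝ, (c • v) ⬝ᵥ (c • v) = 1 := by
  have h : 0 < v ⬝ᵥ v := by
    rw [← star_trivial v]; exact dotProduct_star_self_pos_iff.2 (by simpa using hv)
  refine ⟨(Real.sqrt (v ⬝ᵥ v))⁻¹, ?_⟩
  rw [smul_dotProduct, dotProduct_smul, smul_eq_mul, smul_eq_mul, ← mul_assoc, ← mul_inv,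
    Real.mul_self_sqrt h.le, inv_mul_cancel₀ h.ne']

theorem exists_unit_perp {α n : Type} [Fintype α] [Fintype n] (u : α → n → ℝ)
    (h : Fintype.card α < Fintype.card n) : ∃ v : n → ℝ, v ⬝ᵥ v = 1 ∧ ∀ i, u i ⬝ᵥ v = 0 := by
  have hlt : Module.finrank ℝ (α → ℝ) < Module.finrank ℝ (n → ℝ) := by
    rwa [Module.finrank_fintype_fun_eq_card, Module.finrank_fintype_fun_eq_card]
  have := LinearMap.ker_ne_bot_of_finrank_lt (f := (Matrix.of u).mulVecLin) hlt
  obtain ⟨z, hz, hz0⟩ := Submodule.exists_mem_ne_zero_of_ne_bot this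
  obtain ⟨c, hc⟩ := exists_dotProduct_self_eq_one hz0
  refine ⟨c • z, hc, fun i => ?_⟩
  have h1 : u i ⬝ᵥ z = 0 := congrFun (LinearMap.mem_ker.1 hz) i
  rw [dotProduct_smul, h1, smul_zero]

theorem IsSingularSystem.snoc {ι κ : Type} [Fintype ι] [Fintype κ] {V : Set (Matrix ι κ ℝ)}
    {e : κ → ℝ} {n : ℕ} {u : Fin n → ι → ℝ} {w : Fin n → κ → ℝ} (h : IsSingularSystem V e u w)
    {u' : ι → ℝ} {w' : κ → ℝ} (hu' : u' ⬝ᵥ u' = 1) (hw' : w' ⬝ᵥ w' = 1)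
    (hu : ∀ i, u i ⬝ᵥ u' = 0) (hw : ∀ i, w i ⬝ᵥ w' = 0) (he : w' ⬝ᵥ e = 0)
    (hs : ∀ M ∈ V, ∃ c : ℝ, M *ᵥ w' = c • u' ∧ Mᵀ *ᵥ u' = c • w') :
    IsSingularSystem V e (Fin.cons u' u : Fin (n + 1) → ι → ℝ)
      (Fin.cons w' w : Fin (n + 1) → κ → ℝ) := by
  refine ⟨fun i j => ?_, fun i j => ?_, fun i => ?_, fun M hM j => ?_⟩
  · refine Fin.cases ?_ (fun i => ?_) i <;> refine Fin.cases ?_ (fun j => ?_) j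
    · simpa using hu'
    · simpa [(Fin.succ_ne_zero j).symm, dotProduct_comm u'] using hu j
    · simpa [Fin.succ_ne_zero i] using hu i
    · simpa using h.left i j
  · refine Fin.cases ?_ (fun i => ?_) i <;> refine Fin.cases ?_ (fun j => ?_) j
    · simpa using hw'
    · simpa [(Fin.succ_ne_zero j).symm, dotProduct_comm w'] using hw j
    · simpa [Fin.succ_ne_zero i] using hw i
    · simpa using h.right i j
  · exact Fin.cases (by simpa using he) (fun i => by simpa using h.perp i) i
  · exact Fin.cases (by simpa using hs M hM) (fun j => by simpa using h.singular M hM j) j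

/-- Singular pairs make `M` intertwine the projections onto the orthogonal complements of the `w j`
and of the `u j`. -/
theorem mulVec_sub_proj {ι κ : Type} [Fintype ι] [Fintype κ] {n : ℕ} {M : Matrix ι κ ℝ}
    {u : Fin n → ι → ℝ} {w : Fin n → κ → ℝ}
    (h : ∀ j, ∃ c : ℝ, M *ᵥ w j = c • u j ∧ Mᵀ *ᵥ u j = c • w j) (b : κ → ℝ) :
    M *ᵥ (b - ∑ j, (w j ⬝ᵥ b) • w j) = M *ᵥ b - ∑ j, (u j ⬝ᵥ M *ᵥ b) • u j := by
  rw [mulVec_sub, mulVec_sum]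
  congr 1
  refine Finset.sum_congr rfl fun j _ => ?_
  obtain ⟨c, hc, hc'⟩ := h j
  rw [mulVec_smul, hc, dotProduct_mulVec, ← mulVec_transpose, hc', smul_dotProduct, smul_smul,
    smul_eq_mul, mul_comm]

/-- A commuting set of matrices has common singular systems of every possible size. -/
theorem exists_isSingularSystem {ι κ : Type} [Fintype ι] [Fintype κ] [DecidableEq ι]
    [DecidableEq κ] (V : Set (Matrix ι κ ℝ)) (e : κ → ℝ) (he : ∀ M ∈ V, M *ᵥ e = 0)
    (h1 : ∀ M ∈ V, ∀ M' ∈ V, M * M'ᵀ = M' * Mᵀ) (h2 : ∀ M ∈ V, ∀ M' ∈ V, Mᵀ * M' = M'ᵀ * M)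
    (n : ℕ) (hι : n ≤ Fintype.card ι) (hκ : n + 1 ≤ Fintype.card κ) :
    ∃ (u : Fin n → ι → ℝ) (w : Fin n → κ → ℝ), IsSingularSystem V e u w := by
  induction n with
  | zero =>
    exact ⟨fun i => i.elim0, fun i => i.elim0, fun i => i.elim0, fun i => i.elim0,
      fun i => i.elim0, fun _ _ i => i.elim0⟩
  | succ n ih =>
    obtain ⟨u, w, h⟩ := ih (by omega) (by omega)
    suffices ∃ (u' : ι → ℝ) (w' : κ → ℝ), u' ⬝ᵥ u' = 1 ∧ w' ⬝ᵥ w' = 1 ∧ (∀ i, u i ⬝ᵥ u' = 0) ∧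
        (∀ i, w i ⬝ᵥ w' = 0) ∧ w' ⬝ᵥ e = 0 ∧
        ∀ M ∈ V, ∃ c : ℝ, M *ᵥ w' = c • u' ∧ Mᵀ *ᵥ u' = c • w' by
      obtain ⟨u', w', hu', hw', hu, hw, he', hs⟩ := this
      exact ⟨_, _, h.snoc hu' hw' hu hw he' hs⟩
    let pu : (ι → ℝ) → ι → ℝ := fun a => a - ∑ j, (u j ⬝ᵥ a) • u j
    let pw : (κ → ℝ) → κ → ℝ := fun b => b - ∑ j, (w j ⬝ᵥ b) • w j
    have hpu : ∀ a i, u i ⬝ᵥ pu a = 0 := fun a i => by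
      simp [pu, dotProduct_sub, dotProduct_sum, h.left]
    have hpw : ∀ b i, w i ⬝ᵥ pw b = 0 := fun b i => by
      simp [pw, dotProduct_sub, dotProduct_sum, h.right]
    have hpu_smul : ∀ (c : ℝ) a, pu (c • a) = c • pu a := fun c a => by
      simp [pu, smul_sub, Finset.smul_sum, smul_smul]
    have hpw_smul : ∀ (c : ℝ) b, pw (c • b) = c • pw b := fun c b => by
      simp [pw, smul_sub, Finset.smul_sum, smul_smul]
    have hM : ∀ M ∈ V, ∀ b, M *ᵥ pw b = pu (M *ᵥ b) := fun M hM b =>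
      mulVec_sub_proj (h.singular M hM) b
    have hMT : ∀ M ∈ V, ∀ a, Mᵀ *ᵥ pu a = pw (Mᵀ *ᵥ a) := fun M hM a =>
      mulVec_sub_proj (fun j => by
        obtain ⟨c, hc, hc'⟩ := h.singular M hM j
        exact ⟨c, hc', by rwa [transpose_transpose]⟩) a
    -- A joint eigenvector of the matrices `(0, M; Mᵀ, 0)` is a pair `(a, b)` of common singular
    -- vectors. Either some pair with a non-zero eigenvalue is not yet exhausted by the system, and
    -- its projection extends it, or every `M` vanishes on the remaining complement.
    by_cases hcase : ∃ (a : ι → ℝ) (b : κ → ℝ) (χ : V → ℝ),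
        (∀ M : V, (M : Matrix ι κ ℝ) *ᵥ b = χ M • a ∧ (M : Matrix ι κ ℝ)ᵀ *ᵥ a = χ M • b) ∧
        (∃ M, χ M ≠ 0) ∧ (pu a ≠ 0 ∨ pw b ≠ 0)
    · obtain ⟨a, b, χ, hχ, ⟨M₀, hM₀⟩, hne⟩ := hcase
      have hA : ∀ M : V, (M : Matrix ι κ ℝ) *ᵥ pw b = χ M • pu a := fun M => by
        rw [hM M M.2, (hχ M).1, hpu_smul]
      have hB : ∀ M : V, (M : Matrix ι κ ℝ)ᵀ *ᵥ pu a = χ M • pw b := fun M => by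
        rw [hMT M M.2, (hχ M).2, hpw_smul]
      -- A non-zero common singular value forces the two projected vectors to have equal length, so
      -- a single scalar normalizes both.
      have hnorm : pu a ⬝ᵥ pu a = pw b ⬝ᵥ pw b := by
        have h3 : pu a ⬝ᵥ (M₀ : Matrix ι κ ℝ) *ᵥ pw b = pw b ⬝ᵥ (M₀ : Matrix ι κ ℝ)ᵀ *ᵥ pu a := by
          rw [dotProduct_mulVec, ← mulVec_transpose, dotProduct_comm]
        rw [hA, hB, dotProduct_smul, dotProduct_smul] at h3
        exact mul_left_cancel₀ hM₀ h3
      have hu0 : pu a ≠ 0 := by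
        rcases hne with hne | hne
        · exact hne
        · intro h0
          rw [h0, dotProduct_zero, eq_comm, dotProduct_self_eq_zero] at hnorm
          exact hne hnorm
      obtain ⟨c, hc⟩ := exists_dotProduct_self_eq_one hu0
      have hbe : pw b ⬝ᵥ e = 0 := by
        have h3 : (χ M₀ • pw b) ⬝ᵥ e = 0 := by
          rw [← hB, mulVec_transpose, ← dotProduct_mulVec, he _ M₀.2, dotProduct_zero]
        rw [smul_dotProduct, smul_eq_mul] at h3
        exact (mul_eq_zero.1 h3).resolve_left hM₀
      refine ⟨c • pu a, c • pw b, hc, ?_, fun i => ?_, fun i => ?_, ?_, fun M hMV => ?_⟩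
      · rw [← hc]; simp only [smul_dotProduct, dotProduct_smul, hnorm]
      · rw [dotProduct_smul, hpu, smul_zero]
      · rw [dotProduct_smul, hpw, smul_zero]
      · rw [smul_dotProduct, hbe, smul_zero]
      · refine ⟨χ ⟨M, hMV⟩, ?_, ?_⟩
        · rw [mulVec_smul, hA ⟨M, hMV⟩, smul_comm]
        · rw [mulVec_smul, hB ⟨M, hMV⟩, smul_comm]
    · push Not at hcase
      -- The joint eigenvectors span, so it suffices to check them: those with zero eigenvalues are
      -- killed by `M`, and the others are killed by the projection.
      have hzero : ∀ M ∈ V, ∀ b, M *ᵥ pw b = 0 := by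
        intro M hMV b
        let T : V → Matrix (ι ⊕ κ) (ι ⊕ κ) ℝ := fun M => fromBlocks 0 M (M : Matrix ι κ ℝ)ᵀ 0
        let R : Matrix κ κ ℝ := 1 - ∑ j, vecMulVec (w j) (w j)
        have hRw : ∀ b, R *ᵥ b = pw b := fun b => by
          simp [R, pw, sub_mulVec, sum_mulVec, vecMulVec_mulVec]
        have hT := eq_zero_of_mulVec_jointEigenvector T
          (fun i => by simp [T, fromBlocks_transpose])
          (fun i j => by
            simp only [T, fromBlocks_multiply, Matrix.zero_mul, Matrix.mul_zero, zero_add, add_zero,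
              h1 _ i.2 _ j.2, h2 _ i.2 _ j.2])
          (fromBlocks 0 (M * R) 0 0) (fun z χ hz => by
            obtain ⟨a, b, rfl⟩ : ∃ a b, z = Sum.elim a b :=
              ⟨z ∘ Sum.inl, z ∘ Sum.inr, (Sum.elim_comp_inl_inr z).symm⟩
            have hz' : ∀ M : V, (M : Matrix ι κ ℝ) *ᵥ b = χ M • a ∧
                (M : Matrix ι κ ℝ)ᵀ *ᵥ a = χ M • b := by
              intro M
              have h3 := hz M
              rw [fromBlocks_mulVec] at h3
              constructor
              · ext i
                have := congrFun h3 (Sum.inl i)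
                simpa using this
              · ext i
                have := congrFun h3 (Sum.inr i)
                simpa using this
            have h4 : M *ᵥ pw b = 0 := by
              by_cases hχ : χ ⟨M, hMV⟩ = 0
              · rw [hM M hMV, (hz' ⟨M, hMV⟩).1, hχ, zero_smul]
                simp [pu]
              · rw [(hcase a b χ hz' ⟨_, hχ⟩).2, mulVec_zero]
            rw [fromBlocks_mulVec]
            ext (i | i)
            · simp [← mulVec_mulVec, hRw, h4]
            · simp)
        have h5 : M * R = 0 := by
          have := congrArg Matrix.toBlocks₁₂ hT
          exact this
        rw [← hRw, mulVec_mulVec, h5, zero_mulVec]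
      obtain ⟨u', hu', hu⟩ := exists_unit_perp u (by rw [Fintype.card_fin]; omega)
      -- Any unit vectors serve now. The vector `e` is adjoined to the constraints on `w'`, which
      -- uses the extra `1` in the bound on the number of columns.
      obtain ⟨w', hw', hw⟩ := exists_unit_perp (fun o : Option (Fin n) => o.elim e w)
        (by rw [Fintype.card_option, Fintype.card_fin]; omega)
      have hpw' : pw w' = w' := by
        have : ∀ j, w j ⬝ᵥ w' = 0 := fun j => hw (some j)
        simp [pw, this]
      have hpu' : pu u' = u' := by simp [pu, hu]
      refine ⟨u', w', hu', hw', hu, fun i => hw (some i), by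
        rw [dotProduct_comm]; exact hw none, fun M hMV => ⟨0, ?_, ?_⟩⟩
      · rw [← hpw', hzero M hMV, zero_smul]
      · rw [zero_smul]
        refine dotProduct_eq_zero _ fun x => ?_
        have h3 : Mᵀ *ᵥ u' = pw (Mᵀ *ᵥ u') := by rw [← hMT M hMV, hpu']
        have h4 : ∀ i, w i ⬝ᵥ Mᵀ *ᵥ u' = 0 := fun i => by rw [h3]; exact hpw _ i
        have h5 : Mᵀ *ᵥ u' ⬝ᵥ x = Mᵀ *ᵥ u' ⬝ᵥ pw x := by
          simp [pw, dotProduct_sub, dotProduct_sum, dotProduct_comm _ (w _), h4]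
        rw [h5, mulVec_transpose, ← dotProduct_mulVec, hzero M hMV, dotProduct_zero]

end Defect

end

noncomputable section

namespace Defect

/-! ### Commutative subspaces of the antiinvariant part -/

variable {d p : ℕ}

/-- `vecMulVec_mulVec` produces scalars acting from the right; this brings them back to ordinary
ones. -/
theorem op_smul_fun {n : Type*} (c : ℝ) (v : n → ℝ) : MulOpposite.op c • v = c • v :=
  funext fun _ => mul_comm _ _

/-- The last unit vector. -/
def lastVec (p : ℕ) : Fin (p + 2) → ℝ := Pi.single (Fin.last (p + 1)) 1

theorem lastVec_dotProduct_self : lastVec p ⬝ᵥ lastVec p = 1 := by simp [lastVec]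

theorem eta₂_mulVec_lastVec : eta₂ p *ᵥ lastVec p = -lastVec p := by
  ext i
  rw [eta₂, mulVec_diagonal, lorentz, lastVec, Pi.neg_apply, Pi.single_apply]
  split_ifs <;> simp

theorem eta₂_mulVec_of_perp {w : Fin (p + 2) → ℝ} (hw : w ⬝ᵥ lastVec p = 0) :
    eta₂ p *ᵥ w = w := by
  ext i
  rw [eta₂, mulVec_diagonal, lorentz]
  split_ifs with h
  · subst h
    have : w (Fin.last (p + 1)) = 0 := by simpa [lastVec] using hw
    rw [this, mul_zero]
  · rw [one_mul]

theorem eq_zero_of_eq_neg_self {m n : Type*} {A : Matrix m n ℝ} (h : A = -A) : A = 0 := by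
  ext i j
  have := congrFun (congrFun h i) j
  rw [Matrix.neg_apply] at this
  rw [Matrix.zero_apply]
  linarith

theorem mem_lieGMinus_iff_exists {X : Mat d p} :
    X ∈ lieGMinus d p ↔ ∃ M, offDiag d p M = X := by
  constructor
  · intro hX
    rw [mem_lieGMinus, mem_lieG] at hX
    obtain ⟨h1, h2⟩ := hX
    rw [← fromBlocks_toBlocks X] at h1 h2
    rw [eta_eq_fromBlocks, fromBlocks_transpose, fromBlocks_multiply, fromBlocks_multiply,
      fromBlocks_neg, fromBlocks_inj] at h1
    rw [sigmaMat, fromBlocks_multiply, fromBlocks_multiply, fromBlocks_neg, fromBlocks_inj] at h2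
    have h11 : X.toBlocks₁₁ = 0 := eq_zero_of_eq_neg_self (by simpa using h2.1)
    have h22 : X.toBlocks₂₂ = 0 := eq_zero_of_eq_neg_self (by simpa using h2.2.2.2)
    have h12 : X.toBlocks₂₁ᵀ * eta₂ p = -X.toBlocks₁₂ := by simpa [eta₂] using h1.2.1
    refine ⟨-X.toBlocks₂₁ᵀ, ?_⟩
    rw [offDiag_apply, Matrix.neg_mul, h12, neg_neg, transpose_neg, transpose_transpose, neg_neg,
      ← h11]
    conv_rhs => rw [← fromBlocks_toBlocks X, h22]
  · rintro ⟨M, rfl⟩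
    rw [mem_lieGMinus, mem_lieG]
    constructor
    · rw [offDiag_apply, eta_eq_fromBlocks, fromBlocks_transpose, fromBlocks_multiply,
        fromBlocks_multiply, fromBlocks_neg, transpose_mul, eta₂_transpose]
      simp [eta₂]
    · rw [offDiag_apply, sigmaMat, fromBlocks_multiply, fromBlocks_multiply, fromBlocks_neg]
      simp

theorem offDiag_mem_lieGMinus (M : Matrix (Fin (d - p)) (Fin (p + 2)) ℝ) :
    offDiag d p M ∈ lieGMinus d p := mem_lieGMinus_iff_exists.2 ⟨M, rfl⟩

theorem offDiag_mem_lieG (M : Matrix (Fin (d - p)) (Fin (p + 2)) ℝ) :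
    offDiag d p M ∈ lieG d p := (offDiag_mem_lieGMinus M).1

/-- The product of two off-diagonal elements is block diagonal, and the two blocks give the two
relations. In the lower one the common factor `η₂` is cancelled. -/
theorem offDiag_mul_comm_iff {M M' : Matrix (Fin (d - p)) (Fin (p + 2)) ℝ} :
    offDiag d p M * offDiag d p M' = offDiag d p M' * offDiag d p M ↔
      M * eta₂ p * M'ᵀ = M' * eta₂ p * Mᵀ ∧ Mᵀ * M' = M'ᵀ * M := by
  have h : ∀ M M' : Matrix (Fin (d - p)) (Fin (p + 2)) ℝ, offDiag d p M * offDiag d p M' =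
      fromBlocks (-(M * eta₂ p * M'ᵀ)) 0 0 (-(Mᵀ * M' * eta₂ p)) := fun M M' => by
    rw [offDiag_apply, offDiag_apply, fromBlocks_multiply]
    simp [Matrix.mul_assoc]
  rw [h, h, fromBlocks_inj]
  simp only [true_and, neg_inj]
  refine and_congr_right fun _ => ⟨fun h => ?_, fun h => by rw [h]⟩
  have := congrArg (fun A => A * eta₂ p) h
  simpa [Matrix.mul_assoc, eta₂_mul_self] using this

theorem mul_eta₂_apply (M : Matrix (Fin (d - p)) (Fin (p + 2)) ℝ) (i j) :
    (M * eta₂ p) i j = M i j * lorentz (p + 1) j := by rw [eta₂, mul_diagonal]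

theorem mulVec_lastVec (M : Matrix (Fin (d - p)) (Fin (p + 2)) ℝ) (i) :
    (M *ᵥ lastVec p) i = M i (Fin.last (p + 1)) := by simp [lastVec]

/-- Multiplication by `η₂` changes only the timelike column, so skew-symmetry of the whole matrix
amounts to the vanishing of that column. -/
theorem offDiag_mem_lieK_iff {M : Matrix (Fin (d - p)) (Fin (p + 2)) ℝ} :
    offDiag d p M ∈ lieK d p ↔ M *ᵥ lastVec p = 0 := by
  rw [lieK, Submodule.mem_inf, and_iff_right (offDiag_mem_lieG M), LinearMap.mem_ker]
  change (offDiag d p M)ᵀ + offDiag d p M = 0 ↔ _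
  rw [offDiag_apply, fromBlocks_transpose, fromBlocks_add, ← fromBlocks_zero, fromBlocks_inj]
  constructor
  · rintro ⟨-, h, -, -⟩
    ext i
    have := congrFun (congrFun h i) (Fin.last (p + 1))
    simp only [transpose_neg, transpose_transpose, Matrix.add_apply, Matrix.neg_apply,
      mul_eta₂_apply, lorentz, if_true, Matrix.zero_apply] at this
    rw [mulVec_lastVec, Pi.zero_apply]
    linarith
  · intro h
    have h1 : M * eta₂ p = M := by
      ext i j
      rw [mul_eta₂_apply, lorentz]
      split_ifs with hj
      · subst hj
        have := congrFun h i
        rw [mulVec_lastVec, Pi.zero_apply] at this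
        rw [this, zero_mul]
      · rw [mul_one]
    rw [h1]
    simp

theorem eq_vecMulVec_of_offDiag_mem_lieP {M : Matrix (Fin (d - p)) (Fin (p + 2)) ℝ}
    (h : offDiag d p M ∈ lieP d p) : M = vecMulVec (M *ᵥ lastVec p) (lastVec p) := by
  rw [lieP, Submodule.mem_inf, and_iff_right (offDiag_mem_lieG M), LinearMap.mem_ker] at h
  change (offDiag d p M)ᵀ - offDiag d p M = 0 at h
  rw [offDiag_apply, fromBlocks_transpose, sub_eq_zero, fromBlocks_inj] at h
  ext i j
  have h1 := congrFun (congrFun h.2.1 i) j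
  simp only [transpose_neg, transpose_transpose, Matrix.neg_apply, mul_eta₂_apply, lorentz] at h1
  rw [vecMulVec_apply, mulVec_lastVec, lastVec, Pi.single_apply]
  split_ifs at h1 ⊢ with hj
  · rw [hj, mul_one]
  · linarith

theorem offDiag_vecMulVec_mem_lieP (x : Fin (d - p) → ℝ) :
    offDiag d p (vecMulVec x (lastVec p)) ∈ lieP d p := by
  rw [lieP, Submodule.mem_inf, and_iff_right (offDiag_mem_lieG _), LinearMap.mem_ker]
  change (offDiag d p _)ᵀ - offDiag d p _ = 0
  have h : vecMulVec x (lastVec p) * eta₂ p = -vecMulVec x (lastVec p) := by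
    rw [vecMulVec_mul, ← mulVec_transpose, eta₂_transpose, eta₂_mulVec_lastVec, vecMulVec_neg]
  rw [offDiag_apply, h, fromBlocks_transpose, sub_eq_zero]
  simp

theorem isComm_span {n : Type} [Fintype n] {s : Set (Matrix n n ℝ)}
    (h : ∀ x ∈ s, ∀ y ∈ s, x * y = y * x) : IsComm (Submodule.span ℝ s) := by
  intro X hX Y hY
  induction hX using Submodule.span_induction with
  | mem x hx =>
    induction hY using Submodule.span_induction with
    | mem y hy => exact h x hx y hy
    | zero => simp
    | add y z _ _ h1 h2 => rw [Matrix.mul_add, Matrix.add_mul, h1, h2]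
    | smul c y _ h1 => rw [Matrix.mul_smul, Matrix.smul_mul, h1]
  | zero => simp
  | add y z _ _ h1 h2 => rw [Matrix.mul_add, Matrix.add_mul, h1, h2]
  | smul c y _ h1 => rw [Matrix.mul_smul, Matrix.smul_mul, h1]

theorem isComm_span_offDiag {α : Type*} [DecidableEq α]
    {u : α → Fin (d - p) → ℝ} {y : α → Fin (p + 2) → ℝ} {ε : α → ℝ}
    (hu : ∀ i j, u i ⬝ᵥ u j = if i = j then 1 else 0)
    (hy : ∀ i j, y i ⬝ᵥ eta₂ p *ᵥ y j = if i = j then ε i else 0) :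
    IsComm (Submodule.span ℝ (Set.range fun j => offDiag d p (vecMulVec (u j) (y j)))) := by
  apply isComm_span
  rintro _ ⟨i, rfl⟩ _ ⟨j, rfl⟩
  dsimp only
  by_cases hij : i = j
  · rw [hij]
  have hji : j ≠ i := fun h => hij h.symm
  rw [offDiag_mul_comm_iff]
  simp only [transpose_vecMulVec, ← mulVec_mulVec, mul_vecMulVec, vecMulVec_mulVec, hu, hy, hij,
    hji, if_false, op_smul_fun, zero_smul, zero_vecMulVec, and_self]

theorem span_offDiag_le_lieGMinus {α : Type*} (M : α → Matrix (Fin (d - p)) (Fin (p + 2)) ℝ) :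
    Submodule.span ℝ (Set.range fun j => offDiag d p (M j)) ≤ lieGMinus d p := by
  rw [Submodule.span_le]
  rintro _ ⟨j, rfl⟩
  exact offDiag_mem_lieGMinus _

theorem offDiag_sum_mem_span {α : Type*} [Fintype α]
    (M : α → Matrix (Fin (d - p)) (Fin (p + 2)) ℝ) (c : α → ℝ) :
    offDiag d p (∑ j, c j • M j) ∈ Submodule.span ℝ (Set.range fun j => offDiag d p (M j)) := by
  rw [map_sum]
  refine Submodule.sum_mem _ fun j _ => ?_
  rw [map_smul]
  exact Submodule.smul_mem _ _ (Submodule.subset_span ⟨j, rfl⟩)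

theorem exists_sum_of_mem_span {α : Type*} [Fintype α]
    {M : α → Matrix (Fin (d - p)) (Fin (p + 2)) ℝ} {X : Mat d p}
    (hX : X ∈ Submodule.span ℝ (Set.range fun j => offDiag d p (M j))) :
    ∃ c : α → ℝ, X = offDiag d p (∑ j, c j • M j) := by
  obtain ⟨c, hc⟩ := (Submodule.mem_span_range_iff_exists_fun ℝ).1 hX
  exact ⟨c, by rw [← hc, map_sum]; simp⟩

/-! ### Recovering a matrix from its singular vectors. -/

section Completeness

variable {ι κ α : Type} [Fintype α] [DecidableEq α] {M : Matrix ι κ ℝ} {u : α → ι → ℝ} {w : α → κ → ℝ} {c : α → ℝ}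

theorem eq_sum_of_transpose_mulVec [Fintype ι] [DecidableEq ι] (hcard : Fintype.card α = Fintype.card ι)
    (hu : ∀ i j, u i ⬝ᵥ u j = if i = j then 1 else 0) (h : ∀ j, Mᵀ *ᵥ u j = c j • w j) :
    M = ∑ j, c j • vecMulVec (u j) (w j) := by
  calc M = (∑ j, vecMulVec (u j) (u j)) * M := by
        rw [sum_vecMulVec_eq_one u hcard hu, Matrix.one_mul]
    _ = _ := by
        rw [Matrix.sum_mul]
        refine Finset.sum_congr rfl fun j _ => ?_
        rw [vecMulVec_mul, ← mulVec_transpose, h, vecMulVec_smul]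

theorem eq_sum_add_of_mulVec [Fintype κ] [DecidableEq κ] {e : κ → ℝ} (hcard : Fintype.card α + 1 = Fintype.card κ)
    (hw : ∀ i j, w i ⬝ᵥ w j = if i = j then 1 else 0) (he : e ⬝ᵥ e = 1)
    (hwe : ∀ i, w i ⬝ᵥ e = 0) (h : ∀ j, M *ᵥ w j = c j • u j) :
    M = ∑ j, c j • vecMulVec (u j) (w j) + vecMulVec (M *ᵥ e) e := by
  have h1 := sum_vecMulVec_eq_one (fun o : Option α => o.elim e w)
    (by rw [Fintype.card_option, hcard]) (by
      rintro (_ | i) (_ | j)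
      · simpa using he
      · simpa [dotProduct_comm e] using hwe j
      · simpa using hwe i
      · simpa using hw i j)
  rw [Fintype.sum_option] at h1
  calc M = M * (vecMulVec e e + ∑ j, vecMulVec (w j) (w j)) := by
        rw [show vecMulVec e e + ∑ j, vecMulVec (w j) (w j) = 1 from h1, Matrix.mul_one]
    _ = _ := by
        rw [Matrix.mul_add, Matrix.mul_sum, mul_vecMulVec, add_comm]
        congr 1
        refine Finset.sum_congr rfl fun j _ => ?_
        rw [mul_vecMulVec, h, smul_vecMulVec]

end Completeness

theorem eta₂_orthonormal {α : Type*} [DecidableEq α] {w : α → Fin (p + 2) → ℝ}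
    (hw : ∀ i j, w i ⬝ᵥ w j = if i = j then 1 else 0) (hwe : ∀ i, w i ⬝ᵥ lastVec p = 0) :
    ∀ i j, w i ⬝ᵥ eta₂ p *ᵥ w j = if i = j then (1 : ℝ) else 0 := fun i j => by
  rw [eta₂_mulVec_of_perp (hwe j), hw]

/-- The maximal commutative subspaces of `𝔨^{-σ}`. -/
theorem exists_span_of_maximal {t : Submodule ℝ (Mat d p)}
    (ht : IsMaxComm (lieK d p ⊓ lieGMinus d p) t) {n : ℕ} (hn : n = min (d - p) (p + 1)) :
    ∃ (u : Fin n → Fin (d - p) → ℝ) (w : Fin n → Fin (p + 2) → ℝ),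
      (∀ i j, u i ⬝ᵥ u j = if i = j then 1 else 0) ∧
      (∀ i j, w i ⬝ᵥ w j = if i = j then 1 else 0) ∧ (∀ i, w i ⬝ᵥ lastVec p = 0) ∧
      t = Submodule.span ℝ (Set.range fun j => offDiag d p (vecMulVec (u j) (w j))) := by
  let V : Set (Matrix (Fin (d - p)) (Fin (p + 2)) ℝ) := {M | offDiag d p M ∈ t}
  have he : ∀ M ∈ V, M *ᵥ lastVec p = 0 := fun M hM => offDiag_mem_lieK_iff.1 (ht.1.1 hM).1
  have heta : ∀ M ∈ V, M * eta₂ p = M := by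
    intro M hM
    ext i j
    rw [mul_eta₂_apply, lorentz]
    split_ifs with hj
    · subst hj
      have := congrFun (he M hM) i
      rw [mulVec_lastVec, Pi.zero_apply] at this
      rw [this, zero_mul]
    · rw [mul_one]
  have hcomm := fun M (hM : M ∈ V) M' (hM' : M' ∈ V) =>
    offDiag_mul_comm_iff.1 (ht.1.2 _ hM _ hM')
  obtain ⟨u, w, h⟩ := exists_isSingularSystem V (lastVec p) he
    (fun M hM M' hM' => by simpa [heta M hM, heta M' hM'] using (hcomm M hM M' hM').1)
    (fun M hM M' hM' => (hcomm M hM M' hM').2) n (by rw [Fintype.card_fin]; omega)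
    (by rw [Fintype.card_fin]; omega)
  refine ⟨u, w, h.left, h.right, h.perp, ?_⟩
  -- The span is itself commutative, so maximality reduces the equality to the inclusion of `t` in
  -- the span.
  refine ht.eq_of_le ⟨le_inf ?_ (span_offDiag_le_lieGMinus _),
    isComm_span_offDiag h.left (eta₂_orthonormal h.right h.perp)⟩ ?_
  · rw [Submodule.span_le]
    rintro _ ⟨j, rfl⟩
    refine offDiag_mem_lieK_iff.2 ?_
    rw [vecMulVec_mulVec, h.perp, op_smul_fun, zero_smul]
  · intro X hX
    obtain ⟨M, rfl⟩ := mem_lieGMinus_iff_exists.1 (ht.1.1 hX).2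
    choose c hc hc' using h.singular M hX
    have : M = ∑ j, c j • vecMulVec (u j) (w j) := by
      -- The singular vectors exhaust either the rows, or the columns orthogonal to the timelike
      -- vector, on which `M` vanishes.
      rcases min_choice (d - p) (p + 1) with hm | hm
      · exact eq_sum_of_transpose_mulVec (by simp only [Fintype.card_fin]; omega) h.left hc'
      · have := eq_sum_add_of_mulVec (e := lastVec p) (by simp only [Fintype.card_fin]; omega)
          h.right lastVec_dotProduct_self h.perp hc
        rwa [he M hX, zero_vecMulVec, add_zero] at this
    rw [this]
    exact offDiag_sum_mem_span _ c

/-- The two block relations for commuting with the rank-one block are evaluated at `u` and at `w`.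
Each expresses one image as a multiple of the other vector, and the two scalars agree by adjunction.
-/
theorem exists_singular_of_commute {M : Matrix (Fin (d - p)) (Fin (p + 2)) ℝ}
    {u : Fin (d - p) → ℝ} {w : Fin (p + 2) → ℝ} (hu : u ⬝ᵥ u = 1) (hw : w ⬝ᵥ w = 1)
    (hwe : w ⬝ᵥ lastVec p = 0)
    (h : offDiag d p M * offDiag d p (vecMulVec u w) =
      offDiag d p (vecMulVec u w) * offDiag d p M) :
    ∃ c : ℝ, M *ᵥ w = c • u ∧ Mᵀ *ᵥ u = c • w := by
  obtain ⟨h1, h2⟩ := offDiag_mul_comm_iff.1 h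
  have e1 := congrArg (fun A => A *ᵥ u) h1
  have e2 := congrArg (fun A => A *ᵥ w) h2
  simp only [transpose_vecMulVec, ← mulVec_mulVec, vecMulVec_mulVec, hu, hw, op_smul_fun, one_smul,
    eta₂_mulVec_of_perp hwe] at e1 e2
  refine ⟨w ⬝ᵥ Mᵀ *ᵥ u, ?_, ?_⟩
  · rw [e1, dotProduct_mulVec, ← mulVec_transpose, eta₂_transpose, eta₂_mulVec_of_perp hwe]
  · have h3 : w ⬝ᵥ Mᵀ *ᵥ u = u ⬝ᵥ M *ᵥ w := by
      rw [dotProduct_mulVec, vecMul_transpose, dotProduct_comm]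
    rw [h3]
    exact e2

theorem eq_smul_of_vecMulVec_comm {n : Type*} [Fintype n] {v x : n → ℝ} (hv : v ⬝ᵥ v = 1)
    (h : vecMulVec v x = vecMulVec x v) : x = (x ⬝ᵥ v) • v := by
  have := congrArg (fun A => A *ᵥ v) h
  simp only [vecMulVec_mulVec, hv, op_smul_fun, one_smul] at this
  exact this.symm

theorem vecMulVec_comm_of_lastVec {x y : Fin (d - p) → ℝ}
    (h : offDiag d p (vecMulVec x (lastVec p)) * offDiag d p (vecMulVec y (lastVec p)) =
      offDiag d p (vecMulVec y (lastVec p)) * offDiag d p (vecMulVec x (lastVec p))) :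
    vecMulVec x y = vecMulVec y x := by
  have h1 := (offDiag_mul_comm_iff.1 h).1
  simp only [transpose_vecMulVec, ← mulVec_mulVec, mul_vecMulVec, vecMulVec_mulVec,
    eta₂_mulVec_lastVec, dotProduct_neg, lastVec_dotProduct_self, op_smul_fun, neg_smul, one_smul,
    neg_vecMulVec, neg_inj] at h1
  exact h1

/-- The maximal commutative subspaces of `𝔤^{-σ}` in the equal rank case. -/
theorem eq_of_le_of_maximal {t c : Submodule ℝ (Mat d p)}
    (hC : IsFundamentalCartan d p t c) {n : ℕ} (hn : n = d - p)
    {u : Fin n → Fin (d - p) → ℝ} {w : Fin n → Fin (p + 2) → ℝ}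
    (hu : ∀ i j, u i ⬝ᵥ u j = if i = j then 1 else 0)
    (hw : ∀ i j, w i ⬝ᵥ w j = if i = j then 1 else 0) (hwe : ∀ i, w i ⬝ᵥ lastVec p = 0)
    (ht : t = Submodule.span ℝ (Set.range fun j => offDiag d p (vecMulVec (u j) (w j)))) :
    c = t := by
  refine le_antisymm (fun X hX => ?_) hC.le
  obtain ⟨M, rfl⟩ := mem_lieGMinus_iff_exists.1 (hC.maximal_c.1.1 hX)
  have hmem : ∀ j, offDiag d p (vecMulVec (u j) (w j)) ∈ c := fun j =>
    hC.le (by rw [ht]; exact Submodule.subset_span ⟨j, rfl⟩)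
  choose a ha ha' using fun j => exists_singular_of_commute (by simpa using hu j j)
    (by simpa using hw j j) (hwe j) (hC.maximal_c.1.2 _ hX _ (hmem j))
  rw [ht, eq_sum_of_transpose_mulVec (by simp only [Fintype.card_fin]; omega) hu ha']
  exact offDiag_sum_mem_span _ a

/-- The maximal commutative subspaces of `𝔤^{-σ}` in the case of unequal rank. -/
theorem exists_span_of_fundamental {t c : Submodule ℝ (Mat d p)}
    (hC : IsFundamentalCartan d p t c) {n : ℕ} (hn : n = p + 1) (hlt : p + 1 < d - p)
    {u : Fin n → Fin (d - p) → ℝ} {w : Fin n → Fin (p + 2) → ℝ}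
    (hu : ∀ i j, u i ⬝ᵥ u j = if i = j then 1 else 0)
    (hw : ∀ i j, w i ⬝ᵥ w j = if i = j then 1 else 0) (hwe : ∀ i, w i ⬝ᵥ lastVec p = 0)
    (ht : t = Submodule.span ℝ (Set.range fun j => offDiag d p (vecMulVec (u j) (w j)))) :
    ∃ v : Fin (d - p) → ℝ, v ⬝ᵥ v = 1 ∧ (∀ i, u i ⬝ᵥ v = 0) ∧
      c = Submodule.span ℝ (Set.range fun j : Fin (n + 1) => offDiag d p
        (vecMulVec ((Fin.cons v u : Fin (n + 1) → Fin (d - p) → ℝ) j)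
          ((Fin.cons (lastVec p) w : Fin (n + 1) → Fin (p + 2) → ℝ) j))) := by
  have hmem : ∀ j, offDiag d p (vecMulVec (u j) (w j)) ∈ c := fun j =>
    hC.le (by rw [ht]; exact Submodule.subset_span ⟨j, rfl⟩)
  -- Commuting with `𝔱` makes each `(u j, w j)` a singular pair, so only the timelike column of `M`
  -- remains undetermined. This boost part lies in `𝔠` as well.
  have hdec : ∀ M, offDiag d p M ∈ c → ∃ a : Fin n → ℝ,
      M = ∑ j, a j • vecMulVec (u j) (w j) + vecMulVec (M *ᵥ lastVec p) (lastVec p) ∧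
      offDiag d p (vecMulVec (M *ᵥ lastVec p) (lastVec p)) ∈ c ∧
      ∀ j, u j ⬝ᵥ M *ᵥ lastVec p = 0 := by
    intro M hM
    choose a ha ha' using fun j => exists_singular_of_commute (by simpa using hu j j)
      (by simpa using hw j j) (hwe j) (hC.maximal_c.1.2 _ hM _ (hmem j))
    have h1 := eq_sum_add_of_mulVec (e := lastVec p) (by simp only [Fintype.card_fin]; omega)
      hw lastVec_dotProduct_self hwe ha
    refine ⟨a, h1, ?_, fun j => ?_⟩
    · have h2 : offDiag d p (∑ j, a j • vecMulVec (u j) (w j)) ∈ c := by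
        rw [map_sum]
        refine Submodule.sum_mem _ fun j _ => ?_
        rw [map_smul]
        exact Submodule.smul_mem _ _ (hmem j)
      have h3 := sub_mem hM h2
      rw [← map_sub] at h3
      rwa [← eq_sub_of_add_eq' h1.symm] at h3
    · rw [dotProduct_mulVec, ← mulVec_transpose, ha', smul_dotProduct, hwe, smul_zero]
  -- Commuting boosts are parallel, so one direction `v` suffices. If `𝔠` contained no boost, any
  -- `v` orthogonal to the `u j` would do, and maximality then gives the equality below.
  obtain ⟨v, hv, huv, hpar⟩ : ∃ v : Fin (d - p) → ℝ, v ⬝ᵥ v = 1 ∧ (∀ i, u i ⬝ᵥ v = 0) ∧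
      ∀ M, offDiag d p M ∈ c → ∃ r : ℝ, M *ᵥ lastVec p = r • v := by
    by_cases hne : ∃ M, offDiag d p M ∈ c ∧ M *ᵥ lastVec p ≠ 0
    · obtain ⟨M, hM, hM0⟩ := hne
      obtain ⟨r, hr⟩ := exists_dotProduct_self_eq_one hM0
      obtain ⟨-, -, hmemM, hperp⟩ := hdec M hM
      refine ⟨_, hr, fun i => by rw [dotProduct_smul, hperp, smul_zero], fun M' hM' => ?_⟩
      obtain ⟨-, -, hmemM', -⟩ := hdec M' hM'
      refine ⟨_, eq_smul_of_vecMulVec_comm hr ?_⟩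
      rw [smul_vecMulVec, vecMulVec_smul,
        vecMulVec_comm_of_lastVec (hC.maximal_c.1.2 _ hmemM _ hmemM')]
    · push Not at hne
      obtain ⟨v, hv, huv⟩ := exists_unit_perp u (by simp only [Fintype.card_fin]; omega)
      exact ⟨v, hv, huv, fun M hM => ⟨0, by rw [hne M hM, zero_smul]⟩⟩
  refine ⟨v, hv, huv, hC.maximal_c.eq_of_le ⟨span_offDiag_le_lieGMinus _, ?_⟩ ?_⟩
  · refine isComm_span_offDiag (ε := Fin.cons (-1) fun _ => 1) (fun i j => ?_) (fun i j => ?_)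
    · refine Fin.cases ?_ (fun i => ?_) i <;> refine Fin.cases ?_ (fun j => ?_) j
      · simpa using hv
      · simpa [(Fin.succ_ne_zero j).symm, dotProduct_comm v] using huv j
      · simpa [Fin.succ_ne_zero i] using huv i
      · simpa using hu i j
    · refine Fin.cases ?_ (fun i => ?_) i <;> refine Fin.cases ?_ (fun j => ?_) j
      · simp [eta₂_mulVec_lastVec, lastVec_dotProduct_self]
      · simp [(Fin.succ_ne_zero j).symm, eta₂_mulVec_of_perp (hwe j), dotProduct_comm (lastVec p),
          hwe]
      · simp [Fin.succ_ne_zero i, eta₂_mulVec_lastVec, hwe]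
      · simpa [eta₂_mulVec_of_perp (hwe j)] using hw i j
  · intro X hX
    obtain ⟨M, rfl⟩ := mem_lieGMinus_iff_exists.1 (hC.maximal_c.1.1 hX)
    obtain ⟨a, ha, -, -⟩ := hdec M hX
    obtain ⟨r, hr⟩ := hpar M hX
    have : M = ∑ j : Fin (n + 1), (Fin.cons r a : Fin (n + 1) → ℝ) j •
        vecMulVec ((Fin.cons v u : Fin (n + 1) → Fin (d - p) → ℝ) j)
          ((Fin.cons (lastVec p) w : Fin (n + 1) → Fin (p + 2) → ℝ) j) := by
      rw [Fin.sum_univ_succ]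
      simp only [Fin.cons_zero, Fin.cons_succ]
      refine ha.trans ?_
      rw [hr, smul_vecMulVec]
      exact add_comm _ _
    rw [this]
    exact offDiag_sum_mem_span _ _

end Defect

end

noncomputable section

namespace Defect

/-! ### Standard Cartan subsets -/

/-- Multiplying `h2` by `D` and using `h1` gives `D X Z² = 0`. Since `D` commutes with `X`, `h1`
then yields `D X = 0`. Inserting `h3` into `D = -D Z²` leaves only terms that contain `D X`. -/
theorem eq_zero_of_mul_relations {R : Type*} [Ring R] {D X Z : R} (hZ : D * Z = Z * D)
    (hX : D * X = X * D) (h1 : D * Z * Z = -D) (h2 : X = -(Z * Z * X + X * Z * Z))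
    (h3 : Z * Z = X * X * Z * Z + Z * X * X * Z) : D = 0 := by
  have e1 : D * X * Z * Z = 0 := by
    have h4 : D * X = -(D * Z * Z * X + D * X * Z * Z) := by
      conv_lhs => rw [h2]
      noncomm_ring
    rw [h1, neg_mul, neg_add, neg_neg] at h4
    simpa using h4
  have e2 : D * X = 0 := by
    rw [hX, mul_assoc X, mul_assoc X, h1, mul_neg, neg_eq_zero, ← hX] at e1
    exact e1
  calc D = -(D * (Z * Z)) := by rw [← mul_assoc, h1, neg_neg]
    _ = -(D * X * X * Z * Z + D * Z * X * X * Z) := by rw [h3]; noncomm_ring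
    _ = -(D * X * X * Z * Z + Z * (D * X) * X * Z) := by rw [hZ]; noncomm_ring
    _ = 0 := by rw [e2]; simp

variable {d p : ℕ} {c' : Submodule ℝ (Mat d p)}

/-- `Z` rotates the plane `(u, w)`, so `-Z²` is the projection onto it. `X` exchanges `u`, in this
plane, with the timelike vector, outside it, up to sign, which is the second relation. The third
splits the projection into its parts along `u` and `w`. -/
theorem offDiag_relations {u : Fin (d - p) → ℝ} {w : Fin (p + 2) → ℝ} (hu : u ⬝ᵥ u = 1)
    (hw : w ⬝ᵥ w = 1) (hwe : w ⬝ᵥ lastVec p = 0) {X Z : Mat d p}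
    (hX : X = offDiag d p (vecMulVec u (lastVec p))) (hZ : Z = offDiag d p (vecMulVec u w)) :
    Z * Z * Z = -Z ∧ X = -(Z * Z * X + X * Z * Z) ∧
      Z * Z = X * X * Z * Z + Z * X * X * Z := by
  have hew : lastVec p ⬝ᵥ w = 0 := by rw [dotProduct_comm, hwe]
  have hX' : X = fromBlocks 0 (-vecMulVec u (lastVec p)) (-vecMulVec (lastVec p) u) 0 := by
    rw [hX, offDiag_apply, vecMulVec_mul, ← mulVec_transpose, eta₂_transpose, eta₂_mulVec_lastVec,
      vecMulVec_neg, transpose_vecMulVec]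
  have hZ' : Z = fromBlocks 0 (vecMulVec u w) (-vecMulVec w u) 0 := by
    rw [hZ, offDiag_apply, vecMulVec_mul, ← mulVec_transpose, eta₂_transpose,
      eta₂_mulVec_of_perp hwe, transpose_vecMulVec]
  rw [hX', hZ']
  simp only [fromBlocks_multiply, fromBlocks_neg, fromBlocks_add, Matrix.mul_zero, Matrix.zero_mul,
    add_zero, zero_add, Matrix.mul_neg, Matrix.neg_mul, vecMulVec_mul_vecMulVec, hu, hw, hwe, hew,
    lastVec_dotProduct_self, one_smul, zero_smul, vecMulVec_zero, zero_dotProduct, neg_neg,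
    neg_zero]
  rw [show vecMulVec w (0 : Fin (d - p) → ℝ) = 0 by ext; simp [vecMulVec_apply], zero_add]
  exact ⟨trivial, rfl, trivial⟩

/-- An element of a one-parameter group whose square centralizes a suitable boost has order two. -/
theorem exp_mul_exp_eq_one {u : Fin (d - p) → ℝ} {w : Fin (p + 2) → ℝ} (hu : u ⬝ᵥ u = 1)
    (hw : w ⬝ᵥ w = 1) (hwe : w ⬝ᵥ lastVec p = 0) {T₀ : Mat d p} {r : ℝ}
    (hT₀ : T₀ = r • offDiag d p (vecMulVec u w))
    (h : NormedSpace.exp T₀ * NormedSpace.exp T₀ * offDiag d p (vecMulVec u (lastVec p)) =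
      offDiag d p (vecMulVec u (lastVec p)) * (NormedSpace.exp T₀ * NormedSpace.exp T₀)) :
    NormedSpace.exp T₀ * NormedSpace.exp T₀ = 1 := by
  set X := offDiag d p (vecMulVec u (lastVec p)) with hX
  set Z := offDiag d p (vecMulVec u w) with hZ
  obtain ⟨h1, h2, h3⟩ := offDiag_relations hu hw hwe hX hZ
  set g := NormedSpace.exp T₀
  have hgZ : g * Z = Z * g := exp_mul_eq_mul_exp (by
    rw [hT₀, Matrix.smul_mul, Matrix.mul_smul])
  have hgZZ : g * (1 + Z * Z) = 1 + Z * Z := by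
    have e : g * (1 + Z * Z) = (1 + Z * Z) * NormedSpace.exp (0 : Mat d p) := exp_mul_eq_mul_exp (by
      rw [hT₀, Matrix.mul_zero, Matrix.smul_mul, Matrix.mul_add, ← Matrix.mul_assoc, h1,
        Matrix.mul_one, add_neg_cancel, smul_zero])
    rw [e, NormedSpace.exp_zero, Matrix.mul_one]
  rw [← sub_eq_zero]
  refine eq_zero_of_mul_relations (X := X) (Z := Z) ?_ ?_ ?_ h2 h3
  · rw [Matrix.sub_mul, Matrix.mul_sub, Matrix.one_mul, Matrix.mul_one, Matrix.mul_assoc, hgZ,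
      ← Matrix.mul_assoc, hgZ, Matrix.mul_assoc]
  · rw [Matrix.sub_mul, Matrix.mul_sub, Matrix.one_mul, Matrix.mul_one, h]
  · have e : (g * g - 1) * (1 + Z * Z) = 0 := by
      rw [Matrix.sub_mul, Matrix.mul_assoc, hgZZ, hgZZ, Matrix.one_mul, sub_self]
    rw [Matrix.mul_add, Matrix.mul_one, ← Matrix.mul_assoc] at e
    exact eq_neg_of_add_eq_zero_right e

theorem exists_eq_vecMulVec_lastVec {X : Mat d p} (h1 : X ∈ lieGMinus d p) (h2 : X ∈ lieP d p) :
    ∃ x, X = offDiag d p (vecMulVec x (lastVec p)) := by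
  obtain ⟨M, rfl⟩ := mem_lieGMinus_iff_exists.1 h1
  exact ⟨_, congrArg _ (eq_vecMulVec_of_offDiag_mem_lieP h2)⟩

/-- Standard Cartan subsets in the case of unequal rank. -/
theorem exists_weightFrame_of_lt {t c : Submodule ℝ (Mat d p)} {τ : Mat d p}
    (hC : IsFundamentalCartan d p t c) (hC' : IsStandardCartan d p t c c' τ)
    (hlt : p + 1 < d - p) {n₀ : ℕ} (hn₀ : n₀ + 2 * (p + 2) = d + 2) :
    c' = c ∧ Nonempty (WeightFrame c' (p + 2) n₀) := by
  obtain ⟨u, w, hu, hw, hwe, ht⟩ := exists_span_of_maximal hC.maximal_t (n := p + 1) (by omega)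
  obtain ⟨v, hv, huv, hc⟩ := exists_span_of_fundamental hC rfl hlt hu hw hwe ht
  obtain ⟨t', a', hdec, ht', ha, ha'⟩ := hC'.decomp
  have hvmem : offDiag d p (vecMulVec v (lastVec p)) ∈ c := by
    rw [hc]
    exact Submodule.subset_span ⟨0, by simp⟩
  have hle : c' ≤ c := by
    rw [hdec, sup_le_iff]
    -- The boosts of `𝔞'` commute with the one in `𝔞`, hence are multiples of it, so `𝔠'` lies in
    -- `𝔠`. The equality of dimensions does the rest.
    refine ⟨ht'.trans hC.le, fun X hX => ?_⟩
    have hXc' : X ∈ c' := by rw [hdec]; exact Submodule.mem_sup_right hX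
    obtain ⟨x, rfl⟩ := exists_eq_vecMulVec_lastVec (hC'.le_minus hXc') (ha' hX)
    have hvc' : offDiag d p (vecMulVec v (lastVec p)) ∈ c' := by
      rw [hdec]
      exact Submodule.mem_sup_right (ha ⟨hvmem, offDiag_vecMulVec_mem_lieP v⟩)
    rw [eq_smul_of_vecMulVec_comm hv (vecMulVec_comm_of_lastVec (hC'.comm _ hvc' _ hXc')),
      smul_vecMulVec, map_smul]
    exact Submodule.smul_mem _ _ hvmem
  have heq : c' = c := Submodule.eq_of_le_of_finrank_eq hle hC'.finrank_eq
  refine ⟨heq, WeightFrame.nonempty_of_span (Or.inr rfl) (by omega)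
    (ε := Fin.cons (-1) fun _ => 1) (fun i j => ?_) (fun i => ?_) (fun i j => ?_) (heq.trans hc)⟩
  · refine Fin.cases ?_ (fun i => ?_) i <;> refine Fin.cases ?_ (fun j => ?_) j
    · simpa using hv
    · simpa [(Fin.succ_ne_zero j).symm, dotProduct_comm v] using huv j
    · simpa [Fin.succ_ne_zero i] using huv i
    · simpa using hu i j
  · exact Fin.cases (by simp) (fun i => by simp) i
  · refine Fin.cases ?_ (fun i => ?_) i <;> refine Fin.cases ?_ (fun j => ?_) j
    · simp [eta₂_mulVec_lastVec, lastVec_dotProduct_self]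
    · simp [(Fin.succ_ne_zero j).symm, eta₂_mulVec_of_perp (hwe j), dotProduct_comm (lastVec p),
        hwe]
    · simp [Fin.succ_ne_zero i, eta₂_mulVec_lastVec, hwe]
    · simpa [eta₂_mulVec_of_perp (hwe j)] using hw i j

/-- The standard Cartan subspaces in the case of equal rank. -/
theorem exists_span_of_standard {t c : Submodule ℝ (Mat d p)} {τ : Mat d p}
    (hC' : IsStandardCartan d p t c c' τ) (hct : c = t) {n : ℕ} (hn : n = d - p)
    {u : Fin n → Fin (d - p) → ℝ} {w : Fin n → Fin (p + 2) → ℝ}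
    (hu : ∀ i j, u i ⬝ᵥ u j = if i = j then 1 else 0)
    (hw : ∀ i j, w i ⬝ᵥ w j = if i = j then 1 else 0) (hwe : ∀ i, w i ⬝ᵥ lastVec p = 0)
    (ht : t = Submodule.span ℝ (Set.range fun j => offDiag d p (vecMulVec (u j) (w j)))) :
    c' = t ∨ ∃ j₀, c' = Submodule.span ℝ (Set.range fun j => offDiag d p
      (vecMulVec (u j) (if j = j₀ then lastVec p else w j))) := by
  have hfin : Module.finrank ℝ c' = n := by
    rw [hC'.finrank_eq, hct, ht, finrank_span_eq_card (linearIndependent_offDiag hu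
      (fun _ => one_ne_zero) (eta₂_orthonormal hw hwe)), Fintype.card_fin]
  obtain ⟨t', a', hdec, ht', ha, ha'⟩ := hC'.decomp
  by_cases hbot : a' = ⊥
  · left
    rw [← hct]
    refine Submodule.eq_of_le_of_finrank_eq ?_ hC'.finrank_eq
    rw [hdec, hbot, sup_bot_eq, hct]
    exact ht'
  right
  obtain ⟨X, hX, hX0⟩ := Submodule.exists_mem_ne_zero_of_ne_bot hbot
  have ha'c' : a' ≤ c' := by rw [hdec]; exact le_sup_right
  have ht'c' : t' ≤ c' := by rw [hdec]; exact le_sup_left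
  obtain ⟨x, rfl⟩ := exists_eq_vecMulVec_lastVec (hC'.le_minus (ha'c' hX)) (ha' hX)
  have hexp : x = ∑ j, (u j ⬝ᵥ x) • u j := by
    have h1 := congrArg (fun A => A *ᵥ x)
      (sum_vecMulVec_eq_one u (by simp only [Fintype.card_fin]; omega) hu)
    simp only [sum_mulVec, vecMulVec_mulVec, op_smul_fun, one_mulVec] at h1
    exact h1.symm
  obtain ⟨j₀, hj₀⟩ : ∃ j, u j ⬝ᵥ x ≠ 0 := by
    by_contra! hcon
    apply hX0
    rw [hexp]
    simp [hcon]
  -- Rotations that occur in `𝔱'` must have `u j` orthogonal to the boost direction `x`; the others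
  -- are replaced by zero, and the boost itself takes the place `j₀`.
  let g : Fin n → Mat d p := fun j => if j = j₀ then offDiag d p (vecMulVec x (lastVec p)) else
    if u j ⬝ᵥ x = 0 then offDiag d p (vecMulVec (u j) (w j)) else 0
  have hle : c' ≤ Submodule.span ℝ (Set.range g) := by
    rw [hdec, sup_le_iff]
    constructor
    · intro T hT
      obtain ⟨a, rfl⟩ := exists_sum_of_mem_span (ht ▸ ht' hT)
      -- The lower block relation is applied to the timelike vector and paired with `w k`.
      have h1 := (offDiag_mul_comm_iff.1 (hC'.comm _ (ht'c' hT) _ (ha'c' hX))).2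
      have h2 := congrArg (fun A => A *ᵥ lastVec p) h1
      have h3 : ∀ k, a k * (u k ⬝ᵥ x) = 0 := by
        intro k
        have h4 := congrArg (fun v => w k ⬝ᵥ v) h2
        simp only [transpose_sum, transpose_smul, transpose_vecMulVec, ← mulVec_mulVec, sum_mulVec,
          smul_mulVec, vecMulVec_mulVec, op_smul_fun, lastVec_dotProduct_self, one_smul,
          dotProduct_smul, dotProduct_sum, hw, hwe, smul_eq_mul, mul_ite, mul_one,
          mul_zero, Finset.sum_ite_eq, Finset.mem_univ, if_true] at h4
        exact h4
      rw [map_sum]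
      refine Submodule.sum_mem _ fun j _ => ?_
      rw [map_smul]
      by_cases haj : a j = 0
      · rw [haj, zero_smul]; exact zero_mem _
      · have huj : u j ⬝ᵥ x = 0 := (mul_eq_zero.1 (h3 j)).resolve_left haj
        refine Submodule.smul_mem _ _ (Submodule.subset_span ⟨j, ?_⟩)
        have hjj₀ : j ≠ j₀ := fun h => hj₀ (h ▸ huj)
        simp [g, hjj₀, huj]
    · intro Y hY
      obtain ⟨y, rfl⟩ := exists_eq_vecMulVec_lastVec (hC'.le_minus (ha'c' hY)) (ha' hY)
      have h1 := congrArg (fun A => u j₀ ᵥ* A)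
        (vecMulVec_comm_of_lastVec (hC'.comm _ (ha'c' hX) _ (ha'c' hY)))
      simp only [vecMul_vecMulVec] at h1
      have h2 : y = ((u j₀ ⬝ᵥ y) / (u j₀ ⬝ᵥ x)) • x := by
        rw [div_eq_inv_mul, mul_smul, ← h1, smul_smul, inv_mul_cancel₀ hj₀, one_smul]
      rw [h2, smul_vecMulVec, map_smul]
      exact Submodule.smul_mem _ _ (Submodule.subset_span ⟨j₀, by simp [g]⟩)
  have hcard : (Set.range g).finrank ℝ = n := by
    refine le_antisymm ?_ ?_
    · simpa using finrank_range_le_card (R := ℝ) g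
    · exact hfin.symm.le.trans (Submodule.finrank_mono hle)
  -- `𝔠'` has dimension `n` and lies in the span of these `n` vectors, so none of them is zero.
  -- Hence `x` is orthogonal to every `u j` except `u j₀`.
  have hind : LinearIndependent ℝ g := by
    rw [linearIndependent_iff_card_eq_finrank_span, hcard, Fintype.card_fin]
  have hperp : ∀ j, j ≠ j₀ → u j ⬝ᵥ x = 0 := by
    intro j hj
    by_contra hne
    exact hind.ne_zero j (by simp [g, hj, hne])
  have hx : x = (u j₀ ⬝ᵥ x) • u j₀ := by
    conv_lhs => rw [hexp]
    exact Finset.sum_eq_single j₀ (fun j _ hj => by rw [hperp j hj, zero_smul]) (by simp)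
  refine ⟨j₀, ?_⟩
  have hle' : c' ≤ Submodule.span ℝ (Set.range fun j => offDiag d p
      (vecMulVec (u j) (if j = j₀ then lastVec p else w j))) := by
    refine hle.trans (Submodule.span_le.2 ?_)
    rintro _ ⟨j, rfl⟩
    by_cases hj : j = j₀
    · simp only [g, hj, if_true]
      rw [hx, smul_vecMulVec, map_smul]
      exact Submodule.smul_mem _ _ (Submodule.subset_span ⟨j₀, by simp⟩)
    · simp only [g, hj, if_false, hperp j hj, if_true]
      exact Submodule.subset_span ⟨j, by simp [hj]⟩
  refine Submodule.eq_of_le_of_finrank_le hle' ?_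
  rw [hfin]
  have h := finrank_range_le_card (R := ℝ) fun j => offDiag d p
      (vecMulVec (u j) (if j = j₀ then lastVec p else w j))
  rwa [Fintype.card_fin] at h

theorem eta₂_orthogonal_update {n : ℕ} {w : Fin n → Fin (p + 2) → ℝ}
    (hw : ∀ i j, w i ⬝ᵥ w j = if i = j then 1 else 0) (hwe : ∀ i, w i ⬝ᵥ lastVec p = 0)
    (j₀ i j : Fin n) :
    (if i = j₀ then lastVec p else w i) ⬝ᵥ eta₂ p *ᵥ (if j = j₀ then lastVec p else w j) =
      if i = j then (if i = j₀ then (-1 : ℝ) else 1) else 0 := by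
  by_cases hi : i = j₀ <;> by_cases hj : j = j₀
  · simp [hi, hj, eta₂_mulVec_lastVec, lastVec_dotProduct_self]
  · simp [hi, hj, eta₂_mulVec_of_perp (hwe j), dotProduct_comm (lastVec p), hwe, Ne.symm hj]
  · simp [hi, hj, eta₂_mulVec_lastVec, hwe]
  · simp [hi, hj, eta₂_mulVec_of_perp (hwe j), hw]

/-- The involution inverts `τ = exp T` and negates `X`. Antiinvariance of `τ⁻¹ X τ` therefore says
`τ X τ⁻¹ = τ⁻¹ X τ`. -/
theorem exp_mul_exp_comm_of_standard {t c : Submodule ℝ (Mat d p)} {T : Mat d p}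
    (hC' : IsStandardCartan d p t c c' (NormedSpace.exp T)) (hT : T ∈ lieGMinus d p) {X : Mat d p}
    (hX : X ∈ c') :
    NormedSpace.exp T * NormedSpace.exp T * X = X * (NormedSpace.exp T * NormedSpace.exp T) := by
  have hinv : (NormedSpace.exp T)⁻¹ = NormedSpace.exp (-T) :=
    Matrix.inv_eq_right_inv (exp_mul_exp_neg T)
  have h1 := (mem_lieGMinus.1 (hC'.le_Ad X hX)).2
  rw [hinv] at h1
  have hTS := (mem_lieGMinus.1 hT).2
  have hXS := (mem_lieGMinus.1 (hC'.le_minus hX)).2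
  have e1 : T * sigmaMat d p = sigmaMat d p * -T := by
    rw [← hTS, Matrix.mul_assoc, ← Matrix.mul_assoc, ← Matrix.mul_assoc, sigmaMat_mul_self,
      Matrix.one_mul]
  have e2 : -T * sigmaMat d p = sigmaMat d p * T := by
    rw [Matrix.neg_mul, e1, Matrix.mul_neg, neg_neg]
  have e3 : NormedSpace.exp T * sigmaMat d p = sigmaMat d p * NormedSpace.exp (-T) :=
    exp_mul_eq_mul_exp e1
  have e4 : NormedSpace.exp (-T) * sigmaMat d p = sigmaMat d p * NormedSpace.exp T :=
    exp_mul_eq_mul_exp e2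
  have h2 : NormedSpace.exp T * X * NormedSpace.exp (-T) =
      NormedSpace.exp (-T) * X * NormedSpace.exp T := by
    have h3 : sigmaMat d p * (NormedSpace.exp (-T) * X * NormedSpace.exp T) * sigmaMat d p =
        NormedSpace.exp T * (sigmaMat d p * X * sigmaMat d p) * NormedSpace.exp (-T) := by
      calc sigmaMat d p * (NormedSpace.exp (-T) * X * NormedSpace.exp T) * sigmaMat d p
          = (sigmaMat d p * NormedSpace.exp (-T)) * X * (NormedSpace.exp T * sigmaMat d p) := by
            simp only [Matrix.mul_assoc]
        _ = _ := by rw [e3, ← e3]; simp only [Matrix.mul_assoc]; rw [e3]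
    rw [h3, hXS, Matrix.mul_neg, Matrix.neg_mul, neg_inj] at h1
    exact h1
  calc NormedSpace.exp T * NormedSpace.exp T * X
      = NormedSpace.exp T * (NormedSpace.exp T * X * (NormedSpace.exp (-T) * NormedSpace.exp T)) := by
        rw [exp_neg_mul_exp, Matrix.mul_one, Matrix.mul_assoc]
    _ = NormedSpace.exp T * (NormedSpace.exp T * X * NormedSpace.exp (-T)) * NormedSpace.exp T := by
        simp only [Matrix.mul_assoc]
    _ = NormedSpace.exp T * NormedSpace.exp (-T) * X * (NormedSpace.exp T * NormedSpace.exp T) := by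
        rw [h2]; simp only [Matrix.mul_assoc]
    _ = _ := by rw [exp_mul_exp_neg, Matrix.one_mul]

/-- Every standard Cartan subset is of the form `exp(𝔠') t₀` with an involution `t₀`, and `𝔠'` has
a weight basis. -/
theorem exists_weightFrame (hp : p ≤ d) {t c : Submodule ℝ (Mat d p)} {τ : Mat d p}
    (hC : IsFundamentalCartan d p t c) (hC' : IsStandardCartan d p t c c' τ) :
    ∃ n₀, n₀ + 2 * min (p + 2) (d - p) = d + 2 ∧
      Nonempty (WeightFrame c' (min (p + 2) (d - p)) n₀) ∧
      ∃ T₀ ∈ t, ∃ T' ∈ c', NormedSpace.exp T₀ * NormedSpace.exp T₀ = 1 ∧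
        τ = NormedSpace.exp T' * NormedSpace.exp T₀ := by
  obtain ⟨T, hT, hτ⟩ := hC'.mem_T
  rw [Matrix.mul_one] at hτ
  subst hτ
  rcases lt_or_ge (p + 1) (d - p) with hlt | hge
  · have hmin : min (p + 2) (d - p) = p + 2 := by omega
    rw [hmin]
    obtain ⟨heq, hF⟩ := exists_weightFrame_of_lt hC hC' hlt (n₀ := d + 2 - 2 * (p + 2)) (by omega)
    -- Here `𝔱` lies in `𝔠 = 𝔠'`, so all of `τ` is absorbed into `exp(𝔠')` and `t₀ = 1`.
    refine ⟨_, by omega, hF, 0, zero_mem _, T, heq ▸ hC.le hT, ?_, ?_⟩ <;> simp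
  · obtain ⟨n, hn⟩ : ∃ n, n = d - p := ⟨_, rfl⟩
    have hmin : min (p + 2) (d - p) = n := by omega
    rw [hmin]
    obtain ⟨u, w, hu, hw, hwe, ht⟩ := exists_span_of_maximal hC.maximal_t (n := n) (by omega)
    have hct := eq_of_le_of_maximal hC hn hu hw hwe ht
    refine ⟨d + 2 - 2 * n, by omega, ?_⟩
    rcases exists_span_of_standard hC' hct hn hu hw hwe ht with heq | ⟨j₀, heq⟩
    · refine ⟨WeightFrame.nonempty_of_span (Or.inl hn) (by omega) hu (fun _ => one_ne_zero)
        (eta₂_orthonormal hw hwe) (heq.trans ht), 0, zero_mem _, T, heq ▸ hT, ?_, ?_⟩ <;> simp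
    · refine ⟨WeightFrame.nonempty_of_span (Or.inl hn) (by omega) hu
        (fun i => by split_ifs <;> norm_num) (eta₂_orthogonal_update hw hwe j₀) heq, ?_⟩
      have hmem : ∀ j, offDiag d p (vecMulVec (u j) (w j)) ∈ t := fun j => by
        rw [ht]; exact Submodule.subset_span ⟨j, rfl⟩
      obtain ⟨a, ha⟩ := exists_sum_of_mem_span (ht ▸ hT)
      -- Only the rotation in the plane `j₀` fails to lie in `𝔠'`; all other components of `T` are
      -- absorbed. Since `exp(T - T₀)` commutes with the boost, the commutation of the square of `τ`
      -- with it passes to the square of `exp T₀`.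
      set T₀ := a j₀ • offDiag d p (vecMulVec (u j₀) (w j₀)) with hT₀
      have hT₀t : T₀ ∈ t := Submodule.smul_mem _ _ (hmem j₀)
      have hT' : T - T₀ ∈ c' := by
        rw [ha, hT₀, map_sum, ← Finset.add_sum_erase _ _ (Finset.mem_univ j₀), map_smul,
          add_sub_cancel_left, heq]
        refine Submodule.sum_mem _ fun j hj => ?_
        rw [map_smul]
        refine Submodule.smul_mem _ _ (Submodule.subset_span ⟨j, ?_⟩)
        simp [Finset.ne_of_mem_erase hj]
      have hfac : NormedSpace.exp T = NormedSpace.exp (T - T₀) * NormedSpace.exp T₀ := by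
        rw [← exp_add_of_mem hC.maximal_t.1.2 (sub_mem hT hT₀t) hT₀t, sub_add_cancel]
      have hfac' : NormedSpace.exp T = NormedSpace.exp T₀ * NormedSpace.exp (T - T₀) := by
        rw [← exp_add_of_mem hC.maximal_t.1.2 hT₀t (sub_mem hT hT₀t), add_sub_cancel]
      have hXmem : offDiag d p (vecMulVec (u j₀) (lastVec p)) ∈ c' := by
        rw [heq]; exact Submodule.subset_span ⟨j₀, by simp⟩
      refine ⟨T₀, hT₀t, T - T₀, hT', exp_mul_exp_eq_one (by simpa using hu j₀ j₀)
        (by simpa using hw j₀ j₀) (hwe j₀) hT₀ ?_, hfac⟩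
      set X := offDiag d p (vecMulVec (u j₀) (lastVec p))
      have h1 := exp_mul_exp_comm_of_standard hC' (hC.maximal_t.1.1 hT).2 hXmem
      set g := NormedSpace.exp T₀
      set b := NormedSpace.exp (T - T₀) with hb
      have hbX : b * X = X * b := exp_mul_eq_mul_exp (hC'.comm _ hT' _ hXmem)
      have hbb : NormedSpace.exp (-(T - T₀)) * b = 1 := exp_neg_mul_exp _
      have hTT : NormedSpace.exp T * NormedSpace.exp T = b * b * (g * g) := by
        calc NormedSpace.exp T * NormedSpace.exp T = b * (g * b) * g := by
              rw [hfac]; simp only [Matrix.mul_assoc]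
          _ = _ := by rw [← hfac', hfac]; simp only [Matrix.mul_assoc]
      rw [hTT] at h1
      have h2 : b * (b * (g * g * X)) = b * (b * (X * (g * g))) := by
        calc b * (b * (g * g * X)) = b * b * (g * g) * X := by simp only [Matrix.mul_assoc]
          _ = X * b * b * (g * g) := by rw [h1]; simp only [Matrix.mul_assoc]
          _ = b * X * b * (g * g) := by rw [hbX]
          _ = b * (X * b) * (g * g) := by simp only [Matrix.mul_assoc]
          _ = b * (b * X) * (g * g) := by rw [hbX]
          _ = _ := by simp only [Matrix.mul_assoc]
      have hcancel : ∀ Y Y' : Mat d p, b * Y = b * Y' → Y = Y' := fun Y Y' h => by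
        rw [← Matrix.one_mul Y, ← hbb, Matrix.mul_assoc, h, ← Matrix.mul_assoc, hbb,
          Matrix.one_mul]
      exact hcancel _ _ (hcancel _ _ h2)

end Defect

end

/-! ### Assembly of the theorem. -/

theorem Defect.sigmaMat_mul_exp {d p : ℕ} {T₀ : Defect.Mat d p} (h : T₀ ∈ Defect.lieGMinus d p)
    (hsq : NormedSpace.exp T₀ * NormedSpace.exp T₀ = 1) :
    Defect.sigmaMat d p * NormedSpace.exp T₀ = NormedSpace.exp T₀ * Defect.sigmaMat d p := by
  have h1 := (Defect.mem_lieGMinus.1 h).2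
  have h2 : NormedSpace.exp (-T₀) * Defect.sigmaMat d p =
      Defect.sigmaMat d p * NormedSpace.exp T₀ := by
    apply Defect.exp_mul_eq_mul_exp
    rw [← h1, Matrix.mul_assoc, Defect.sigmaMat_mul_self, Matrix.mul_one]
  -- The involution inverts `exp T₀`, which is its own inverse.
  have h3 : NormedSpace.exp (-T₀) = NormedSpace.exp T₀ := by
    rw [← Matrix.mul_one (NormedSpace.exp (-T₀)), ← hsq, ← Matrix.mul_assoc,
      Defect.exp_neg_mul_exp, Matrix.one_mul]
  rw [← h2, h3]

theorem mainTheorem7 (d p : ℕ) (hp : p ≤ d) (t c : Submodule ℝ (Defect.Mat d p))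
    (hC : Defect.IsFundamentalCartan d p t c)
    (c' : Submodule ℝ (Defect.Mat d p)) (τ : Defect.Mat d p)
    (hC' : Defect.IsStandardCartan d p t c c' τ) :
    Module.finrank ℝ c' = min (p + 2) (d - p) ∧
    Nonempty (Defect.TraceDualBases (Defect.lieG d p) (Module.finrank ℝ (Defect.lieG d p))) ∧
    Nonempty (Defect.TraceDualBases c' (min (p + 2) (d - p))) ∧
    Defect.IsTypeBD d p (min (p + 2) (d - p)) c' ∧
    ∃ t₀ ∈ Defect.expCoset t 1, t₀ * t₀ = 1 ∧ Defect.expCoset c' t₀ = Defect.expCoset c' τ ∧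
      ∀ X : c', Defect.IsRegularSemisimple d p (NormedSpace.exp (X : Defect.Mat d p) * t₀) →
        (∀ α ∈ Defect.doubledRoots c', Complex.exp (α X) ≠ 1) ∧
        ∀ (f : Defect.Mat d p → ℂ), Defect.IsDefectBlock d p f →
        ∀ (m : ℕ) (Dg : Defect.TraceDualBases (Defect.lieG d p) m)
          (m' : ℕ) (Dc : Defect.TraceDualBases c' m')
          (ξ : Fin (min (p + 2) (d - p)) → Defect.Form c') (P : Finset (Defect.Form c')),
          Defect.IsOrthonormalFrame Dc (Defect.doubledRoots c') ξ →
          Defect.IsPositiveSystem (Defect.doubledRoots c') P →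
          Defect.casimirLeft Dg f (NormedSpace.exp (X : Defect.Mat d p) * t₀) =
              Defect.heckmanOpdam Dc ξ P (Defect.mult c')
                (fun Y : c' => f (NormedSpace.exp (Y : Defect.Mat d p) * t₀)) X ∧
            Defect.casimirRight Dg f (NormedSpace.exp (X : Defect.Mat d p) * t₀) =
              Defect.heckmanOpdam Dc ξ P (Defect.mult c')
                (fun Y : c' => f (NormedSpace.exp (Y : Defect.Mat d p) * t₀)) X := by
  obtain ⟨n₀, hn₀, ⟨F⟩, T₀, hT₀, T', hT', hsq, hτ⟩ := Defect.exists_weightFrame hp hC hC'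
  have hfin := F.finrank_eq
  have hT₀minus : T₀ ∈ Defect.lieGMinus d p := (hC.maximal_t.1.1 hT₀).2
  have hS := Defect.sigmaMat_mul_exp hT₀minus hsq
  refine ⟨hfin, Defect.nonempty_traceDualBases fun X hX h => Defect.trace_nondegenerate_lieG X hX h,
    ?_, F.isTypeBD (by omega) ?_, NormedSpace.exp T₀, ⟨T₀, hT₀, by rw [Matrix.mul_one]⟩, hsq, ?_,
    fun X hX => ?_⟩
  · have := Defect.nonempty_traceDualBases (V := c') fun X hX h => F.trace_nondegenerate X hX h
    rwa [hfin] at this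
  · rcases le_total (p + 2) (d - p) with h | h
    · rw [abs_of_nonneg]
      · have h2 : n₀ + 2 * p + 2 = d := by omega
        rw [← h2]; push_cast; ring
      · have h2 : 2 * p + 2 ≤ d := by omega
        have h3 : ((2 * p + 2 : ℕ) : ℝ) ≤ d := by exact_mod_cast h2
        push_cast at h3; linarith
    · rw [abs_of_nonpos]
      · have h2 : n₀ + d = 2 * p + 2 := by omega
        have h3 : ((n₀ + d : ℕ) : ℝ) = (2 * p + 2 : ℕ) := by rw [h2]
        push_cast at h3; linarith
      · have h2 : d ≤ 2 * p + 2 := by omega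
        have h3 : (d : ℝ) ≤ ((2 * p + 2 : ℕ) : ℝ) := by exact_mod_cast h2
        push_cast at h3; linarith
  -- `τ` and `t₀` differ by the factor `exp T'` with `T'` in `𝔠'`, which only translates the
  -- parameter.
  · ext x
    constructor
    · rintro ⟨X, hX, rfl⟩
      refine ⟨X - T', sub_mem hX hT', ?_⟩
      rw [hτ, ← Matrix.mul_assoc, ← Defect.exp_add_of_mem hC'.comm (sub_mem hX hT') hT',
        sub_add_cancel]
    · rintro ⟨X, hX, rfl⟩
      refine ⟨X + T', add_mem hX hT', ?_⟩
      rw [hτ, ← Matrix.mul_assoc, ← Defect.exp_add_of_mem hC'.comm hX hT']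
  · have hreg : ∀ α ∈ Defect.doubledRoots c', Complex.exp (α X) ≠ 1 := fun α hα =>
      Defect.exp_doubledRoot_ne_one hC'.le_minus hC'.comm hT₀minus.1 hsq hS X hX hα
    exact ⟨hreg, fun f hf m Dg m' Dc ξ P hξ hP =>
      Defect.casimir_eq_heckmanOpdam F hC'.le_minus hC'.comm hT₀minus.1 hsq hS X hreg hf Dg Dc
        hξ hP⟩
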